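/- **Setting.** Let $L\ge 2$, $d,N\ge 1$. Given training data $\mathbf x^1,\dots,\mathbf x^N\in\mathbb R^d$ with $|\mathbf x^n(i)|\le B$, labels $y^n\in\mathcal Y$, put $\bm X=[\mathbf x^1,\dots,\mathbf x^N]^\top\in\mathbb R^{N\times d}$. The activation $h:\mathbb R\to\mathbb R$ is differentiable with $|h|\le L_1$, $|h'|\le L_2$ and $h'$ $L_3$-Lipschitz; the loss $\phi:\mathbb R\times\mathcal Y\to\mathbb R$ is differentiable in its first argument with $|\phi_1'|\le L_4$ and $\phi_1'(\cdot,y)$ $L_5$-Lipschitz for every $y$. The functions $h,h'$ act entrywise on vectors, $\cdot$ is the entrywise product, and $\|\cdot\|_\infty$ is the max norm. **Discrete DNN and scaled gradient descent.** A DNN of width $m$ has weights $\hat{\mathbf w}_{1,j}=(\hat w_{1,i,j})_{i\le d}\in\mathbb R^d$ ($j\le m$), $\hat w_{\ell,i,j}$ ($2\le\ell\le L$, $i,j\le m$) and $\hat w_{L+1,i,1}$ ($i\le m$); its features are $\hat{\bm\theta}_{1,j}=\frac1d\bm X\hat{\mathbf w}_{1,j}$, $\hat{\bm\theta}_{\ell,j}=\frac1m\sum_i\hat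 w_{\ell,i,j}h(\hat{\bm\theta}_{\ell-1,i})\in\mathbb R^N$ ($2\le\ell\le L$), $\hat{\bm\theta}_{L+1,1}=\frac1m\sum_i\hat w_{L+1,i,1}h(\hat{\bm\theta}_{L,i})$, and its loss is $\hat{\mathcal L}=\frac1N\sum_n\phi(\hat{\bm\theta}_{L+1,1}(n),y^n)$. Scaled gradient descent with step size $\eta$ is $\hat w^{k+1}_{\ell,i,j}=\hat w^k_{\ell,i,j}-\eta\,m_{\ell-1}m_\ell\,\partial\hat{\mathcal L}/\partial\hat w_{\ell,i,j}(\hat{\mathbf w}^k)$ for all $\ell\in[L+1]$, where $m_0=d$, $m_1=\dots=m_L=m$, $m_{L+1}=1$. Write $\hat{\bm\theta}^k$, $\hat{\mathcal L}^k$ for the features and loss after $k$ steps. **Continuous DNN.** It consists of probability measures $p_1$ on $\mathbb R^d$ and $p_2,\dots,p_L$ on $\mathbb R^N$ and functions $w_2$ on $\mathrm{supp}\,p_1\times\mathrm{supp}\,p_2$, $w_\ell$ on $\mathrm{supp}\,p_{\ell-1}\times\mathrm{supp}\,p_\ell$ ($3\le\ell\le L$), $w_{L+1}$ on $\mathrm{supp}\,p_L$,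 such that $\int w_2(\mathbf w_1,\bm\theta_2)h(\bm\theta_1(\mathbf w_1))\,dp_1(\mathbf w_1)=\bm\theta_2$ for $\bm\theta_2\in\mathrm{supp}\,p_2$, where $\bm\theta_1(\mathbf w_1)=\frac1d\bm X\mathbf w_1$, and $\int w_\ell(\bm\theta_{\ell-1},\bm\theta_\ell)h(\bm\theta_{\ell-1})\,dp_{\ell-1}(\bm\theta_{\ell-1})=\bm\theta_\ell$ for $\bm\theta_\ell\in\mathrm{supp}\,p_\ell$, $3\le\ell\le L$. We say that it is *regular* with parameters $\sigma>0$, $C_1,\dots,C_4\ge0$ if: every $p_\ell$ is $\sigma$-sub-gaussian, i.e. $\mathbb E\exp((u^\top\bm\xi)^2/\sigma^2)\le e$ for $\bm\xi\sim p_\ell$ and every Euclidean unit vector $u$; for $2\le\ell\le L$, writing $v$ for the first argument ($v=\mathbf w_1$ if $\ell=2$, $v=\bm\theta_{\ell-1}$ otherwise), $|w_\ell(v,\bm\theta_\ell)|\le C_1(1+\|\bm\theta_\ell\|_\infty)$ and $|w_\ell(v,\bm\theta_\ell)-w_\ell(\bar v,\bar{\bm\theta}_\ell)|\le C_2(1+\|\bm\theta_\ell\|_\infty)(\|v-\bar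 v\|_\infty+\|\bm\theta_\ell-\bar{\bm\theta}_\ell\|_\infty)$ whenever all points lie in the supports and $\|v-\bar v\|_\infty<1$, $\|\bm\theta_\ell-\bar{\bm\theta}_\ell\|_\infty<1$; and $w_{L+1}$ is bounded by $C_3$ and $C_4$-Lipschitz on $\mathrm{supp}\,p_L$ with respect to $\|\cdot\|_\infty$. **Neural feature flow.** A trajectory $\Psi$ on $[0,T]$ assigns to the points of the supports functions of time $\mathbf w_1^t(\mathbf w_1)\in\mathbb R^d$, $\bm\theta_\ell^t(\bm\theta_\ell)\in\mathbb R^N$ ($2\le\ell\le L$), $w_2^t(\mathbf w_1,\bm\theta_2)$, $w_\ell^t(\bm\theta_{\ell-1},\bm\theta_\ell)$ ($3\le\ell\le L$), $w_{L+1}^t(\bm\theta_L)\in\mathbb R$, continuous in $t$ and measurable in the points. Put $\bm\theta_1^t(\mathbf w_1)=\frac1d\bm X\mathbf w_1^t(\mathbf w_1)$, and, with "point of layer $1$" meaning $\mathbf w_1$ and "point of layer $\ell$" meaning $\bm\theta_\ell$ for $\ell\ge2$ (denoted $z_\ell$), $$\bm\theta_{L+1}^t=\int w_{L+1}^t\,h(\bm\theta_L^t)\,dp_L,\quad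 \mathcal D_{L+1}^t=\big(\phi_1'(\bm\theta_{L+1}^t(n),y^n)\big)_{n\le N},\quad \mathcal D_L^t(z_L)=w_{L+1}^t(z_L)\,\mathcal D_{L+1}^t\cdot h'(\bm\theta_L^t(z_L)),$$ $$\mathcal D_\ell^t(z_\ell)=\Big[\int w_{\ell+1}^t(z_\ell,z_{\ell+1})\mathcal D_{\ell+1}^t(z_{\ell+1})\,dp_{\ell+1}(z_{\ell+1})\Big]\cdot h'(\bm\theta_\ell^t(z_\ell))\quad(1\le\ell\le L-1),$$ $$G^t_{L+1}(z_L)=\tfrac1N(\mathcal D_{L+1}^t)^\top h(\bm\theta_L^t(z_L)),\quad G_\ell^t(z_{\ell-1},z_\ell)=\tfrac1N\mathcal D_\ell^t(z_\ell)^\top h(\bm\theta_{\ell-1}^t(z_{\ell-1}))\ (2\le\ell\le L),\quad G_1^t(z_1)=\tfrac1N\bm X^\top\mathcal D_1^t(z_1),$$ $$\Gamma_1^t(z_1)=\tfrac1d\bm XG_1^t(z_1),\quad \Gamma_\ell^t(z_\ell)=\int w_\ell^t(z_{\ell-1},z_\ell)\,h'(\bm\theta_{\ell-1}^t(z_{\ell-1}))\cdot\Gamma_{\ell-1}^t(z_{\ell-1})+h(\bm\theta_{\ell-1}^t(z_{\ell-1}))\,G_\ell^t(z_{\ell-1},z_\ell)\,dp_{\ell-1}(z_{\ell-1})\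 (2\le\ell\le L).$$ $\Psi$ is a neural feature flow of the continuous DNN if for all $t\in[0,T]$ and all points of the supports $\mathbf w_1^t(\mathbf w_1)=\mathbf w_1-\int_0^tG_1^s(\mathbf w_1)\,ds$, $\bm\theta_\ell^t(\bm\theta_\ell)=\bm\theta_\ell-\int_0^t\Gamma_\ell^s(\bm\theta_\ell)\,ds$ ($2\le\ell\le L$), $w_\ell^t=w_\ell-\int_0^tG_\ell^s\,ds$ ($2\le\ell\le L+1$). Its loss is $\mathcal L^t=\frac1N\sum_n\phi(\bm\theta_{L+1}^t(n),y^n)$. **$\varepsilon_1$-independent initialization.** Random initial weights $\hat{\mathbf w}$ of width $m$ are $\varepsilon_1$-independent if there are a regular continuous DNN and mutually independent random vectors $\bar{\mathbf w}_{1,i}\sim p_1$ ($i\le m$), $\bar{\bm\theta}_{\ell,i}\sim p_\ell$ ($2\le\ell\le L$, $i\le m$) on the same probability space such that almost surely, for all indices, $\|\hat{\mathbf w}_{1,i}-\bar{\mathbf w}_{1,i}\|_\infty\le(1+\|\bar{\mathbf w}_{1,i}\|_\infty)\varepsilon_1$, $|\hat w_{2,i,j}-w_2(\bar{\mathbf w}_{1,i},\bar{\bm\theta}_{2,j})|\le(1+\|\bar{\mathbf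 w}_{1,i}\|_\infty+\|\bar{\bm\theta}_{2,j}\|_\infty)\varepsilon_1$, $|\hat w_{\ell,i,j}-w_\ell(\bar{\bm\theta}_{\ell-1,i},\bar{\bm\theta}_{\ell,j})|\le(1+\|\bar{\bm\theta}_{\ell-1,i}\|_\infty+\|\bar{\bm\theta}_{\ell,j}\|_\infty)\varepsilon_1$ ($3\le\ell\le L$), $|\hat w_{L+1,i,1}-w_{L+1}(\bar{\bm\theta}_{L,i})|\le(1+\|\bar{\bm\theta}_{L,i}\|_\infty)\varepsilon_1$. Given a neural feature flow of this continuous DNN, the ideal process is $\bar{\mathbf w}_{1,i}^t=\mathbf w_1^t(\bar{\mathbf w}_{1,i})$, $\bar{\bm\theta}_{\ell,i}^t=\bm\theta_\ell^t(\bar{\bm\theta}_{\ell,i})$, $\bar w_{2,i,j}^t=w_2^t(\bar{\mathbf w}_{1,i},\bar{\bm\theta}_{2,j})$, $\bar w_{\ell,i,j}^t=w_\ell^t(\bar{\bm\theta}_{\ell-1,i},\bar{\bm\theta}_{\ell,j})$ ($3\le\ell\le L$), $\bar w_{L+1,i,1}^t=w_{L+1}^t(\bar{\bm\theta}_{L,i})$.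 **Theorem.** For all $L,d,N$, $T\ge0$, $B,L_1,\dots,L_5,\sigma,C_1,\dots,C_4$ and $\kappa>0$ there are constants $\varepsilon_0\in(0,1]$, $A,A',A''>0$ and $a,b\in\mathbb N$, depending only on these parameters, such that the following holds for all data, $h$ and $\phi$ as above. Let $0<\varepsilon_1\le\varepsilon_0$, $0<\delta\le1$, $$m\ \ge\ A\,\varepsilon_1^{-2}\log^a\!\Big(\frac{e}{\varepsilon_1\delta}\Big),\qquad 0<\eta\le\kappa\,\varepsilon_1 .$$ Run scaled gradient descent with step size $\eta$ from an $\varepsilon_1$-independent initialization of width $m$, and consider the ideal process of a neural feature flow on $[0,T]$ of the corresponding continuous DNN. Then with probability at least $1-\delta$, simultaneously for all integers $0\le k\le\lfloor T/\eta\rfloor$, all $i,j\le m$, $$\|\hat{\mathbf w}_{1,i}^k-\bar{\mathbf w}_{1,i}^{k\eta}\|_\infty,\quad \|\hat{\bm\theta}_{\ell,i}^k-\bar{\bm\theta}_{\ell,i}^{k\eta}\|_\infty,\quad |\hat w_{\ell,i,j}^k-\bar w_{\ell,i,j}^{k\eta}|\ (2\le\ell\le L),\quad |\hat w_{L+1,i,1}^k-\bar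 w_{L+1,i,1}^{k\eta}|\ \ \le\ A'\,\varepsilon_1\log^b\!\Big(\frac{e\,m}{\delta}\Big),$$ $$\big|\hat{\mathcal L}^k-\mathcal L^{k\eta}\big|\ \le\ A''\,\varepsilon_1 .$$ -/

import Mathlib

open MeasureTheory ProbabilityTheory

noncomputable section

namespace DeepMeanField

/-- The data of the learning problem: activation `h`, loss `φ`, inputs `X n i = 𝐱ⁿ(i)`,
labels `y n`. -/
structure Problem (d N : ℕ) (Y : Type*) where
  h : ℝ → ℝ
  φ : ℝ → Y → ℝ
  X : Fin N → Fin d → ℝ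
  y : Fin N → Y

/-- The activation function is differentiable and bounded, with bounded and Lipschitz derivative. -/
structure ActivationAssumption (h : ℝ → ℝ) (L₁ L₂ L₃ : ℝ) : Prop where
  differentiable : Differentiable ℝ h
  bound : ∀ x, |h x| ≤ L₁
  deriv_bound : ∀ x, |deriv h x| ≤ L₂
  deriv_lipschitz : ∀ x y, |deriv h x - deriv h y| ≤ L₃ * |x - y|

/-- The loss is differentiable in its first argument, with bounded and Lipschitz derivative. -/
structure LossAssumption {Y : Type*} (φ : ℝ → Y → ℝ) (L₄ L₅ : ℝ) : Prop where
  differentiable : ∀ y, Differentiable ℝ (fun x => φ x y)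
  deriv_bound : ∀ y x, |deriv (fun z => φ z y) x| ≤ L₄
  deriv_lipschitz : ∀ y x₁ x₂,
    |deriv (fun z => φ z y) x₁ - deriv (fun z => φ z y) x₂| ≤ L₅ * |x₁ - x₂|

/-! ### Discrete DNN and scaled gradient descent -/

/-- The weights of a discrete DNN all of whose hidden layers have width `m`.
`w₁ i j` connects input `i` to node `j` of layer `1`, `w ℓ i j` (used for `2 ≤ ℓ ≤ L`) connects
node `i` of layer `ℓ - 1` to node `j` of layer `ℓ`, and `wOut i` connects node `i` of layer `L`
to the output. -/
@[ext]
structure Weights (d m : ℕ) where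
  w₁ : Fin d → Fin m → ℝ
  w : ℕ → Fin m → Fin m → ℝ
  wOut : Fin m → ℝ

namespace Weights

variable {d m : ℕ}

/-- Replace the single weight `w₁ i j` by `s`. -/
def setFirst (W : Weights d m) (i : Fin d) (j : Fin m) (s : ℝ) : Weights d m :=
  { W with w₁ := Function.update W.w₁ i (Function.update (W.w₁ i) j s) }

/-- Replace the single weight `w ℓ i j` by `s`. -/
def setMid (W : Weights d m) (ℓ : ℕ) (i j : Fin m) (s : ℝ) : Weights d m :=
  { W with
    w := Function.update W.w ℓ (Function.update (W.w ℓ) i (Function.update (W.w ℓ i) j s)) }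

/-- Replace the single weight `wOut i` by `s`. -/
def setOut (W : Weights d m) (i : Fin m) (s : ℝ) : Weights d m :=
  { W with wOut := Function.update W.wOut i s }

end Weights

section Discrete

variable {d N m : ℕ} {Y : Type*}

/-- The feature vector over the training samples of node `j` of layer `ℓ`, for `1 ≤ ℓ ≤ L`
(the value at `ℓ = 0` is a placeholder, never used). -/
def feature (P : Problem d N Y) (W : Weights d m) : ℕ → Fin m → Fin N → ℝ
  | 0 => fun _ _ => 0
  | 1 => fun j n => (1 / (d : ℝ)) * ∑ i, W.w₁ i j * P.X n i
  | ℓ + 2 => fun j n =>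
      (1 / (m : ℝ)) * ∑ i, W.w (ℓ + 2) i j * P.h (feature P W (ℓ + 1) i n)

/-- The output of the discrete DNN with `L` hidden layers. -/
def output (P : Problem d N Y) (L : ℕ) (W : Weights d m) (n : Fin N) : ℝ :=
  (1 / (m : ℝ)) * ∑ i, W.wOut i * P.h (feature P W L i n)

/-- The (unregularized) training loss of the discrete DNN. -/
def discreteLoss (P : Problem d N Y) (L : ℕ) (W : Weights d m) : ℝ :=
  (1 / (N : ℝ)) * ∑ n, P.φ (output P L W n) (P.y n)

/-- One step of scaled gradient descent: every weight between layers `ℓ - 1` and `ℓ` moves by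
`- η m_{ℓ-1} m_ℓ` times the partial derivative of the loss in that weight, where `m_0 = d`,
`m_ℓ = m` for `1 ≤ ℓ ≤ L`, and `m_{L+1} = 1`. -/
def gdStep (P : Problem d N Y) (L : ℕ) (η : ℝ) (W : Weights d m) : Weights d m where
  w₁ i j := W.w₁ i j - η * ((d : ℝ) * m) *
    deriv (fun s => discreteLoss P L (W.setFirst i j s)) (W.w₁ i j)
  w ℓ i j := W.w ℓ i j - η * ((m : ℝ) * m) *
    deriv (fun s => discreteLoss P L (W.setMid ℓ i j s)) (W.w ℓ i j)
  wOut i := W.wOut i - η * ((m : ℝ) * 1) *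
    deriv (fun s => discreteLoss P L (W.setOut i s)) (W.wOut i)

/-- The weights after `k` steps of scaled gradient descent. -/
def gd (P : Problem d N Y) (L : ℕ) (η : ℝ) (W : Weights d m) (k : ℕ) : Weights d m :=
  (gdStep P L η)^[k] W

end Discrete

/-! ### Continuous DNN -/

/-- The data of a continuous DNN: laws `p₁` of the first-layer weights and `p ℓ` of the features
of layer `ℓ` (used for `2 ≤ ℓ ≤ L`), and connecting weights `w₂`, `w ℓ` (used for `3 ≤ ℓ ≤ L`),
`wOut` (the weights of layer `L + 1`). Only values on the supports are ever used. -/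
structure ContinuousDNN (d N : ℕ) where
  p₁ : Measure (Fin d → ℝ)
  p : ℕ → Measure (Fin N → ℝ)
  w₂ : (Fin d → ℝ) → (Fin N → ℝ) → ℝ
  w : ℕ → (Fin N → ℝ) → (Fin N → ℝ) → ℝ
  wOut : (Fin N → ℝ) → ℝ

/-- The features `𝛉₁(𝐰₁) = X 𝐰₁ / d` of a first-layer node. -/
def firstFeature {d N : ℕ} {Y : Type*} (P : Problem d N Y) (u : Fin d → ℝ) (n : Fin N) : ℝ :=
  (1 / (d : ℝ)) * ∑ i, P.X n i * u i

/-- `Q` is a continuous DNN with `L` hidden layers for the problem `P`: the `p`'s are probability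
measures and the forward-propagation constraints hold. -/
structure IsContinuousDNN {d N : ℕ} {Y : Type*} (P : Problem d N Y) (L : ℕ)
    (Q : ContinuousDNN d N) : Prop where
  prob₁ : IsProbabilityMeasure Q.p₁
  prob : ∀ ℓ ∈ Finset.Icc 2 L, IsProbabilityMeasure (Q.p ℓ)
  forward₂ : ∀ θ ∈ (Q.p 2).support, ∀ n,
    Integrable (fun u => Q.w₂ u θ * P.h (firstFeature P u n)) Q.p₁ ∧
    ∫ u, Q.w₂ u θ * P.h (firstFeature P u n) ∂Q.p₁ = θ n
  forward : ∀ ℓ ∈ Finset.Icc 3 L, ∀ θ ∈ (Q.p ℓ).support, ∀ n,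
    Integrable (fun θ' => Q.w ℓ θ' θ * P.h (θ' n)) (Q.p (ℓ - 1)) ∧
    ∫ θ', Q.w ℓ θ' θ * P.h (θ' n) ∂(Q.p (ℓ - 1)) = θ n

/-- A law on `ℝᵏ` is `σ`-sub-gaussian: `𝔼 exp((uᵀx)² / σ²) ≤ e` for all Euclidean unit `u`. -/
def SubGaussian {k : ℕ} (p : Measure (Fin k → ℝ)) (σ : ℝ) : Prop :=
  ∀ u : Fin k → ℝ, ∑ i, u i ^ 2 = 1 →
    ∫⁻ x, ENNReal.ofReal (Real.exp ((∑ i, u i * x i) ^ 2 / σ ^ 2)) ∂p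
      ≤ ENNReal.ofReal (Real.exp 1)

/-- Sub-gaussian initial laws; initial weights of sublinear growth, locally Lipschitz with
constants of sublinear growth; bounded and Lipschitz weights in the last layer.
`‖·‖` on `Fin k → ℝ` is the `ℓ∞` norm. -/
structure InitAssumption {d N : ℕ} (L : ℕ) (Q : ContinuousDNN d N) (σ C₁ C₂ C₃ C₄ : ℝ) :
    Prop where
  subGaussian₁ : SubGaussian Q.p₁ σ
  subGaussian : ∀ ℓ ∈ Finset.Icc 2 L, SubGaussian (Q.p ℓ) σ
  growth₂ : ∀ u ∈ Q.p₁.support, ∀ θ ∈ (Q.p 2).support, |Q.w₂ u θ| ≤ C₁ * (1 + ‖θ‖)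
  growth : ∀ ℓ ∈ Finset.Icc 3 L, ∀ θ' ∈ (Q.p (ℓ - 1)).support, ∀ θ ∈ (Q.p ℓ).support,
    |Q.w ℓ θ' θ| ≤ C₁ * (1 + ‖θ‖)
  lipschitz₂ : ∀ u ∈ Q.p₁.support, ∀ v ∈ Q.p₁.support ∩ Metric.ball u 1,
    ∀ θ ∈ (Q.p 2).support, ∀ ϑ ∈ (Q.p 2).support ∩ Metric.ball θ 1,
    |Q.w₂ u θ - Q.w₂ v ϑ| ≤ C₂ * (1 + ‖θ‖) * (‖u - v‖ + ‖θ - ϑ‖)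
  lipschitz : ∀ ℓ ∈ Finset.Icc 3 L,
    ∀ θ' ∈ (Q.p (ℓ - 1)).support, ∀ ϑ' ∈ (Q.p (ℓ - 1)).support ∩ Metric.ball θ' 1,
    ∀ θ ∈ (Q.p ℓ).support, ∀ ϑ ∈ (Q.p ℓ).support ∩ Metric.ball θ 1,
    |Q.w ℓ θ' θ - Q.w ℓ ϑ' ϑ| ≤ C₂ * (1 + ‖θ‖) * (‖θ' - ϑ'‖ + ‖θ - ϑ‖)
  boundOut : ∀ θ ∈ (Q.p L).support, |Q.wOut θ| ≤ C₃
  lipschitzOut : ∀ θ ∈ (Q.p L).support, ∀ ϑ ∈ (Q.p L).support,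
    |Q.wOut θ - Q.wOut ϑ| ≤ C₄ * ‖θ - ϑ‖

/-! ### Neural feature flow -/

/-- Trajectories, as functions of the initial node(s) and of time, of the first-layer weights
(`w₁`), of the weights of layers `2`, `3 ≤ ℓ ≤ L`, `L + 1` (`w₂`, `w ℓ`, `wOut`), and of the
features of layers `2 ≤ ℓ ≤ L` (`θ ℓ`). -/
structure Trajectory (d N : ℕ) where
  w₁ : (Fin d → ℝ) → ℝ → Fin d → ℝ
  w₂ : (Fin d → ℝ) → (Fin N → ℝ) → ℝ → ℝ
  w : ℕ → (Fin N → ℝ) → (Fin N → ℝ) → ℝ → ℝ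
  wOut : (Fin N → ℝ) → ℝ → ℝ
  θ : ℕ → (Fin N → ℝ) → ℝ → Fin N → ℝ

section Flow

variable {d N : ℕ} {Y : Type*}

/-- The network output `𝛉_{L+1}(Ψ, t)`. -/
def flowOutput (P : Problem d N Y) (L : ℕ) (Q : ContinuousDNN d N) (Ψ : Trajectory d N)
    (t : ℝ) (n : Fin N) : ℝ :=
  ∫ θ, Ψ.wOut θ t * P.h (Ψ.θ L θ t n) ∂(Q.p L)

/-- The training loss along the flow. -/
def flowLoss (P : Problem d N Y) (L : ℕ) (Q : ContinuousDNN d N) (Ψ : Trajectory d N)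
    (t : ℝ) : ℝ :=
  (1 / (N : ℝ)) * ∑ n, P.φ (flowOutput P L Q Ψ t n) (P.y n)

/-- `D_{L+1}(Ψ, t)`. -/
def backOut (P : Problem d N Y) (L : ℕ) (Q : ContinuousDNN d N) (Ψ : Trajectory d N)
    (t : ℝ) (n : Fin N) : ℝ :=
  deriv (fun z => P.φ z (P.y n)) (flowOutput P L Q Ψ t n)

/-- Backward propagation counted from the top: `backAux r` is `D_{L-r}(·; Ψ, t)`. -/
def backAux (P : Problem d N Y) (L : ℕ) (Q : ContinuousDNN d N) (Ψ : Trajectory d N) (t : ℝ) :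
    ℕ → (Fin N → ℝ) → Fin N → ℝ
  | 0 => fun θ n => Ψ.wOut θ t * backOut P L Q Ψ t n * deriv P.h (Ψ.θ L θ t n)
  | r + 1 => fun θ n =>
      (∫ θ', Ψ.w (L - r) θ θ' t * backAux P L Q Ψ t r θ' n ∂(Q.p (L - r)))
        * deriv P.h (Ψ.θ (L - (r + 1)) θ t n)

/-- `D_ℓ(θ; Ψ, t)` for `2 ≤ ℓ ≤ L`. -/
def back (P : Problem d N Y) (L : ℕ) (Q : ContinuousDNN d N) (Ψ : Trajectory d N) (t : ℝ)
    (ℓ : ℕ) (θ : Fin N → ℝ) (n : Fin N) : ℝ :=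
  backAux P L Q Ψ t (L - ℓ) θ n

/-- `D_1(u; Ψ, t)`. -/
def backFirst (P : Problem d N Y) (L : ℕ) (Q : ContinuousDNN d N) (Ψ : Trajectory d N) (t : ℝ)
    (u : Fin d → ℝ) (n : Fin N) : ℝ :=
  (∫ θ, Ψ.w₂ u θ t * back P L Q Ψ t 2 θ n ∂(Q.p 2))
    * deriv P.h (firstFeature P (Ψ.w₁ u t) n)

/-- Gradient of the weights of layer `L + 1`. -/
def gradOut (P : Problem d N Y) (L : ℕ) (Q : ContinuousDNN d N) (Ψ : Trajectory d N) (t : ℝ)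
    (θ : Fin N → ℝ) : ℝ :=
  (1 / (N : ℝ)) * ∑ n, backOut P L Q Ψ t n * P.h (Ψ.θ L θ t n)

/-- Gradient of the weights of layer `3 ≤ ℓ ≤ L`. -/
def gradMid (P : Problem d N Y) (L : ℕ) (Q : ContinuousDNN d N) (Ψ : Trajectory d N) (t : ℝ)
    (ℓ : ℕ) (θ' θ : Fin N → ℝ) : ℝ :=
  (1 / (N : ℝ)) * ∑ n, back P L Q Ψ t ℓ θ n * P.h (Ψ.θ (ℓ - 1) θ' t n)

/-- Gradient of the weights of layer `2`. -/
def gradSecond (P : Problem d N Y) (L : ℕ) (Q : ContinuousDNN d N) (Ψ : Trajectory d N) (t : ℝ)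
    (u : Fin d → ℝ) (θ : Fin N → ℝ) : ℝ :=
  (1 / (N : ℝ)) * ∑ n, back P L Q Ψ t 2 θ n * P.h (firstFeature P (Ψ.w₁ u t) n)

/-- Gradient of the weights of layer `1`. -/
def gradFirst (P : Problem d N Y) (L : ℕ) (Q : ContinuousDNN d N) (Ψ : Trajectory d N) (t : ℝ)
    (u : Fin d → ℝ) (i : Fin d) : ℝ :=
  (1 / (N : ℝ)) * ∑ n, P.X n i * backFirst P L Q Ψ t u n

/-- Drift of the features of layer `1`, namely `X / d` applied to the gradient of the weights. -/
def driftFirst (P : Problem d N Y) (L : ℕ) (Q : ContinuousDNN d N) (Ψ : Trajectory d N) (t : ℝ)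
    (u : Fin d → ℝ) (n : Fin N) : ℝ :=
  (1 / (d : ℝ)) * ∑ i, P.X n i * gradFirst P L Q Ψ t u i

/-- Drift of the features of layer `2 ≤ ℓ ≤ L` (the values at `ℓ = 0, 1` are placeholders, never
used). -/
def drift (P : Problem d N Y) (L : ℕ) (Q : ContinuousDNN d N) (Ψ : Trajectory d N) (t : ℝ) :
    ℕ → (Fin N → ℝ) → Fin N → ℝ
  | 0 => fun _ _ => 0
  | 1 => fun _ _ => 0
  | 2 => fun θ n =>
      (∫ u, Ψ.w₂ u θ t * (deriv P.h (firstFeature P (Ψ.w₁ u t) n) * driftFirst P L Q Ψ t u n)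
        ∂Q.p₁)
      + ∫ u, P.h (firstFeature P (Ψ.w₁ u t) n) * gradSecond P L Q Ψ t u θ ∂Q.p₁
  | ℓ + 3 => fun θ n =>
      (∫ θ', Ψ.w (ℓ + 3) θ' θ t *
          (deriv P.h (Ψ.θ (ℓ + 2) θ' t n) * drift P L Q Ψ t (ℓ + 2) θ' n) ∂(Q.p (ℓ + 2)))
      + ∫ θ', P.h (Ψ.θ (ℓ + 2) θ' t n) * gradMid P L Q Ψ t (ℓ + 3) θ' θ ∂(Q.p (ℓ + 2))

/-- Admissible trajectories: continuous in time for all nodes in the supports, and measurable in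
the nodes at every time. -/
structure IsTrajectory (L : ℕ) (Q : ContinuousDNN d N) (T : ℝ) (Ψ : Trajectory d N) :
    Prop where
  continuous_w₁ : ∀ u ∈ Q.p₁.support, ContinuousOn (Ψ.w₁ u) (Set.Icc 0 T)
  continuous_w₂ : ∀ u ∈ Q.p₁.support, ∀ θ ∈ (Q.p 2).support,
    ContinuousOn (Ψ.w₂ u θ) (Set.Icc 0 T)
  continuous_w : ∀ ℓ ∈ Finset.Icc 3 L, ∀ θ' ∈ (Q.p (ℓ - 1)).support, ∀ θ ∈ (Q.p ℓ).support,
    ContinuousOn (Ψ.w ℓ θ' θ) (Set.Icc 0 T)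
  continuous_wOut : ∀ θ ∈ (Q.p L).support, ContinuousOn (Ψ.wOut θ) (Set.Icc 0 T)
  continuous_θ : ∀ ℓ ∈ Finset.Icc 2 L, ∀ θ ∈ (Q.p ℓ).support,
    ContinuousOn (Ψ.θ ℓ θ) (Set.Icc 0 T)
  measurable_w₁ : ∀ t ∈ Set.Icc 0 T, Measurable fun u : Q.p₁.support => Ψ.w₁ u t
  measurable_w₂ : ∀ t ∈ Set.Icc 0 T,
    Measurable fun q : Q.p₁.support × (Q.p 2).support => Ψ.w₂ q.1 q.2 t
  measurable_w : ∀ ℓ ∈ Finset.Icc 3 L, ∀ t ∈ Set.Icc 0 T,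
    Measurable fun q : (Q.p (ℓ - 1)).support × (Q.p ℓ).support => Ψ.w ℓ q.1 q.2 t
  measurable_wOut : ∀ t ∈ Set.Icc 0 T, Measurable fun θ : (Q.p L).support => Ψ.wOut θ t
  measurable_θ : ∀ ℓ ∈ Finset.Icc 2 L, ∀ t ∈ Set.Icc 0 T,
    Measurable fun θ : (Q.p ℓ).support => Ψ.θ ℓ θ t

/-- `Ψ` is a neural feature flow on `[0, T]` started from the continuous DNN `Q`. -/
structure IsNeuralFeatureFlow (P : Problem d N Y) (L : ℕ) (Q : ContinuousDNN d N) (T : ℝ)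
    (Ψ : Trajectory d N) : Prop extends IsTrajectory L Q T Ψ where
  flow_θ : ∀ t ∈ Set.Icc 0 T, ∀ ℓ ∈ Finset.Icc 2 L, ∀ θ ∈ (Q.p ℓ).support,
    Ψ.θ ℓ θ t = θ - ∫ s in (0 : ℝ)..t, drift P L Q Ψ s ℓ θ
  flow_w₁ : ∀ t ∈ Set.Icc 0 T, ∀ u ∈ Q.p₁.support,
    Ψ.w₁ u t = u - ∫ s in (0 : ℝ)..t, gradFirst P L Q Ψ s u
  flow_w₂ : ∀ t ∈ Set.Icc 0 T, ∀ u ∈ Q.p₁.support, ∀ θ ∈ (Q.p 2).support,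
    Ψ.w₂ u θ t = Q.w₂ u θ - ∫ s in (0 : ℝ)..t, gradSecond P L Q Ψ s u θ
  flow_w : ∀ t ∈ Set.Icc 0 T, ∀ ℓ ∈ Finset.Icc 3 L,
    ∀ θ' ∈ (Q.p (ℓ - 1)).support, ∀ θ ∈ (Q.p ℓ).support,
    Ψ.w ℓ θ' θ t = Q.w ℓ θ' θ - ∫ s in (0 : ℝ)..t, gradMid P L Q Ψ s ℓ θ' θ
  flow_wOut : ∀ t ∈ Set.Icc 0 T, ∀ θ ∈ (Q.p L).support,
    Ψ.wOut θ t = Q.wOut θ - ∫ s in (0 : ℝ)..t, gradOut P L Q Ψ s θ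

end Flow

/-! ### `ε`-independent initialization -/

/-- The random initial weights `W` of a discrete DNN of width `m` are `ε`-independent, as witnessed
by the continuous DNN `Q` and the mutually independent ideal nodes `u i ∼ p₁` (`𝐰̄_{1,i}`) and
`θ ℓ i ∼ p ℓ` (`𝛉̄_{ℓ,i}`, `2 ≤ ℓ ≤ L`). -/
structure IsEpsIndependent {d N m : ℕ} {Y Ω : Type*} [MeasurableSpace Ω] (P : Problem d N Y)
    (L : ℕ) (σ C₁ C₂ C₃ C₄ ε : ℝ) (μ : Measure Ω) (W : Ω → Weights d m)
    (Q : ContinuousDNN d N) (u : Fin m → Ω → Fin d → ℝ) (θ : ℕ → Fin m → Ω → Fin N → ℝ) :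
    Prop where
  isContinuousDNN : IsContinuousDNN P L Q
  initAssumption : InitAssumption L Q σ C₁ C₂ C₃ C₄
  measurable₁ : ∀ i, Measurable (u i)
  measurable : ∀ ℓ ∈ Finset.Icc 2 L, ∀ i, Measurable (θ ℓ i)
  law₁ : ∀ i, μ.map (u i) = Q.p₁
  law : ∀ ℓ ∈ Finset.Icc 2 L, ∀ i, μ.map (θ ℓ i) = Q.p ℓ
  /-- All the ideal nodes together are mutually independent. -/
  indep : iIndep (Sum.elim (fun i : Fin m => MeasurableSpace.comap (u i) inferInstance)
    (fun q : Finset.Icc 2 L × Fin m => MeasurableSpace.comap (θ q.1 q.2) inferInstance)) μ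
  close₁ : ∀ᵐ ω ∂μ, ∀ i, ‖(fun a => (W ω).w₁ a i) - u i ω‖ ≤ (1 + ‖u i ω‖) * ε
  close₂ : ∀ᵐ ω ∂μ, ∀ i j,
    |(W ω).w 2 i j - Q.w₂ (u i ω) (θ 2 j ω)| ≤ (1 + ‖u i ω‖ + ‖θ 2 j ω‖) * ε
  close : ∀ᵐ ω ∂μ, ∀ ℓ ∈ Finset.Icc 3 L, ∀ i j,
    |(W ω).w ℓ i j - Q.w ℓ (θ (ℓ - 1) i ω) (θ ℓ j ω)|
      ≤ (1 + ‖θ (ℓ - 1) i ω‖ + ‖θ ℓ j ω‖) * ε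
  closeOut : ∀ᵐ ω ∂μ, ∀ i,
    |(W ω).wOut i - Q.wOut (θ L i ω)| ≤ (1 + ‖θ L i ω‖) * ε

/-- The discrete DNN with weights `W` and the ideal discrete DNN that at time `t` consists of the
images of the ideal nodes `u i`, `θ ℓ i` under `Ψ` differ by at most `r` in all first-layer
weights, all features of the layers `2 ≤ ℓ ≤ L`, and all weights of the layers `2 ≤ ℓ ≤ L + 1`. -/
structure IsTrackedWithin {d N m : ℕ} {Y : Type*} (P : Problem d N Y) (L : ℕ)
    (Ψ : Trajectory d N) (u : Fin m → Fin d → ℝ) (θ : ℕ → Fin m → Fin N → ℝ)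
    (W : Weights d m) (t r : ℝ) : Prop where
  w₁ : ∀ i, ‖(fun a => W.w₁ a i) - Ψ.w₁ (u i) t‖ ≤ r
  features : ∀ ℓ ∈ Finset.Icc 2 L, ∀ i, ‖feature P W ℓ i - Ψ.θ ℓ (θ ℓ i) t‖ ≤ r
  w₂ : ∀ i j, |W.w 2 i j - Ψ.w₂ (u i) (θ 2 j) t| ≤ r
  w : ∀ ℓ ∈ Finset.Icc 3 L, ∀ i j, |W.w ℓ i j - Ψ.w ℓ (θ (ℓ - 1) i) (θ ℓ j) t| ≤ r
  wOut : ∀ i, |W.wOut i - Ψ.wOut (θ L i) t| ≤ r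

end DeepMeanField

end

noncomputable section

namespace DeepMeanField

open Set

/-! The neural feature flow is the mean-field limit of gradient descent: averages over the `m` nodes
of a layer become integrals against the law of that layer. Every node carries a size `a = 1 + ‖z‖`,
and all estimates are made relative to these sizes. Hidden layers are counted from `0` to `K = L -
1`. There are four ingredients.

A priori regularity. The gradient of the weights into a layer involves only the backward features of
that layer. So a descending induction from the output bounds the backward features and shows `|w(z,
z')| ≤ c a(z')` without any Gronwall argument, and then all trajectories are Lipschitz in time
(`LimitNet.exists_isRegular`). The drift `Γ` is exactly the formal time derivative of `∫ w h(x)`, so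
the forward propagation constraint persists along the flow (`LimitNet.IsBounded.fwd'`). Features are
therefore functions of the weights at every time, as in the discrete network, and only weights have
to be tracked.

Sampling. Conditionally on one node, the average of `w h(x)` or `w D` over a neighbouring layer is
an i.i.d. average dominated by `a ^ 2`, whose exponential moment is finite because the laws are
sub-gaussian. It deviates from its mean by `ε` with probability at most `2 exp(-κ m ε²)`. A union
bound over nodes, layers, data points and a time net of mesh `ε`, filled in by Lipschitz continuity
in time, makes the sampled network satisfy the forward and backward recursions up to `O(ε)` at all
times (`LimitNet.exists_isTypical`).

Stability. If the discrete weights are within `E a(z) a(z')` of the ideal ones and the ideal network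
is consistent up to `e`, then features and gradients differ by `O(E + e)` times the matching sizes,
with a constant independent of `m` (`IdealNet.exists_isGradClose`). Only averages of `a ^ 2` enter,
and these are bounded, so no logarithm is lost.

Discrete Gronwall. By the backpropagation formulas, scaled gradient descent is an explicit Euler
scheme for the flow, with local error `O(η²)`. Since `η ≤ κ ε`, the weighted error stays `O(ε)` on
`[0, T]` (`LimitNet.exists_tracking`).

Logarithms appear only when weighted bounds are made uniform: all sampled sizes are at most `R log(e
m / δ)`, and a connecting weight carries two of them, whence the exponent two. The output carries no
size factor, so the loss bound has no logarithm. -/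

lemma abs_avg_le {n : ℕ} {f : Fin n → ℝ} {C : ℝ} (hC : 0 ≤ C) (hf : ∀ i, |f i| ≤ C) :
    |(1 / (n : ℝ)) * ∑ i, f i| ≤ C := by
  rcases Nat.eq_zero_or_pos n with rfl | hn
  · simpa using hC
  have hn' : (0 : ℝ) < n := by exact_mod_cast hn
  rw [abs_mul, abs_of_nonneg (by positivity)]
  calc (1 / (n : ℝ)) * |∑ i, f i| ≤ (1 / (n : ℝ)) * ∑ _i : Fin n, C := by
        gcongr
        exact (Finset.abs_sum_le_sum_abs _ _).trans (Finset.sum_le_sum fun i _ => hf i)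
    _ = C := by simp; field_simp

/-- Combine finitely many existential constants of monotone properties. -/
lemma exists_uniform_const {P : ℕ → ℝ → Prop} (hmono : ∀ r C C', C ≤ C' → P r C → P r C')
    (h : ∀ r, ∃ C, P r C) (K : ℕ) : ∃ C, ∀ r ≤ K, P r C := by
  choose C hC using h
  refine ⟨∑ r ∈ Finset.range (K + 1), |C r|, fun r hr => hmono r _ _ ?_ (hC r)⟩
  exact (le_abs_self _).trans (Finset.single_le_sum (f := fun r => |C r|)
    (fun _ _ => abs_nonneg _) (Finset.mem_range.2 (by omega)))

lemma abs_mul_sub_mul_le {a b a' b' A B δ₁ δ₂ : ℝ} (ha : |a| ≤ A) (hb : |b'| ≤ B)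
    (h₁ : |a - a'| ≤ δ₁) (h₂ : |b - b'| ≤ δ₂) :
    |a * b - a' * b'| ≤ A * δ₂ + δ₁ * B := by
  have : a * b - a' * b' = a * (b - b') + (a - a') * b' := by ring
  rw [this]
  refine (abs_add_le _ _).trans ?_
  rw [abs_mul, abs_mul]
  have := abs_nonneg a
  have := abs_nonneg (b - b')
  have := abs_nonneg (a - a')
  have := abs_nonneg b'
  gcongr <;> linarith

/-! ### The limit network and bounds uniform in time -/

/-- The data of a mean-field limit network with hidden layers `0, …, K`: node spaces `S k` with laws
`ρ k` and weight functions `a k`; trajectories of the first-layer weights `u`, the features `x`, the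
connecting weights `w`, the output weights `v` and the backward features `D`; the activation `h`,
the derivatives `ψ n` of the losses and the inputs `X`. -/
structure LimitNet (d N K : ℕ) where
  S : ℕ → Type
  [ms : ∀ k, MeasurableSpace (S k)]
  ρ : ∀ k, Measure (S k)
  a : ∀ k, S k → ℝ
  u : S 0 → ℝ → Fin d → ℝ
  x : ∀ k, S k → ℝ → Fin N → ℝ
  w : ∀ k, S k → S (k + 1) → ℝ → ℝ
  v : S K → ℝ → ℝ
  D : ∀ k, S k → ℝ → Fin N → ℝ
  h : ℝ → ℝ
  ψ : Fin N → ℝ → ℝ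
  X : Fin N → Fin d → ℝ

namespace LimitNet

variable {d N K : ℕ} (M : LimitNet d N K)

instance (k : ℕ) : MeasurableSpace (M.S k) := M.ms k

/-- The network output. -/
def out (t : ℝ) (n : Fin N) : ℝ := ∫ z, M.v z t * M.h (M.x K z t n) ∂(M.ρ K)

/-- The derivative of the loss at the network output. -/
def dOut (t : ℝ) (n : Fin N) : ℝ := M.ψ n (M.out t n)

/-- Gradient of the output weights. -/
def gOut (z : M.S K) (t : ℝ) : ℝ := (1 / (N : ℝ)) * ∑ n, M.dOut t n * M.h (M.x K z t n)

/-- Gradient of the connecting weights. -/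
def grad (k : ℕ) (z : M.S k) (z' : M.S (k + 1)) (t : ℝ) : ℝ :=
  (1 / (N : ℝ)) * ∑ n, M.D (k + 1) z' t n * M.h (M.x k z t n)

/-- Gradient of the first-layer weights. -/
def gFirst (z : M.S 0) (t : ℝ) (i : Fin d) : ℝ := (1 / (N : ℝ)) * ∑ n, M.X n i * M.D 0 z t n

/-- Drift of the features. -/
def Γ : ∀ k, M.S k → ℝ → Fin N → ℝ
  | 0 => fun z t n => (1 / (d : ℝ)) * ∑ i, M.X n i * M.gFirst z t i
  | k + 1 => fun z' t n =>
      (∫ z, M.w k z z' t * (deriv M.h (M.x k z t n) * Γ k z t n) ∂(M.ρ k))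
        + ∫ z, M.h (M.x k z t n) * M.grad k z z' t ∂(M.ρ k)

/-- The limit network evolves by the feature flow on `[0, T]`, with all parameters bounded
by `c`. -/
structure IsFlow (c T : ℝ) : Prop where
  one_le : 1 ≤ c
  T_nonneg : 0 ≤ T
  T_le : T ≤ c
  h_diff : Differentiable ℝ M.h
  h_bound : ∀ y, |M.h y| ≤ c
  h'_bound : ∀ y, |deriv M.h y| ≤ c
  h'_lip : ∀ y y', |deriv M.h y - deriv M.h y'| ≤ c * |y - y'|
  ψ_bound : ∀ n y, |M.ψ n y| ≤ c
  ψ_lip : ∀ n y y', |M.ψ n y - M.ψ n y'| ≤ c * |y - y'|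
  X_bound : ∀ n i, |M.X n i| ≤ c
  prob : ∀ k ≤ K, IsProbabilityMeasure (M.ρ k)
  a_meas : ∀ k ≤ K, Measurable (M.a k)
  one_le_a : ∀ k z, 1 ≤ M.a k z
  a2_int : ∀ k ≤ K, Integrable (fun z => M.a k z ^ 2) (M.ρ k)
  a2_le : ∀ k ≤ K, ∫ z, M.a k z ^ 2 ∂(M.ρ k) ≤ c
  x_cont : ∀ k ≤ K, ∀ z n, ContinuousOn (fun t => M.x k z t n) (Icc 0 T)
  x_meas : ∀ k ≤ K, ∀ t ∈ Icc 0 T, ∀ n, Measurable fun z => M.x k z t n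
  w_cont : ∀ k < K, ∀ z z', ContinuousOn (M.w k z z') (Icc 0 T)
  w_meas : ∀ k < K, ∀ t ∈ Icc 0 T, Measurable fun q : M.S k × M.S (k + 1) => M.w k q.1 q.2 t
  v_cont : ∀ z, ContinuousOn (M.v z) (Icc 0 T)
  v_meas : ∀ t ∈ Icc 0 T, Measurable fun z => M.v z t
  w_init : ∀ k < K, ∀ z z', |M.w k z z' 0| ≤ c * M.a (k + 1) z'
  v_init : ∀ z, |M.v z 0| ≤ c
  D_top : ∀ t ∈ Icc 0 T, ∀ z n, M.D K z t n = M.v z t * M.dOut t n * deriv M.h (M.x K z t n)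
  D_succ : ∀ t ∈ Icc 0 T, ∀ k < K, ∀ z n, M.D k z t n =
    (∫ z', M.w k z z' t * M.D (k + 1) z' t n ∂(M.ρ (k + 1))) * deriv M.h (M.x k z t n)
  x_zero : ∀ t ∈ Icc 0 T, ∀ z n, M.x 0 z t n = (1 / (d : ℝ)) * ∑ i, M.X n i * M.u z t i
  fwd_init : ∀ k < K, ∀ z' n,
    M.x (k + 1) z' 0 n = ∫ z, M.w k z z' 0 * M.h (M.x k z 0 n) ∂(M.ρ k)
  flow_u : ∀ t ∈ Icc 0 T, ∀ z, M.u z t = M.u z 0 - ∫ s in (0 : ℝ)..t, M.gFirst z s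
  flow_x : ∀ t ∈ Icc 0 T, ∀ k < K, ∀ z,
    M.x (k + 1) z t = M.x (k + 1) z 0 - ∫ s in (0 : ℝ)..t, M.Γ (k + 1) z s
  flow_w : ∀ t ∈ Icc 0 T, ∀ k < K, ∀ z z',
    M.w k z z' t = M.w k z z' 0 - ∫ s in (0 : ℝ)..t, M.grad k z z' s
  flow_v : ∀ t ∈ Icc 0 T, ∀ z, M.v z t = M.v z 0 - ∫ s in (0 : ℝ)..t, M.gOut z s

variable {M} {c T : ℝ}

namespace IsFlow

variable (H : M.IsFlow c T)
include H

lemma c_nonneg : 0 ≤ c := zero_le_one.trans H.one_le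

lemma a_le_sq (k : ℕ) (z : M.S k) : M.a k z ≤ M.a k z ^ 2 := by nlinarith [H.one_le_a k z]

lemma a_nonneg (k : ℕ) (z : M.S k) : 0 ≤ M.a k z := zero_le_one.trans (H.one_le_a k z)

lemma a_int {k : ℕ} (hk : k ≤ K) : Integrable (M.a k) (M.ρ k) := by
  refine (H.a2_int k hk).mono' (H.a_meas k hk).aestronglyMeasurable (ae_of_all _ fun z => ?_)
  rw [Real.norm_eq_abs, abs_of_nonneg (H.a_nonneg k z)]
  exact H.a_le_sq k z

/-- An integrable majorant is enough: the bound holds for the Bochner integral whether or not `f` is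
measurable, which is why no measurability is carried through the a priori estimates. -/
lemma abs_integral_le_sq {k : ℕ} (hk : k ≤ K) {f : M.S k → ℝ} {C : ℝ} (hC : 0 ≤ C)
    (hf : ∀ z, |f z| ≤ C * M.a k z ^ 2) : |∫ z, f z ∂(M.ρ k)| ≤ C * c := by
  have := norm_integral_le_of_norm_le (f := f) ((H.a2_int k hk).const_mul C) (ae_of_all _ hf)
  rw [integral_const_mul] at this
  exact this.trans (mul_le_mul_of_nonneg_left (H.a2_le k hk) hC)

lemma abs_integral_le {k : ℕ} (hk : k ≤ K) {f : M.S k → ℝ} {C : ℝ} (hC : 0 ≤ C)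
    (hf : ∀ z, |f z| ≤ C * M.a k z) : |∫ z, f z ∂(M.ρ k)| ≤ C * c :=
  H.abs_integral_le_sq hk hC fun z =>
    (hf z).trans (mul_le_mul_of_nonneg_left (H.a_le_sq k z) hC)

lemma abs_dOut_le (t : ℝ) (n : Fin N) : |M.dOut t n| ≤ c := H.ψ_bound n _

lemma abs_gOut_le (z : M.S K) (t : ℝ) : |M.gOut z t| ≤ c * c := by
  have := H.c_nonneg
  refine abs_avg_le (by positivity) fun n => ?_
  rw [abs_mul]
  exact mul_le_mul (H.abs_dOut_le t n) (H.h_bound _) (abs_nonneg _) (by assumption)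

lemma abs_intervalIntegral_le {f : ℝ → ℝ} {C t : ℝ} (hC : 0 ≤ C) (ht : t ∈ Icc 0 T)
    (hf : ∀ s ∈ Icc 0 T, |f s| ≤ C) : |∫ s in (0 : ℝ)..t, f s| ≤ C * c := by
  have : ‖∫ s in (0 : ℝ)..t, f s‖ ≤ C * |t - 0| := by
    refine intervalIntegral.norm_integral_le_of_norm_le_const fun s hs => hf s ?_
    rw [uIoc_of_le ht.1] at hs
    exact ⟨hs.1.le, hs.2.trans ht.2⟩
  refine this.trans (mul_le_mul_of_nonneg_left ?_ hC)
  rw [sub_zero, abs_of_nonneg ht.1]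
  exact ht.2.trans H.T_le

lemma abs_v_le {t : ℝ} (ht : t ∈ Icc 0 T) (z : M.S K) : |M.v z t| ≤ c + c * c * c := by
  have hc := H.c_nonneg
  rw [H.flow_v t ht]
  refine (abs_sub _ _).trans (add_le_add (H.v_init z) ?_)
  exact H.abs_intervalIntegral_le (by positivity) ht fun s _ => H.abs_gOut_le z s

lemma abs_grad_le {b t : ℝ} (hb : 0 ≤ b) {k : ℕ} {z' : M.S (k + 1)}
    (hD : ∀ n, |M.D (k + 1) z' t n| ≤ b) (z : M.S k) : |M.grad k z z' t| ≤ b * c := by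
  have := H.c_nonneg
  refine abs_avg_le (by positivity) fun n => ?_
  rw [abs_mul]
  exact mul_le_mul (hD n) (H.h_bound _) (abs_nonneg _) hb

/-- The gradient of a connecting weight is bounded once the backward feature of its target is.
Integrating over `[0, T]` adds a constant to the initial growth, and `1 ≤ a` absorbs it. -/
lemma abs_w_le_of_D {b : ℝ} (hb : 0 ≤ b) {k : ℕ} (hk : k < K) {z' : M.S (k + 1)}
    (hD : ∀ t ∈ Icc 0 T, ∀ n, |M.D (k + 1) z' t n| ≤ b) (z : M.S k) {t : ℝ} (ht : t ∈ Icc 0 T) :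
    |M.w k z z' t| ≤ (c + b * c * c) * M.a (k + 1) z' := by
  have hc := H.c_nonneg
  rw [H.flow_w t ht k hk]
  have h1 := H.abs_intervalIntegral_le (f := fun s => M.grad k z z' s) (C := b * c) (by positivity)
    ht fun s hs => H.abs_grad_le hb (hD s hs) z
  refine (abs_sub _ _).trans ?_
  have h2 := H.w_init k hk z z'
  have h3 := H.one_le_a (k + 1) z'
  have h4 : 0 ≤ b * c * c := by positivity
  nlinarith

end IsFlow

/-- Descending induction, with `r` the distance from the top layer. The output weights stay bounded
because their gradient involves only the derivative of the loss and the activation. Below the top, a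
bound on layer `k + 1` controls the growth of the weights into it, and the integral over that layer
leaves a bound on layer `k` with no size factor. -/
lemma exists_D_bound (d N K : ℕ) (c T : ℝ) (r : ℕ) : ∃ C : ℝ, 0 ≤ C ∧
    ∀ M : LimitNet d N K, M.IsFlow c T → ∀ k, k + r = K → ∀ z, ∀ t ∈ Icc 0 T, ∀ n,
      |M.D k z t n| ≤ C := by
  -- A flow forces `1 ≤ c`, so for negative `c` the claim is vacuous and any constant will do.
  by_cases hc : 0 ≤ c
  swap
  · exact ⟨0, le_rfl, fun M H => absurd H.c_nonneg hc⟩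
  induction r with
  | zero =>
    refine ⟨(c + c * c * c) * c * c, by positivity, fun M H k hk z t ht n => ?_⟩
    obtain rfl : k = K := hk
    rw [H.D_top t ht, abs_mul, abs_mul]
    have := H.abs_v_le ht z
    have := H.abs_dOut_le t n
    have := H.h'_bound (M.x k z t n)
    gcongr
  | succ r ih =>
    obtain ⟨b, hb, ih⟩ := ih
    refine ⟨((c + b * c * c) * b * c) * c, by positivity, fun M H k hk z t ht n => ?_⟩
    rw [H.D_succ t ht k (by omega), abs_mul]
    have hD := ih M H (k + 1) (by omega)
    gcongr
    · refine H.abs_integral_le (by omega) (by positivity) fun z' => ?_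
      rw [abs_mul]
      have h1 := H.abs_w_le_of_D hb (by omega) (hD z') z ht
      have h2 := hD z' t ht n
      calc _ ≤ ((c + b * c * c) * M.a (k + 1) z') * b := by
            have := H.a_nonneg (k + 1) z'
            gcongr
        _ = _ := by ring
    · exact H.h'_bound _

variable (M) in
/-- A flow whose trajectories obey growth bounds with constant `c`. -/
structure IsBounded (c T : ℝ) : Prop extends M.IsFlow c T where
  D_bound : ∀ k ≤ K, ∀ z, ∀ t ∈ Icc 0 T, ∀ n, |M.D k z t n| ≤ c
  w_bound : ∀ k < K, ∀ z z', ∀ t ∈ Icc 0 T, |M.w k z z' t| ≤ c * M.a (k + 1) z'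
  v_bound : ∀ z, ∀ t ∈ Icc 0 T, |M.v z t| ≤ c

lemma IsFlow.mono (H : M.IsFlow c T) {c' : ℝ} (hc : c ≤ c') : M.IsFlow c' T where
  __ := H
  one_le := H.one_le.trans hc
  T_le := H.T_le.trans hc
  h_bound y := (H.h_bound y).trans hc
  h'_bound y := (H.h'_bound y).trans hc
  h'_lip y y' := (H.h'_lip y y').trans (by gcongr)
  ψ_bound n y := (H.ψ_bound n y).trans hc
  ψ_lip n y y' := (H.ψ_lip n y y').trans (by gcongr)
  X_bound n i := (H.X_bound n i).trans hc
  a2_le k hk := (H.a2_le k hk).trans hc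
  w_init k hk z z' := (H.w_init k hk z z').trans
    (mul_le_mul_of_nonneg_right hc (H.a_nonneg (k + 1) z'))
  v_init z := (H.v_init z).trans hc

lemma exists_isBounded (d N K : ℕ) (c T : ℝ) : ∃ c' : ℝ, c ≤ c' ∧
    ∀ M : LimitNet d N K, M.IsFlow c T → M.IsBounded c' T := by
  obtain ⟨b, hb⟩ := exists_uniform_const (P := fun r C => 0 ≤ C ∧
    ∀ M : LimitNet d N K, M.IsFlow c T → ∀ k, k + r = K → ∀ z, ∀ t ∈ Icc 0 T, ∀ n,
      |M.D k z t n| ≤ C)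
    (fun r C C' hC h => ⟨h.1.trans hC, fun M H k hk z t ht n => (h.2 M H k hk z t ht n).trans hC⟩)
    (exists_D_bound d N K c T) K
  have hb0 : 0 ≤ b := (hb 0 (Nat.zero_le _)).1
  refine ⟨|c| + b + b * |c| * |c| + |c| * |c| * |c|, ?_, fun M H => ?_⟩
  · have := le_abs_self c
    have : 0 ≤ b * |c| * |c| + |c| * |c| * |c| := by positivity
    linarith
  have hc := H.c_nonneg
  have h1 : 0 ≤ b * c * c := by positivity
  have h2 : 0 ≤ c * c * c := by positivity
  rw [abs_of_nonneg hc]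
  have hD : ∀ k ≤ K, ∀ z, ∀ t ∈ Icc 0 T, ∀ n, |M.D k z t n| ≤ b := fun k hk z t ht n =>
    (hb (K - k) (by omega)).2 M H k (by omega) z t ht n
  refine { H.mono (by linarith) with D_bound := ?_, w_bound := ?_, v_bound := ?_ }
  · exact fun k hk z t ht n => (hD k hk z t ht n).trans (by linarith)
  · intro k hk z z' t ht
    exact (H.abs_w_le_of_D hb0 hk (hD (k + 1) (by omega) z') z ht).trans
      (mul_le_mul_of_nonneg_right (by linarith) (H.a_nonneg (k + 1) z'))
  · exact fun z t ht => (H.abs_v_le ht z).trans (by linarith)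

end LimitNet

/-! ### Integral equations; measurability and continuity of the flow -/

/-- An integral equation on `[0, T]` with continuous integrand, in differential form. -/
lemma hasDerivAt_of_integral_eq {f g : ℝ → ℝ} {T t : ℝ} (hg : ContinuousOn g (Icc 0 T))
    (hf : ∀ t ∈ Icc 0 T, f t = f 0 - ∫ s in (0 : ℝ)..t, g s) (ht : t ∈ Ioo 0 T) :
    HasDerivAt f (-g t) t := by
  have hI : IntervalIntegrable g volume 0 t :=
    (hg.mono (by rw [uIcc_of_le ht.1.le]; exact Icc_subset_Icc_right ht.2.le)).intervalIntegrable
  have hnhds : Icc 0 T ∈ nhds t := Icc_mem_nhds ht.1 ht.2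
  have h1 : HasDerivAt (fun t => f 0 - ∫ s in (0 : ℝ)..t, g s) (-g t) t :=
    (intervalIntegral.integral_hasDerivAt_right hI
      (hg.stronglyMeasurableAtFilter_nhdsWithin measurableSet_Icc t |>.filter_mono
        (by rw [nhdsWithin_eq_nhds.2 hnhds])) (hg.continuousAt hnhds)).const_sub _
  exact h1.congr_of_eventuallyEq (Filter.eventually_of_mem hnhds hf)

lemma abs_sub_le_of_integral_eq {f g : ℝ → ℝ} {T C s t : ℝ} (hg : ContinuousOn g (Icc 0 T))
    (hf : ∀ t ∈ Icc 0 T, f t = f 0 - ∫ s in (0 : ℝ)..t, g s) (hC : ∀ t ∈ Icc 0 T, |g t| ≤ C)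
    (hs : s ∈ Icc 0 T) (ht : t ∈ Icc 0 T) : |f t - f s| ≤ C * |t - s| := by
  have hI : ∀ r ∈ Icc 0 T, IntervalIntegrable g volume 0 r := fun r hr =>
    (hg.mono (by rw [uIcc_of_le hr.1]; exact Icc_subset_Icc_right hr.2)).intervalIntegrable
  have h1 : f t - f s = - ∫ r in s..t, g r := by
    rw [hf t ht, hf s hs, ← intervalIntegral.integral_interval_sub_left (hI t ht) (hI s hs)]
    ring
  rw [h1, abs_neg, ← Real.norm_eq_abs]
  exact intervalIntegral.norm_integral_le_of_norm_le_const fun r hr =>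
    hC r (uIcc_subset_Icc hs ht (uIoc_subset_uIcc hr))

/-- Lets the vector-valued integral equations be used coordinate by coordinate. Continuity of the
coordinates supplies the integrability without which evaluation need not commute with the integral.
-/
lemma intervalIntegral_apply {ι : Type*} [Fintype ι] {f : ℝ → ι → ℝ} {T t : ℝ}
    (hf : ∀ i, ContinuousOn (fun s => f s i) (Icc 0 T)) (ht : t ∈ Icc 0 T) (i : ι) :
    (∫ s in (0 : ℝ)..t, f s) i = ∫ s in (0 : ℝ)..t, f s i := by
  rw [intervalIntegral.integral_of_le ht.1, intervalIntegral.integral_of_le ht.1]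
  refine eval_integral (fun i => ?_) i
  have h : IntegrableOn (fun s => f s i) (Icc 0 t) volume :=
    ((hf i).mono (Icc_subset_Icc_right ht.2)).integrableOn_Icc
  exact h.mono_set Ioc_subset_Icc_self

namespace LimitNet

variable {d N K : ℕ} {M : LimitNet d N K} {c T : ℝ}

namespace IsFlow

variable (H : M.IsFlow c T)
include H

lemma continuous_deriv_h : Continuous (deriv M.h) :=
  (LipschitzWith.of_dist_le' (H.h'_lip)).continuous

lemma continuous_ψ (n : Fin N) : Continuous (M.ψ n) :=
  (LipschitzWith.of_dist_le' (H.ψ_lip n)).continuous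

lemma h_lip (y y' : ℝ) : |M.h y - M.h y'| ≤ c * |y - y'| := by
  have := Convex.norm_image_sub_le_of_norm_deriv_le (𝕜 := ℝ) (f := M.h) (s := univ) (C := c)
    (fun x _ => H.h_diff x) (fun x _ => H.h'_bound x) convex_univ (mem_univ y') (mem_univ y)
  simpa using this

/-- Measurability descends from the output: a parameter integral of a jointly measurable function is
measurable in the parameter, so joint measurability of the connecting weights carries one layer to
the layer below. -/
lemma D_meas_aux (r : ℕ) : ∀ k, k + r = K → ∀ t ∈ Icc 0 T, ∀ n,
    Measurable fun z => M.D k z t n := by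
  have hh := H.continuous_deriv_h.measurable
  induction r with
  | zero =>
    intro k hk t ht n
    obtain rfl : k = K := hk
    simp_rw [H.D_top t ht]
    exact ((H.v_meas t ht).mul_const _).mul (hh.comp (H.x_meas k le_rfl t ht n))
  | succ r ih =>
    intro k hk t ht n
    simp_rw [H.D_succ t ht k (by omega)]
    have := H.prob (k + 1) (by omega)
    refine Measurable.mul ?_ (hh.comp (H.x_meas k (by omega) t ht n))
    have h1 := (H.w_meas k (by omega) t ht).mul
      ((ih (k + 1) (by omega) t ht n).comp measurable_snd)
    exact (h1.stronglyMeasurable.integral_prod_right').measurable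

lemma D_meas {k : ℕ} (hk : k ≤ K) {t : ℝ} (ht : t ∈ Icc 0 T) (n : Fin N) :
    Measurable fun z => M.D k z t n :=
  H.D_meas_aux (K - k) k (by omega) t ht n

lemma h_x_meas {k : ℕ} (hk : k ≤ K) {t : ℝ} (ht : t ∈ Icc 0 T) (n : Fin N) :
    Measurable fun z => M.h (M.x k z t n) :=
  H.h_diff.continuous.measurable.comp (H.x_meas k hk t ht n)

lemma grad_meas {k : ℕ} (hk : k < K) {t : ℝ} (ht : t ∈ Icc 0 T) :
    Measurable fun q : M.S k × M.S (k + 1) => M.grad k q.1 q.2 t :=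
  (Finset.univ.measurable_sum fun n _ => ((H.D_meas (k := k + 1) (by omega) ht n).comp
    measurable_snd).mul ((H.h_x_meas (k := k) (by omega) ht n).comp measurable_fst)).const_mul _

lemma Γ_meas {k : ℕ} (hk : k ≤ K) {t : ℝ} (ht : t ∈ Icc 0 T) (n : Fin N) :
    Measurable fun z => M.Γ k z t n := by
  induction k generalizing n with
  | zero =>
    simp only [Γ, gFirst]
    exact (Finset.univ.measurable_sum fun i _ => ((Finset.univ.measurable_sum fun n _ =>
      (H.D_meas hk ht n).const_mul _).const_mul _).const_mul _).const_mul _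
  | succ k ih =>
    simp only [Γ]
    have := H.prob k (by omega)
    have h1 : Measurable fun q : M.S (k + 1) × M.S k =>
        M.w k q.2 q.1 t * (deriv M.h (M.x k q.2 t n) * M.Γ k q.2 t n) :=
      ((H.w_meas k (by omega) t ht).comp measurable_swap).mul
        (((H.continuous_deriv_h.measurable.comp (H.x_meas k (by omega) t ht n)).comp
          measurable_snd).mul ((ih (by omega) n).comp measurable_snd))
    have h2 : Measurable fun q : M.S (k + 1) × M.S k =>
        M.h (M.x k q.2 t n) * M.grad k q.2 q.1 t :=
      ((H.h_x_meas (by omega) ht n).comp measurable_snd).mul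
        ((H.grad_meas (by omega) ht).comp measurable_swap)
    exact (h1.stronglyMeasurable.integral_prod_right'.add
      h2.stronglyMeasurable.integral_prod_right').measurable

end IsFlow

namespace IsBounded

variable (H : M.IsBounded c T)
include H

/-- Dominated convergence, the size function serving as majorant at all times simultaneously. -/
lemma continuousOn_integral {k : ℕ} (hk : k ≤ K) {F : ℝ → M.S k → ℝ} {C : ℝ}
    (hm : ∀ t ∈ Icc 0 T, Measurable (F t)) (hF : ∀ t ∈ Icc 0 T, ∀ z, |F t z| ≤ C * M.a k z)
    (hc : ∀ z, ContinuousOn (fun t => F t z) (Icc 0 T)) :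
    ContinuousOn (fun t => ∫ z, F t z ∂(M.ρ k)) (Icc 0 T) :=
  continuousOn_of_dominated (bound := fun z => C * M.a k z)
    (fun t ht => (hm t ht).aestronglyMeasurable) (fun t ht => ae_of_all _ (hF t ht))
    ((H.a_int hk).const_mul C) (ae_of_all _ hc)

lemma h_x_cont {k : ℕ} (hk : k ≤ K) (z : M.S k) (n : Fin N) :
    ContinuousOn (fun t => M.h (M.x k z t n)) (Icc 0 T) :=
  H.h_diff.continuous.comp_continuousOn (H.x_cont k hk z n)

lemma h'_x_cont {k : ℕ} (hk : k ≤ K) (z : M.S k) (n : Fin N) :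
    ContinuousOn (fun t => deriv M.h (M.x k z t n)) (Icc 0 T) :=
  H.continuous_deriv_h.comp_continuousOn (H.x_cont k hk z n)

lemma abs_v_mul_h_le {t : ℝ} (ht : t ∈ Icc 0 T) (z : M.S K) (n : Fin N) :
    |M.v z t * M.h (M.x K z t n)| ≤ c * c * M.a K z := by
  have := H.c_nonneg
  have := H.one_le_a K z
  rw [abs_mul]
  calc _ ≤ c * c := mul_le_mul (H.v_bound z t ht) (H.h_bound _) (abs_nonneg _) (by assumption)
    _ ≤ _ := by nlinarith [mul_nonneg H.c_nonneg H.c_nonneg]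

lemma out_cont (n : Fin N) : ContinuousOn (fun t => M.out t n) (Icc 0 T) :=
  H.continuousOn_integral le_rfl (fun t ht => (H.v_meas t ht).mul (H.h_x_meas le_rfl ht n))
    (fun _ ht z => H.abs_v_mul_h_le ht z n) fun z => (H.v_cont z).mul (H.h_x_cont le_rfl z n)

lemma dOut_cont (n : Fin N) : ContinuousOn (fun t => M.dOut t n) (Icc 0 T) :=
  (H.continuous_ψ n).comp_continuousOn (H.out_cont n)

lemma abs_w_mul_D_le {k : ℕ} (hk : k < K) {t : ℝ} (ht : t ∈ Icc 0 T) (z : M.S k)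
    (z' : M.S (k + 1)) (n : Fin N) :
    |M.w k z z' t * M.D (k + 1) z' t n| ≤ c * c * M.a (k + 1) z' := by
  have := H.c_nonneg
  have := H.one_le_a (k + 1) z'
  rw [abs_mul]
  calc _ ≤ (c * M.a (k + 1) z') * c := mul_le_mul (H.w_bound k hk z z' t ht)
        (H.D_bound (k + 1) (by omega) z' t ht n) (abs_nonneg _) (by positivity)
    _ = _ := by ring

lemma D_cont_aux (r : ℕ) : ∀ k, k + r = K → ∀ z n,
    ContinuousOn (fun t => M.D k z t n) (Icc 0 T) := by
  induction r with
  | zero =>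
    intro k hk z n
    obtain rfl : k = K := hk
    exact (((H.v_cont z).mul (H.dOut_cont n)).mul (H.h'_x_cont le_rfl z n)).congr
      fun _ ht => H.D_top _ ht z n
  | succ r ih =>
    intro k hk z n
    refine ContinuousOn.congr ?_ fun t ht => H.D_succ t ht k (by omega) z n
    refine ContinuousOn.mul ?_ (H.h'_x_cont (by omega) z n)
    refine H.continuousOn_integral (by omega) (fun t ht => ?_)
      (fun t ht z' => H.abs_w_mul_D_le (by omega) ht z z' n) fun z' =>
      (H.w_cont k (by omega) z z').mul (ih (k + 1) (by omega) z' n)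
    exact ((H.w_meas k (by omega) t ht).comp measurable_prodMk_left).mul
      (H.D_meas (by omega) ht n)

lemma D_cont {k : ℕ} (hk : k ≤ K) (z : M.S k) (n : Fin N) :
    ContinuousOn (fun t => M.D k z t n) (Icc 0 T) :=
  H.D_cont_aux (K - k) k (by omega) z n

lemma gOut_cont (z : M.S K) : ContinuousOn (M.gOut z) (Icc 0 T) :=
  continuousOn_const.mul (continuousOn_finsetSum _ fun n _ =>
    (H.dOut_cont n).mul (H.h_x_cont le_rfl z n))

lemma grad_cont {k : ℕ} (hk : k < K) (z : M.S k) (z' : M.S (k + 1)) :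
    ContinuousOn (M.grad k z z') (Icc 0 T) :=
  continuousOn_const.mul (continuousOn_finsetSum _ fun n _ =>
    (H.D_cont (by omega) z' n).mul (H.h_x_cont (by omega) z n))

lemma gFirst_cont (z : M.S 0) (i : Fin d) : ContinuousOn (fun t => M.gFirst z t i) (Icc 0 T) :=
  continuousOn_const.mul (continuousOn_finsetSum _ fun n _ =>
    continuousOn_const.mul (H.D_cont (Nat.zero_le _) z n))

lemma abs_gFirst_le (z : M.S 0) {t : ℝ} (ht : t ∈ Icc 0 T) (i : Fin d) :
    |M.gFirst z t i| ≤ c * c := by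
  have := H.c_nonneg
  refine abs_avg_le (by positivity) fun n => ?_
  rw [abs_mul]
  exact mul_le_mul (H.X_bound n i) (H.D_bound 0 (Nat.zero_le _) z t ht n) (abs_nonneg _) this

lemma abs_grad_le' {k : ℕ} (hk : k < K) (z : M.S k) (z' : M.S (k + 1)) {t : ℝ}
    (ht : t ∈ Icc 0 T) : |M.grad k z z' t| ≤ c * c :=
  H.abs_grad_le H.c_nonneg (H.D_bound (k + 1) (by omega) z' t ht) z

end IsBounded

/-- Induction up the layers. The factor `a (k + 1) z'` comes from the connecting weight alone,
because the factor `a k z` in the drift of the previous layer is integrated out. Hence the growth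
stays linear at every depth. -/
lemma exists_Γ_bound (d N K : ℕ) (c T : ℝ) (k : ℕ) : ∃ C : ℝ, 0 ≤ C ∧
    ∀ M : LimitNet d N K, M.IsBounded c T → k ≤ K → ∀ z, ∀ t ∈ Icc 0 T, ∀ n,
      |M.Γ k z t n| ≤ C * M.a k z := by
  by_cases hc : 0 ≤ c
  swap
  · exact ⟨0, le_rfl, fun M H => absurd H.c_nonneg hc⟩
  induction k with
  | zero =>
    refine ⟨c * (c * c), by positivity, fun M H hk z t ht n => ?_⟩
    have h1 : |M.Γ 0 z t n| ≤ c * (c * c) := by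
      refine abs_avg_le (by positivity) fun i => ?_
      rw [abs_mul]
      exact mul_le_mul (H.X_bound n i) (H.abs_gFirst_le z ht i) (abs_nonneg _) hc
    have h2 := H.one_le_a 0 z
    have h3 : 0 ≤ c * (c * c) := by positivity
    nlinarith
  | succ k ih =>
    obtain ⟨b, hb, ih⟩ := ih
    refine ⟨c * (c * b) * c + c * (c * c) * c, by positivity, fun M H hk z' t ht n => ?_⟩
    have ha' := H.one_le_a (k + 1) z'
    rw [Γ, add_mul]
    refine (abs_add_le _ _).trans (add_le_add ?_ ?_)
    · refine (H.abs_integral_le (by omega) (C := c * M.a (k + 1) z' * (c * b))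
        (by positivity) fun z => ?_).trans_eq (by ring)
      rw [abs_mul, abs_mul, mul_assoc (c * _), mul_assoc c b]
      have := H.w_bound k (by omega) z z' t ht
      have := H.h'_bound (M.x k z t n)
      have := ih M H (by omega) z t ht n
      gcongr
    · have h1 : |∫ z, M.h (M.x k z t n) * M.grad k z z' t ∂(M.ρ k)| ≤ c * (c * c) * c := by
        refine H.abs_integral_le (by omega) (by positivity) fun z => ?_
        rw [abs_mul]
        have := H.h_bound (M.x k z t n)
        have := H.abs_grad_le' (by omega) z z' ht
        have := H.one_le_a k z
        calc _ ≤ c * (c * c) := by gcongr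
          _ ≤ c * (c * c) * M.a k z := le_mul_of_one_le_right (by positivity) this
      exact h1.trans (le_mul_of_one_le_right (by positivity) ha')

lemma IsBounded.flow_u_apply (H : M.IsBounded c T) {t : ℝ} (ht : t ∈ Icc 0 T) (z : M.S 0)
    (i : Fin d) : M.u z t i = M.u z 0 i - ∫ s in (0 : ℝ)..t, M.gFirst z s i := by
  rw [H.flow_u t ht, Pi.sub_apply, intervalIntegral_apply (H.gFirst_cont z) ht]

lemma IsBounded.Γ_cont (H : M.IsBounded c T) {k : ℕ} (hk : k ≤ K) (z : M.S k) (n : Fin N) :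
    ContinuousOn (fun t => M.Γ k z t n) (Icc 0 T) := by
  have hc := H.c_nonneg
  induction k generalizing n with
  | zero =>
    exact continuousOn_const.mul (continuousOn_finsetSum _ fun i _ =>
      continuousOn_const.mul (H.gFirst_cont z i))
  | succ k ih =>
    have := H.prob k (by omega)
    obtain ⟨b, hb, hΓ⟩ := exists_Γ_bound d N K c T k
    have ha := H.a_nonneg (k + 1) z
    simp only [Γ]
    refine ContinuousOn.add ?_ ?_
    · refine H.continuousOn_integral (C := c * M.a (k + 1) z * (c * b)) (by omega)
        (fun t ht => ?_) (fun t ht z' => ?_) fun z' => ?_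
      · exact ((H.w_meas k (by omega) t ht).comp measurable_prodMk_right).mul
          ((H.continuous_deriv_h.measurable.comp (H.x_meas k (by omega) t ht n)).mul
            (H.Γ_meas (by omega) ht n))
      · rw [abs_mul, abs_mul, mul_assoc (c * _), mul_assoc c b]
        have := H.w_bound k (by omega) z' z t ht
        have := H.h'_bound (M.x k z' t n)
        have := hΓ M H (by omega) z' t ht n
        gcongr
      · exact (H.w_cont k (by omega) z' z).mul ((H.h'_x_cont (by omega) z' n).mul
          (ih (by omega) z' n))
    · refine H.continuousOn_integral (C := c * (c * c)) (by omega)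
        (fun t ht => ?_) (fun t ht z' => ?_) fun z' => ?_
      · exact (H.h_x_meas (by omega) ht n).mul
          ((H.grad_meas (by omega) ht).comp measurable_prodMk_right)
      · rw [abs_mul]
        have := H.h_bound (M.x k z' t n)
        have := H.abs_grad_le' (by omega) z' z ht
        have := H.one_le_a k z'
        calc _ ≤ c * (c * c) := by gcongr
          _ ≤ c * (c * c) * M.a k z' := le_mul_of_one_le_right (by positivity) this
      · exact (H.h_x_cont (by omega) z' n).mul (H.grad_cont (by omega) z' z)

lemma IsBounded.flow_x_apply (H : M.IsBounded c T) {t : ℝ} (ht : t ∈ Icc 0 T) {k : ℕ}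
    (hk : k < K) (z : M.S (k + 1)) (n : Fin N) :
    M.x (k + 1) z t n = M.x (k + 1) z 0 n - ∫ s in (0 : ℝ)..t, M.Γ (k + 1) z s n := by
  rw [H.flow_x t ht k hk, Pi.sub_apply, intervalIntegral_apply (H.Γ_cont hk z) ht]

end LimitNet

/-! ### Lipschitz dependence on time and persistence of forward propagation -/

namespace LimitNet

variable {d N K : ℕ} {M : LimitNet d N K} {c T : ℝ}

variable (M) in
/-- A bounded flow whose trajectories are Lipschitz in time and satisfy forward propagation at all
times. -/
structure IsRegular (c T : ℝ) : Prop extends M.IsBounded c T where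
  v_lip : ∀ z, ∀ s ∈ Icc 0 T, ∀ t ∈ Icc 0 T, |M.v z t - M.v z s| ≤ c * |t - s|
  w_lip : ∀ k < K, ∀ z z', ∀ s ∈ Icc 0 T, ∀ t ∈ Icc 0 T,
    |M.w k z z' t - M.w k z z' s| ≤ c * |t - s|
  x_lip : ∀ k ≤ K, ∀ z, ∀ s ∈ Icc 0 T, ∀ t ∈ Icc 0 T, ∀ n,
    |M.x k z t n - M.x k z s n| ≤ c * |t - s| * M.a k z
  dOut_lip : ∀ s ∈ Icc 0 T, ∀ t ∈ Icc 0 T, ∀ n, |M.dOut t n - M.dOut s n| ≤ c * |t - s|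
  D_lip : ∀ k ≤ K, ∀ z, ∀ s ∈ Icc 0 T, ∀ t ∈ Icc 0 T, ∀ n,
    |M.D k z t n - M.D k z s n| ≤ c * |t - s| * M.a k z
  fwd : ∀ t ∈ Icc 0 T, ∀ k < K, ∀ z' n,
    M.x (k + 1) z' t n = ∫ z, M.w k z z' t * M.h (M.x k z t n) ∂(M.ρ k)

lemma IsBounded.mono (H : M.IsBounded c T) {c' : ℝ} (hc : c ≤ c') : M.IsBounded c' T where
  __ := H.toIsFlow.mono hc
  D_bound k hk z t ht n := (H.D_bound k hk z t ht n).trans hc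
  w_bound k hk z z' t ht := (H.w_bound k hk z z' t ht).trans
    (mul_le_mul_of_nonneg_right hc (H.a_nonneg (k + 1) z'))
  v_bound z t ht := (H.v_bound z t ht).trans hc

namespace IsBounded

variable (H : M.IsBounded c T)
include H

lemma integrable_of_le {k : ℕ} (hk : k ≤ K) {f : M.S k → ℝ} {C : ℝ} (hm : Measurable f)
    (hf : ∀ z, |f z| ≤ C * M.a k z) : Integrable f (M.ρ k) :=
  ((H.a_int hk).const_mul C).mono' hm.aestronglyMeasurable (ae_of_all _ hf)

lemma v_lip' (z : M.S K) {s t : ℝ} (hs : s ∈ Icc 0 T) (ht : t ∈ Icc 0 T) :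
    |M.v z t - M.v z s| ≤ c * c * |t - s| :=
  abs_sub_le_of_integral_eq (H.gOut_cont z) (fun t ht => H.flow_v t ht z)
    (fun t _ => H.abs_gOut_le z t) hs ht

lemma w_lip' {k : ℕ} (hk : k < K) (z : M.S k) (z' : M.S (k + 1)) {s t : ℝ} (hs : s ∈ Icc 0 T)
    (ht : t ∈ Icc 0 T) : |M.w k z z' t - M.w k z z' s| ≤ c * c * |t - s| :=
  abs_sub_le_of_integral_eq (H.grad_cont hk z z') (fun t ht => H.flow_w t ht k hk z z')
    (fun _ ht => H.abs_grad_le' hk z z' ht) hs ht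

lemma x_lip_zero (z : M.S 0) {s t : ℝ} (hs : s ∈ Icc 0 T) (ht : t ∈ Icc 0 T) (n : Fin N) :
    |M.x 0 z t n - M.x 0 z s n| ≤ c * (c * c * |t - s|) * M.a 0 z := by
  have hc := H.c_nonneg
  refine le_trans ?_ (le_mul_of_one_le_right (by positivity) (H.one_le_a 0 z))
  rw [H.x_zero t ht, H.x_zero s hs, ← mul_sub, ← Finset.sum_sub_distrib]
  refine abs_avg_le (by positivity) fun i => ?_
  rw [← mul_sub, abs_mul]
  have := H.X_bound n i
  have := abs_sub_le_of_integral_eq (H.gFirst_cont z i) (fun t ht => H.flow_u_apply ht z i)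
    (fun _ ht => H.abs_gFirst_le z ht i) hs ht
  gcongr

lemma x_lip_succ {k : ℕ} (hk : k < K) {b : ℝ} (z : M.S (k + 1))
    (hb : ∀ t ∈ Icc 0 T, ∀ n, |M.Γ (k + 1) z t n| ≤ b * M.a (k + 1) z) {s t : ℝ}
    (hs : s ∈ Icc 0 T) (ht : t ∈ Icc 0 T) (n : Fin N) :
    |M.x (k + 1) z t n - M.x (k + 1) z s n| ≤ b * |t - s| * M.a (k + 1) z := by
  rw [mul_right_comm]
  exact abs_sub_le_of_integral_eq (H.Γ_cont hk z n) (fun t ht => H.flow_x_apply ht hk z n)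
    (fun t ht => hb t ht n) hs ht

lemma h_x_lip {b δ : ℝ} {k : ℕ} {z : M.S k} {s t : ℝ} {n : Fin N}
    (hx : |M.x k z t n - M.x k z s n| ≤ b * δ * M.a k z) :
    |M.h (M.x k z t n) - M.h (M.x k z s n)| ≤ c * b * δ * M.a k z :=
  (H.h_lip _ _).trans ((mul_le_mul_of_nonneg_left hx H.c_nonneg).trans_eq (by ring))

lemma h'_x_lip {b δ : ℝ} {k : ℕ} {z : M.S k} {s t : ℝ} {n : Fin N}
    (hx : |M.x k z t n - M.x k z s n| ≤ b * δ * M.a k z) :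
    |deriv M.h (M.x k z t n) - deriv M.h (M.x k z s n)| ≤ c * b * δ * M.a k z :=
  (H.h'_lip _ _).trans ((mul_le_mul_of_nonneg_left hx H.c_nonneg).trans_eq (by ring))

lemma dOut_lip' {b : ℝ} (hb : 0 ≤ b) {s t : ℝ} (hs : s ∈ Icc 0 T) (ht : t ∈ Icc 0 T)
    {n : Fin N} (hx : ∀ z, |M.x K z t n - M.x K z s n| ≤ b * |t - s| * M.a K z) :
    |M.dOut t n - M.dOut s n| ≤ c * ((c * (c * b) + c * c * c) * c) * |t - s| := by
  have hc := H.c_nonneg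
  refine (H.ψ_lip n _ _).trans ?_
  rw [mul_assoc c]
  refine mul_le_mul_of_nonneg_left ?_ hc
  rw [out, out, ← integral_sub]
  · refine (H.abs_integral_le le_rfl (C := (c * (c * b) + c * c * c) * |t - s|)
      (by positivity) fun z => ?_).trans_eq (by ring)
    refine (abs_mul_sub_mul_le (H.v_bound z t ht) (H.h_bound _) (H.v_lip' z hs ht)
      (H.h_x_lip (hx z))).trans ?_
    have ha := H.one_le_a K z
    have : c * c * |t - s| * c ≤ (c * c * |t - s| * c) * M.a K z :=
      le_mul_of_one_le_right (by positivity) ha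
    linarith
  · exact H.integrable_of_le le_rfl ((H.v_meas t ht).mul (H.h_x_meas le_rfl ht n))
      fun z => H.abs_v_mul_h_le ht z n
  · exact H.integrable_of_le le_rfl ((H.v_meas s hs).mul (H.h_x_meas le_rfl hs n))
      fun z => H.abs_v_mul_h_le hs z n

lemma integrable_w_mul_D {k : ℕ} (hk : k < K) {t : ℝ} (ht : t ∈ Icc 0 T) (z : M.S k)
    (n : Fin N) : Integrable (fun z' => M.w k z z' t * M.D (k + 1) z' t n) (M.ρ (k + 1)) :=
  H.integrable_of_le (by omega) (((H.w_meas k hk t ht).comp measurable_prodMk_left).mul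
    (H.D_meas (by omega) ht n)) fun z' => H.abs_w_mul_D_le hk ht z z' n

lemma abs_w_mul_h_le {k : ℕ} (hk : k < K) {t : ℝ} (ht : t ∈ Icc 0 T) (z : M.S k)
    (z' : M.S (k + 1)) (n : Fin N) :
    |M.w k z z' t * M.h (M.x k z t n)| ≤ c * M.a (k + 1) z' * c := by
  rw [abs_mul]
  have := H.a_nonneg (k + 1) z'
  have := H.c_nonneg
  exact mul_le_mul (H.w_bound k hk z z' t ht) (H.h_bound _) (abs_nonneg _) (by positivity)

lemma w_mul_h_meas {k : ℕ} (hk : k < K) {t : ℝ} (ht : t ∈ Icc 0 T)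
    (z' : M.S (k + 1)) (n : Fin N) :
    Measurable (fun z => M.w k z z' t * M.h (M.x k z t n)) :=
  ((H.w_meas k hk t ht).comp measurable_prodMk_right).mul (H.h_x_meas (by omega) ht n)

lemma x_hasDerivAt {k : ℕ} (hk : k ≤ K) (z : M.S k) (n : Fin N) {t : ℝ} (ht : t ∈ Ioo 0 T) :
    HasDerivAt (fun t => M.x k z t n) (-M.Γ k z t n) t := by
  cases k with
  | zero =>
    have h1 : HasDerivAt (fun t => (1 / (d : ℝ)) * ∑ i, M.X n i * M.u z t i)
        ((1 / (d : ℝ)) * ∑ i, M.X n i * (- M.gFirst z t i)) t := by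
      refine (HasDerivAt.fun_sum fun i _ => ?_).const_mul _
      exact (hasDerivAt_of_integral_eq (H.gFirst_cont z i)
        (fun t ht => H.flow_u_apply ht z i) ht).const_mul _
    have h2 : -M.Γ 0 z t n = (1 / (d : ℝ)) * ∑ i, M.X n i * (- M.gFirst z t i) := by
      simp [Γ]
    rw [h2]
    exact h1.congr_of_eventuallyEq (Filter.eventually_of_mem (Icc_mem_nhds ht.1 ht.2)
      fun s hs => H.x_zero s hs z n)
  | succ k =>
    exact hasDerivAt_of_integral_eq (H.Γ_cont hk z n) (fun t ht => H.flow_x_apply ht hk z n) ht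

/-- Both sides agree at time `0` and have derivative `-Γ (k + 1)` inside the interval: `Γ` is what
the product and chain rules give when `w` and `x k` move with velocities `-grad` and `-Γ k`. -/
lemma fwd' {t : ℝ} (ht : t ∈ Icc 0 T) {k : ℕ} (hk : k < K) (z' : M.S (k + 1)) (n : Fin N) :
    M.x (k + 1) z' t n = ∫ z, M.w k z z' t * M.h (M.x k z t n) ∂(M.ρ k) := by
  have hc := H.c_nonneg
  have ha' := H.a_nonneg (k + 1) z'
  have hkK : k ≤ K := by omega
  have := H.prob k hkK
  obtain ⟨b, hb, hΓ⟩ := exists_Γ_bound d N K c T k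
  have sub : ∀ {s}, s ∈ Ioo 0 T → s ∈ Icc 0 T := fun hs => Ioo_subset_Icc_self hs
  have hm1 : ∀ s ∈ Icc 0 T, Measurable
      fun z => M.w k z z' s * (deriv M.h (M.x k z s n) * M.Γ k z s n) := fun s hs =>
    ((H.w_meas k hk s hs).comp measurable_prodMk_right).mul
      ((H.continuous_deriv_h.measurable.comp (H.x_meas k hkK s hs n)).mul (H.Γ_meas hkK hs n))
  have hm2 : ∀ s ∈ Icc 0 T, Measurable
      fun z => M.h (M.x k z s n) * M.grad k z z' s := fun s hs =>
    (H.h_x_meas hkK hs n).mul ((H.grad_meas hk hs).comp measurable_prodMk_right)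
  have hb1 : ∀ s ∈ Icc 0 T, ∀ z, |M.w k z z' s * (deriv M.h (M.x k z s n) * M.Γ k z s n)|
      ≤ c * M.a (k + 1) z' * (c * b) * M.a k z := fun s hs z => by
    rw [abs_mul, abs_mul, mul_assoc (c * _), mul_assoc c b]
    have := H.w_bound k hk z z' s hs
    have := H.h'_bound (M.x k z s n)
    have := hΓ M H hkK z s hs n
    gcongr
  have hb2 : ∀ s ∈ Icc 0 T, ∀ z, |M.h (M.x k z s n) * M.grad k z z' s|
      ≤ c * (c * c) * M.a k z := fun s hs z => by
    rw [abs_mul]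
    have := H.h_bound (M.x k z s n)
    have := H.abs_grad_le' hk z z' hs
    calc _ ≤ c * (c * c) := by gcongr
      _ ≤ c * (c * c) * M.a k z := le_mul_of_one_le_right (by positivity) (H.one_le_a k z)
  set F : ℝ → ℝ := fun t => ∫ z, M.w k z z' t * M.h (M.x k z t n) ∂(M.ρ k) with hF
  have hFc : ContinuousOn F (Icc 0 T) := by
    refine H.continuousOn_integral (C := c * M.a (k + 1) z' * c) hkK
      (fun s hs => H.w_mul_h_meas hk hs z' n) (fun s hs z => ?_) fun z =>
      (H.w_cont k hk z z').mul (H.h_x_cont hkK z n)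
    exact (H.abs_w_mul_h_le hk hs z z' n).trans
      (le_mul_of_one_le_right (by positivity) (H.one_le_a k z))
  -- Differentiation under the integral sign, with the growth bounds of the two parts of `Γ` as a
  -- majorant uniform in time.
  have hFd : ∀ s ∈ Ioo 0 T, HasDerivAt F (-M.Γ (k + 1) z' s n) s := by
    intro s hs
    have h1 := hasDerivAt_integral_of_dominated_loc_of_deriv_le (μ := M.ρ k)
      (F := fun t z => M.w k z z' t * M.h (M.x k z t n))
      (F' := fun t z => -(M.w k z z' t * (deriv M.h (M.x k z t n) * M.Γ k z t n)
        + M.h (M.x k z t n) * M.grad k z z' t))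
      (bound := fun z => (c * M.a (k + 1) z' * (c * b) + c * (c * c)) * M.a k z)
      (x₀ := s) (s := Ioo 0 T) (Ioo_mem_nhds hs.1 hs.2)
      (Filter.eventually_of_mem (Ioo_mem_nhds hs.1 hs.2) fun r hr =>
        (H.w_mul_h_meas hk (sub hr) z' n).aestronglyMeasurable)
      (H.integrable_of_le (C := c * M.a (k + 1) z' * c) hkK (H.w_mul_h_meas hk (sub hs) z' n)
        fun z => (H.abs_w_mul_h_le hk (sub hs) z z' n).trans
          (le_mul_of_one_le_right (by positivity) (H.one_le_a k z)))
      ((hm1 s (sub hs)).add (hm2 s (sub hs))).neg.aestronglyMeasurable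
      (ae_of_all _ fun z r hr => by
        rw [norm_neg, add_mul]
        exact (norm_add_le _ _).trans (add_le_add (hb1 r (sub hr) z) (hb2 r (sub hr) z)))
      ((H.a_int hkK).const_mul _)
      (ae_of_all _ fun z r hr => by
        have hw := hasDerivAt_of_integral_eq (H.grad_cont hk z z')
          (fun t ht => H.flow_w t ht k hk z z') hr
        have hx := (H.h_diff (M.x k z r n)).hasDerivAt.comp r (H.x_hasDerivAt hkK z n hr)
        refine (hw.mul hx).congr_deriv ?_
        simp only [Function.comp]
        ring)
    refine h1.2.congr_deriv ?_
    rw [integral_neg, integral_add (H.integrable_of_le hkK (hm1 s (sub hs)) (hb1 s (sub hs)))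
      (H.integrable_of_le hkK (hm2 s (sub hs)) (hb2 s (sub hs))), Γ]
  -- The flow equations hold only on `[0, T]`, so two-sided derivatives exist only inside.
  -- Continuity of `F` up to the endpoints makes the fundamental theorem applicable.
  have hI := intervalIntegral.integral_eq_sub_of_hasDerivAt_of_le ht.1
    (hFc.mono (Icc_subset_Icc_right ht.2))
    (fun s hs => hFd s ⟨hs.1, hs.2.trans_le ht.2⟩)
    (((H.Γ_cont hk z' n).neg.mono (by
      rw [uIcc_of_le ht.1]; exact Icc_subset_Icc_right ht.2)).intervalIntegrable)
  rw [intervalIntegral.integral_neg] at hI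
  have h0 : M.x (k + 1) z' 0 n = F 0 := H.fwd_init k hk z' n
  have h2 : M.x (k + 1) z' t n = F t := by
    rw [H.flow_x_apply ht hk z' n, h0]
    linarith
  exact h2

end IsBounded

lemma exists_x_lip (d N K : ℕ) (c T : ℝ) (k : ℕ) : ∃ C : ℝ, 0 ≤ C ∧
    ∀ M : LimitNet d N K, M.IsBounded c T → k ≤ K → ∀ z, ∀ s ∈ Icc 0 T, ∀ t ∈ Icc 0 T, ∀ n,
      |M.x k z t n - M.x k z s n| ≤ C * |t - s| * M.a k z := by
  by_cases hc : 0 ≤ c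
  swap
  · exact ⟨0, le_rfl, fun M H => absurd H.c_nonneg hc⟩
  cases k with
  | zero =>
    exact ⟨c * (c * c), by positivity, fun M H hk z s hs t ht n =>
      (H.x_lip_zero z hs ht n).trans_eq (by ring)⟩
  | succ k =>
    obtain ⟨b, hb, hΓ⟩ := exists_Γ_bound d N K c T (k + 1)
    exact ⟨b, hb, fun M H hk z s hs t ht n => H.x_lip_succ hk z (hΓ M H hk z) hs ht n⟩

/-- Descending induction as for the bound. Here the growth of the connecting weight meets the growth
of the Lipschitz constant of the next backward feature, so the majorant is `a ^ 2`. This is where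
second moments of the sizes enter. -/
lemma exists_D_lip (d N K : ℕ) (c T : ℝ) (r : ℕ) : ∃ C : ℝ, 0 ≤ C ∧
    ∀ M : LimitNet d N K, M.IsBounded c T → ∀ k, k + r = K → ∀ z,
      ∀ s ∈ Icc 0 T, ∀ t ∈ Icc 0 T, ∀ n,
      |M.D k z t n - M.D k z s n| ≤ C * |t - s| * M.a k z := by
  by_cases hc : 0 ≤ c
  swap
  · exact ⟨0, le_rfl, fun M H => absurd H.c_nonneg hc⟩
  induction r with
  | zero =>
    obtain ⟨b, hb, hx⟩ := exists_x_lip d N K c T K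
    set e := c * ((c * (c * b) + c * c * c) * c) with he
    have he0 : 0 ≤ e := by positivity
    refine ⟨c * c * (c * b) + (c * e + c * c * c) * c, by positivity,
      fun M H k hk z s hs t ht n => ?_⟩
    obtain rfl : k = K := hk
    rw [H.D_top t ht, H.D_top s hs]
    have hd := H.dOut_lip' hb hs ht fun z => hx M H le_rfl z s hs t ht n
    have h1 := abs_mul_sub_mul_le (H.v_bound z t ht) (H.abs_dOut_le s n) (H.v_lip' z hs ht) hd
    have h2 : |M.v z t * M.dOut t n| ≤ c * c := by
      rw [abs_mul]
      exact mul_le_mul (H.v_bound z t ht) (H.abs_dOut_le t n) (abs_nonneg _) hc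
    refine (abs_mul_sub_mul_le h2 (H.h'_bound _) h1
      (H.h'_x_lip (hx M H le_rfl z s hs t ht n))).trans ?_
    have : (c * e + c * c * c) * c * |t - s| ≤ (c * e + c * c * c) * c * |t - s| * M.a k z :=
      le_mul_of_one_le_right (by positivity) (H.one_le_a k z)
    linarith
  | succ r ih =>
    obtain ⟨b, hb, ih⟩ := ih
    -- For larger `r` no layer lies `r + 1` below the top, and the statement is empty.
    by_cases hr : r + 1 ≤ K
    swap
    · exact ⟨0, le_rfl, fun M H k hk => by omega⟩
    obtain ⟨bx, hbx, hx⟩ := exists_x_lip d N K c T (K - (r + 1))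
    refine ⟨c * c * c * (c * bx) + (c * b + c * c * c) * c * c, by positivity,
      fun M H k hk z s hs t ht n => ?_⟩
    obtain rfl : k = K - (r + 1) := by omega
    have hk' : K - (r + 1) < K := by omega
    rw [H.D_succ t ht _ hk', H.D_succ s hs _ hk']
    have h2 := H.abs_integral_le (by omega) (by positivity)
      fun z' => H.abs_w_mul_D_le hk' ht z z' n
    have h1 : |(∫ z', M.w (K - (r + 1)) z z' t * M.D (K - (r + 1) + 1) z' t n ∂(M.ρ _))
        - ∫ z', M.w (K - (r + 1)) z z' s * M.D (K - (r + 1) + 1) z' s n ∂(M.ρ _)|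
        ≤ (c * b + c * c * c) * |t - s| * c := by
      rw [← integral_sub (H.integrable_w_mul_D hk' ht z n) (H.integrable_w_mul_D hk' hs z n)]
      refine H.abs_integral_le_sq (by omega) (by positivity) fun z' => ?_
      refine (abs_mul_sub_mul_le (H.w_bound _ hk' z z' t ht)
        (H.D_bound _ (by omega) z' s hs n) (H.w_lip' hk' z z' hs ht)
        (ih M H _ (by omega) z' s hs t ht n)).trans ?_
      have h3 : 1 ≤ M.a (K - (r + 1) + 1) z' ^ 2 :=
        (H.one_le_a _ z').trans (H.a_le_sq _ z')
      have : c * c * |t - s| * c ≤ c * c * |t - s| * c * M.a (K - (r + 1) + 1) z' ^ 2 :=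
        le_mul_of_one_le_right (by positivity) h3
      linarith
    refine (abs_mul_sub_mul_le h2 (H.h'_bound _) h1
      (H.h'_x_lip (hx M H (by omega) z s hs t ht n))).trans ?_
    have : (c * b + c * c * c) * |t - s| * c * c
        ≤ (c * b + c * c * c) * |t - s| * c * c * M.a (K - (r + 1)) z :=
      le_mul_of_one_le_right (by positivity) (H.one_le_a _ z)
    linarith

/-- Every feature flow is regular, with a constant depending only on the parameters. -/
theorem exists_isRegular (d N K : ℕ) (c T : ℝ) : ∃ c' : ℝ, c ≤ c' ∧
    ∀ M : LimitNet d N K, M.IsFlow c T → M.IsRegular c' T := by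
  obtain ⟨c₁, hc₁, hB⟩ := exists_isBounded d N K c T
  obtain ⟨bx, hbx⟩ := exists_uniform_const (P := fun k C => 0 ≤ C ∧
    ∀ M : LimitNet d N K, M.IsBounded c₁ T → k ≤ K → ∀ z, ∀ s ∈ Icc 0 T, ∀ t ∈ Icc 0 T, ∀ n,
      |M.x k z t n - M.x k z s n| ≤ C * |t - s| * M.a k z)
    (fun k C C' hC h => ⟨h.1.trans hC, fun M H hk z s hs t ht n => by
      have := H.a_nonneg k z
      exact (h.2 M H hk z s hs t ht n).trans (by gcongr)⟩) (exists_x_lip d N K c₁ T) K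
  obtain ⟨bD, hbD⟩ := exists_uniform_const (P := fun r C => 0 ≤ C ∧
    ∀ M : LimitNet d N K, M.IsBounded c₁ T → ∀ k, k + r = K → ∀ z,
      ∀ s ∈ Icc 0 T, ∀ t ∈ Icc 0 T, ∀ n,
      |M.D k z t n - M.D k z s n| ≤ C * |t - s| * M.a k z)
    (fun k C C' hC h => ⟨h.1.trans hC, fun M H k hk z s hs t ht n => by
      have := H.a_nonneg k z
      exact (h.2 M H k hk z s hs t ht n).trans (by gcongr)⟩) (exists_D_lip d N K c₁ T) K
  have hbx0 : 0 ≤ bx := (hbx 0 (Nat.zero_le _)).1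
  have hbD0 : 0 ≤ bD := (hbD 0 (Nat.zero_le _)).1
  set e := |c₁| * ((|c₁| * (|c₁| * bx) + |c₁| * |c₁| * |c₁|) * |c₁|) with he
  have he0 : 0 ≤ e := by positivity
  have hcc : 0 ≤ |c₁| * |c₁| := by positivity
  -- The sum dominates every separate constant: `c₁` for the bounds, `c₁ * c₁` for the weights, `bx`
  -- for the features, `bD` for the backward features, and `e` for the derivative of the loss.
  refine ⟨|c₁| + bx + bD + e + |c₁| * |c₁|, ?_, fun M HF => ?_⟩
  · have := le_abs_self c₁
    linarith
  have H := hB M HF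
  have hc := H.c_nonneg
  rw [abs_of_nonneg hc] at he hcc ⊢
  have key : ∀ {C δ y : ℝ}, C ≤ c₁ + bx + bD + e + c₁ * c₁ → y ≤ C * |δ| →
      y ≤ (c₁ + bx + bD + e + c₁ * c₁) * |δ| := fun h1 h2 => h2.trans (by gcongr)
  exact
    { H.mono (by linarith) with
      v_lip := fun z s hs t ht => key (by linarith) (H.v_lip' z hs ht)
      w_lip := fun k hk z z' s hs t ht => key (by linarith) (H.w_lip' hk z z' hs ht)
      x_lip := fun k hk z s hs t ht n => by
        refine ((hbx k hk).2 M H hk z s hs t ht n).trans ?_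
        have := H.a_nonneg k z
        gcongr
        linarith
      dOut_lip := fun s hs t ht n => by
        refine key (C := e) (by linarith) ?_
        rw [he]
        exact H.dOut_lip' hbx0 hs ht fun z => (hbx K le_rfl).2 M H le_rfl z s hs t ht n
      D_lip := fun k hk z s hs t ht n => by
        refine ((hbD (K - k) (by omega)).2 M H k (by omega) z s hs t ht n).trans ?_
        have := H.a_nonneg k z
        gcongr
        linarith
      fwd := fun t ht k hk z' n => H.fwd' ht hk z' n }

end LimitNet

/-! ### Exponential moments and deviation inequalities -/

/-- Second-order Taylor remainder of the exponential. The linear term is kept exact because it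
integrates to zero for a centred variable. -/
lemma exp_le_one_add_add_sq_mul (y : ℝ) :
    Real.exp y ≤ 1 + y + y ^ 2 * Real.exp |y| := by
  have h := Complex.norm_exp_sub_sum_le_norm_mul_exp (y : ℂ) 2
  have h2 : Complex.exp (y : ℂ) - ∑ m ∈ Finset.range 2, (y : ℂ) ^ m / (m.factorial : ℂ)
      = ((Real.exp y - (1 + y) : ℝ) : ℂ) := by
    simp [Finset.sum_range_succ]
  rw [h2, Complex.norm_real, Complex.norm_real, Real.norm_eq_abs, Real.norm_eq_abs, sq_abs] at h
  linarith [le_abs_self (Real.exp y - (1 + y))]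

/-- Extracts the factor `t ^ 2` needed for a sub-gaussian moment generating function; the remaining
`y ^ 2` is absorbed by a second copy of the exponential, whence the factor two in the exponent. -/
lemma sq_mul_exp_le {y t t₀ : ℝ} (ht₀ : 0 < t₀) (ht : |t| ≤ t₀) :
    (t * y) ^ 2 * Real.exp |t * y| ≤ t ^ 2 * (2 / t₀ ^ 2) * Real.exp (2 * t₀ * |y|) := by
  have h1 : (t₀ * |y|) ^ 2 ≤ 2 * Real.exp (t₀ * |y|) := by
    have h := Real.quadratic_le_exp_of_nonneg (x := t₀ * |y|) (by positivity)
    have : 0 ≤ t₀ * |y| := by positivity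
    linarith
  have h2 : Real.exp |t * y| ≤ Real.exp (t₀ * |y|) := by
    rw [abs_mul]
    gcongr
  have h3 : y ^ 2 ≤ 2 / t₀ ^ 2 * Real.exp (t₀ * |y|) := by
    rw [mul_pow, sq_abs] at h1
    rw [div_mul_eq_mul_div, le_div_iff₀ (by positivity)]
    linarith
  calc (t * y) ^ 2 * Real.exp |t * y| = t ^ 2 * (y ^ 2 * Real.exp |t * y|) := by ring
    _ ≤ t ^ 2 * ((2 / t₀ ^ 2 * Real.exp (t₀ * |y|)) * Real.exp (t₀ * |y|)) := by gcongr
    _ = _ := by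
      rw [mul_assoc (2 / t₀ ^ 2), ← Real.exp_add]
      ring_nf

lemma le_exp_mul_div {β : ℝ} (hβ : 0 < β) (q : ℝ) : q ≤ Real.exp (β * q) / β := by
  rw [le_div_iff₀ hβ]
  have := Real.add_one_le_exp (β * q)
  linarith

section Mgf

variable {E : Type*} [MeasurableSpace E] {ρ : Measure E} [IsProbabilityMeasure ρ]
  {f q : E → ℝ} {β c : ℝ}

omit [IsProbabilityMeasure ρ] in
lemma integrable_of_abs_le_of_exp (hβ : 0 < β) (hf : Measurable f) (hfq : ∀ z, |f z| ≤ q z)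
    (hint : Integrable (fun z => Real.exp (β * q z)) ρ) : Integrable f ρ :=
  (hint.div_const β).mono' hf.aestronglyMeasurable
    (ae_of_all _ fun z => (hfq z).trans (le_exp_mul_div hβ _))

omit [IsProbabilityMeasure ρ] in
lemma abs_integral_le_of_exp (hβ : 0 < β) (hfq : ∀ z, |f z| ≤ q z)
    (hint : Integrable (fun z => Real.exp (β * q z)) ρ)
    (hle : ∫ z, Real.exp (β * q z) ∂ρ ≤ c) : |∫ z, f z ∂ρ| ≤ c / β := by
  refine (norm_integral_le_of_norm_le (f := f) (hint.div_const β)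
    (ae_of_all _ fun z => (hfq z).trans (le_exp_mul_div hβ _))).trans ?_
  rw [integral_div]
  gcongr

/-- The variance proxy in the moment generating function of a centred variable with an exponential
moment. -/
def mgfConst (β c : ℝ) : ℝ := 8 / β ^ 2 * (Real.exp c * c)

omit [IsProbabilityMeasure ρ] in
-- Taylor expansion with `t₀ = β / 2`, so that the doubled exponent is exactly `β`. The mean is at
-- most `c / β` in absolute value, so centring costs only the factor `exp c`.
lemma exp_centered_le (hβ : 0 < β) (hfq : ∀ z, |f z| ≤ q z)
    (hint : Integrable (fun z => Real.exp (β * q z)) ρ)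
    (hle : ∫ z, Real.exp (β * q z) ∂ρ ≤ c) {t : ℝ} (ht : |t| ≤ β / 2) (z : E) :
    Real.exp (t * (f z - ∫ z, f z ∂ρ)) ≤ 1 + t * (f z - ∫ z, f z ∂ρ)
      + t ^ 2 * (8 / β ^ 2) * (Real.exp c * Real.exp (β * q z)) := by
  set y := f z - ∫ z, f z ∂ρ with hy
  refine (exp_le_one_add_add_sq_mul _).trans (add_le_add le_rfl ?_)
  refine (sq_mul_exp_le (half_pos hβ) ht).trans ?_
  rw [← Real.exp_add]
  have h1 : 2 / (β / 2) ^ 2 = 8 / β ^ 2 := by field_simp; norm_num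
  have h2 : |y| ≤ q z + c / β :=
    (abs_sub _ _).trans (add_le_add (hfq z) (abs_integral_le_of_exp hβ hfq hint hle))
  have h3 : 2 * (β / 2) * |y| ≤ c + β * q z := by
    calc 2 * (β / 2) * |y| = β * |y| := by ring
      _ ≤ β * (q z + c / β) := by gcongr
      _ = c + β * q z := by field_simp; ring
  rw [h1]
  gcongr

lemma integrable_exp_bound (hβ : 0 < β) (hf : Measurable f) (hfq : ∀ z, |f z| ≤ q z)
    (hint : Integrable (fun z => Real.exp (β * q z)) ρ) (t : ℝ) :
    Integrable (fun z => 1 + t * (f z - ∫ z, f z ∂ρ)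
      + t ^ 2 * (8 / β ^ 2) * (Real.exp c * Real.exp (β * q z))) ρ :=
  ((integrable_const _).add (((integrable_of_abs_le_of_exp hβ hf hfq hint).sub
    (integrable_const _)).const_mul t)).add ((hint.const_mul _).const_mul _)

lemma integrable_exp_centered (hβ : 0 < β) (hf : Measurable f) (hfq : ∀ z, |f z| ≤ q z)
    (hint : Integrable (fun z => Real.exp (β * q z)) ρ)
    (hle : ∫ z, Real.exp (β * q z) ∂ρ ≤ c) {t : ℝ} (ht : |t| ≤ β / 2) :
    Integrable (fun z => Real.exp (t * (f z - ∫ z, f z ∂ρ))) ρ := by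
  refine (integrable_exp_bound (c := c) hβ hf hfq hint t).mono'
    (by fun_prop) (ae_of_all _ fun z => ?_)
  rw [Real.norm_eq_abs, Real.abs_exp]
  exact exp_centered_le hβ hfq hint hle ht z

/-- Integrating the pointwise expansion kills the linear term, and `1 + y ≤ exp y` turns the rest
into an exponential of `t ^ 2`. -/
lemma mgf_centered_le (hβ : 0 < β) (hf : Measurable f) (hfq : ∀ z, |f z| ≤ q z)
    (hint : Integrable (fun z => Real.exp (β * q z)) ρ)
    (hle : ∫ z, Real.exp (β * q z) ∂ρ ≤ c) {t : ℝ} (ht : |t| ≤ β / 2) :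
    ∫ z, Real.exp (t * (f z - ∫ z, f z ∂ρ)) ∂ρ ≤ Real.exp (mgfConst β c * t ^ 2) := by
  have hfi := integrable_of_abs_le_of_exp hβ hf hfq hint
  refine (integral_mono (integrable_exp_centered hβ hf hfq hint hle ht)
    (integrable_exp_bound hβ hf hfq hint t)
    (exp_centered_le hβ hfq hint hle ht)).trans ?_
  have i0 : Integrable (fun z => t * (f z - ∫ z, f z ∂ρ)) ρ :=
    (hfi.sub (integrable_const _)).const_mul t
  have i1 : Integrable (fun z => 1 + t * (f z - ∫ z, f z ∂ρ)) ρ := (integrable_const _).add i0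
  have i2 : Integrable (fun z => t ^ 2 * (8 / β ^ 2) * (Real.exp c * Real.exp (β * q z))) ρ :=
    (hint.const_mul _).const_mul _
  rw [integral_add i1 i2, integral_add (integrable_const _) i0, integral_const_mul,
    integral_const_mul, integral_const_mul, integral_sub hfi (integrable_const _)]
  simp only [integral_const, probReal_univ, smul_eq_mul, one_mul, sub_self, mul_zero, add_zero]
  refine le_trans ?_ (Real.add_one_le_exp _)
  have : t ^ 2 * (8 / β ^ 2) * (Real.exp c * ∫ z, Real.exp (β * q z) ∂ρ)
      ≤ t ^ 2 * (8 / β ^ 2) * (Real.exp c * c) := by gcongr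
  rw [mgfConst]
  linarith

end Mgf

/-- The rate in the deviation inequality `measure_abs_avg_sub_ge_le`. -/
def devRate (β c : ℝ) : ℝ := min (β / 2) (1 / (2 * mgfConst β c)) / 2

lemma mgfConst_pos {β c : ℝ} (hβ : 0 < β) (hc : 0 < c) : 0 < mgfConst β c := by
  unfold mgfConst; positivity

lemma devRate_pos {β c : ℝ} (hβ : 0 < β) (hc : 0 < c) : 0 < devRate β c := by
  have := mgfConst_pos hβ hc
  exact half_pos (lt_min (by positivity) (by positivity))

section Deviation

variable {Ω E : Type*} [MeasurableSpace Ω] [MeasurableSpace E] {μ : Measure Ω}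
  [IsProbabilityMeasure μ] {ρ : Measure E} [IsProbabilityMeasure ρ] {f q : E → ℝ} {β c : ℝ}
  {m : ℕ} {Z : Fin m → Ω → E}

/-- Chernoff's bound with parameter `τ s`. The exponent is `-m τ s² + m C τ² s²` with `C = mgfConst
β c`, and `τ ≤ 1 / (2C)` makes the second term at most half the first. The restriction `s ≤ 1` keeps
the parameter within `β / 2`, where the moment bound is valid. -/
lemma measure_avg_sub_ge_le (hβ : 0 < β) (hc : 0 < c) (hf : Measurable f)
    (hfq : ∀ z, |f z| ≤ q z) (hint : Integrable (fun z => Real.exp (β * q z)) ρ)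
    (hle : ∫ z, Real.exp (β * q z) ∂ρ ≤ c) (hZ : ∀ i, Measurable (Z i))
    (hlaw : ∀ i, μ.map (Z i) = ρ) (hind : iIndepFun Z μ) (hm : 0 < m) {s : ℝ} (hs : 0 ≤ s)
    (hs1 : s ≤ 1) :
    μ.real {ω | s ≤ (1 / (m : ℝ)) * ∑ i, f (Z i ω) - ∫ z, f z ∂ρ}
      ≤ Real.exp (-(devRate β c * (m * s ^ 2))) := by
  set g : E → ℝ := fun z => f z - ∫ z, f z ∂ρ with hg
  have hgm : Measurable g := hf.sub_const _
  set τ := min (β / 2) (1 / (2 * mgfConst β c)) with hτ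
  have hC := mgfConst_pos hβ hc
  have hτ0 : 0 < τ := lt_min (by positivity) (by positivity)
  have hτ1 : mgfConst β c * τ ≤ 1 / 2 := by
    calc mgfConst β c * τ ≤ mgfConst β c * (1 / (2 * mgfConst β c)) := by
          gcongr; exact min_le_right _ _
      _ = 1 / 2 := by field_simp
  have ht : |τ * s| ≤ β / 2 := by
    rw [abs_of_nonneg (by positivity)]
    calc τ * s ≤ τ := mul_le_of_le_one_right hτ0.le hs1
      _ ≤ β / 2 := min_le_left _ _
  have hm' : (0 : ℝ) < m := by exact_mod_cast hm
  have hind' : iIndepFun (fun i ω => g (Z i ω)) μ := hind.comp (fun _ => g) fun _ => hgm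
  have hmeas : ∀ i, Measurable (fun ω => g (Z i ω)) := fun i => hgm.comp (hZ i)
  have hset : {ω | s ≤ (1 / (m : ℝ)) * ∑ i, f (Z i ω) - ∫ z, f z ∂ρ}
      = {ω | m * s ≤ (∑ i, fun ω => g (Z i ω)) ω} := by
    ext ω
    simp only [mem_ofPred_eq, Finset.sum_apply, hg, Finset.sum_sub_distrib, Finset.sum_const,
      Finset.card_univ, Fintype.card_fin, nsmul_eq_mul]
    rw [show (1 / (m : ℝ)) * ∑ i, f (Z i ω) - ∫ z, f z ∂ρ
      = (∑ i, f (Z i ω) - m * ∫ z, f z ∂ρ) / m by field_simp, le_div_iff₀ hm', mul_comm s]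
  have hmgf : ∀ i, mgf (fun ω => g (Z i ω)) μ (τ * s)
      = ∫ z, Real.exp (τ * s * g z) ∂ρ := fun i => by
    rw [mgf, ← hlaw i, integral_map (hZ i).aemeasurable (by fun_prop)]
  have hexp : ∀ i, Integrable (fun ω => Real.exp (τ * s * g (Z i ω))) μ := fun i => by
    have h1 : Integrable (fun z => Real.exp (τ * s * g z)) (μ.map (Z i)) := by
      rw [hlaw i]; exact integrable_exp_centered hβ hf hfq hint hle ht
    exact h1.comp_measurable (hZ i)
  rw [hset]
  refine (measure_ge_le_exp_mul_mgf (t := τ * s) _ (by positivity)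
    (hind'.integrable_exp_mul_sum hmeas fun i _ => hexp i)).trans ?_
  rw [hind'.mgf_sum hmeas]
  simp_rw [hmgf]
  rw [Finset.prod_const, Finset.card_univ, Fintype.card_fin]
  have h2 := mgf_centered_le hβ hf hfq hint hle ht
  calc Real.exp (-(τ * s) * (m * s)) * (∫ z, Real.exp (τ * s * g z) ∂ρ) ^ m
      ≤ Real.exp (-(τ * s) * (m * s)) * (Real.exp (mgfConst β c * (τ * s) ^ 2)) ^ m := by
        gcongr
    _ = Real.exp (-(τ * s) * (m * s) + m * (mgfConst β c * (τ * s) ^ 2)) := by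
        rw [← Real.exp_nat_mul, ← Real.exp_add]
    _ ≤ _ := by
        rw [devRate, ← hτ]
        gcongr
        have : 0 ≤ m * s ^ 2 * τ := by positivity
        nlinarith

/-- Two-sided deviation inequality for averages of i.i.d. variables with an exponential moment. -/
theorem measure_abs_avg_sub_ge_le (hβ : 0 < β) (hc : 0 < c) (hf : Measurable f)
    (hfq : ∀ z, |f z| ≤ q z) (hint : Integrable (fun z => Real.exp (β * q z)) ρ)
    (hle : ∫ z, Real.exp (β * q z) ∂ρ ≤ c) (hZ : ∀ i, Measurable (Z i))
    (hlaw : ∀ i, μ.map (Z i) = ρ) (hind : iIndepFun Z μ) (hm : 0 < m) {s : ℝ} (hs : 0 ≤ s)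
    (hs1 : s ≤ 1) :
    μ {ω | s ≤ |(1 / (m : ℝ)) * ∑ i, f (Z i ω) - ∫ z, f z ∂ρ|}
      ≤ ENNReal.ofReal (2 * Real.exp (-(devRate β c * (m * s ^ 2)))) := by
  have h1 := measure_avg_sub_ge_le hβ hc hf hfq hint hle hZ hlaw hind hm hs hs1
  have h2 := measure_avg_sub_ge_le (f := fun z => -f z) hβ hc hf.neg
    (fun z => by rw [abs_neg]; exact hfq z) hint hle hZ hlaw hind hm hs hs1
  have hsub : {ω | s ≤ |(1 / (m : ℝ)) * ∑ i, f (Z i ω) - ∫ z, f z ∂ρ|}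
      ⊆ {ω | s ≤ (1 / (m : ℝ)) * ∑ i, f (Z i ω) - ∫ z, f z ∂ρ} ∪
        {ω | s ≤ (1 / (m : ℝ)) * ∑ i, -f (Z i ω) - ∫ z, -f z ∂ρ} := by
    intro ω hω
    rcases le_abs.1 (mem_ofPred_eq ▸ hω) with h | h
    · exact Or.inl h
    · refine Or.inr ?_
      simp only [mem_ofPred_eq, Finset.sum_neg_distrib, integral_neg]
      linarith
  rw [← ofReal_measureReal]
  refine ENNReal.ofReal_le_ofReal ?_
  refine (measureReal_mono hsub).trans ((measureReal_union_le _ _).trans ?_)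
  linarith

/-- The deviation inequality conditionally on an independent variable. -/
theorem measure_abs_avg_sub_ge_le_of_indep {E₀ : Type*} [MeasurableSpace E₀] {Z₀ : Ω → E₀}
    {F : E₀ → E → ℝ} (hβ : 0 < β) (hc : 0 < c) (hF : Measurable (Function.uncurry F))
    (hFq : ∀ x z, |F x z| ≤ q z) (hint : Integrable (fun z => Real.exp (β * q z)) ρ)
    (hle : ∫ z, Real.exp (β * q z) ∂ρ ≤ c) (hZ : ∀ i, Measurable (Z i))
    (hlaw : ∀ i, μ.map (Z i) = ρ) (hind : iIndepFun Z μ) (hm : 0 < m) (hZ₀ : Measurable Z₀)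
    (hind₀ : IndepFun Z₀ (fun ω i => Z i ω) μ) {s : ℝ} (hs : 0 ≤ s) (hs1 : s ≤ 1) :
    μ {ω | s ≤ |(1 / (m : ℝ)) * ∑ i, F (Z₀ ω) (Z i ω) - ∫ z, F (Z₀ ω) z ∂ρ|}
      ≤ ENNReal.ofReal (2 * Real.exp (-(devRate β c * (m * s ^ 2)))) := by
  have hZm : Measurable (fun ω i => Z i ω) := measurable_pi_lambda _ hZ
  set B : Set (E₀ × (Fin m → E)) :=
    {p | s ≤ |(1 / (m : ℝ)) * ∑ i, F p.1 (p.2 i) - ∫ z, F p.1 z ∂ρ|} with hB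
  have hBm : MeasurableSet B := by
    refine measurableSet_le measurable_const (Measurable.abs (Measurable.sub ?_ ?_))
    · refine (Finset.univ.measurable_sum fun i _ => ?_).const_mul _
      exact hF.comp (measurable_fst.prodMk ((measurable_pi_apply i).comp measurable_snd))
    · exact (hF.stronglyMeasurable.integral_prod_right).measurable.comp measurable_fst
  -- By independence the joint law is a product, so Fubini reduces the claim to a frozen first
  -- variable. The bound on each slice is the same because the majorant `q` does not depend on that
  -- variable.
  have h1 := (indepFun_iff_map_prod_eq_prod_map_map hZ₀.aemeasurable hZm.aemeasurable).1 hind₀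
  have h2 : μ {ω | s ≤ |(1 / (m : ℝ)) * ∑ i, F (Z₀ ω) (Z i ω) - ∫ z, F (Z₀ ω) z ∂ρ|}
      = (μ.map fun ω => (Z₀ ω, fun i => Z i ω)) B := by
    rw [Measure.map_apply (hZ₀.prodMk hZm) hBm]
    rfl
  have := Measure.isProbabilityMeasure_map (μ := μ) hZ₀.aemeasurable
  rw [h2, h1, Measure.prod_apply hBm]
  calc _ ≤ ∫⁻ _x, ENNReal.ofReal (2 * Real.exp (-(devRate β c * (m * s ^ 2)))) ∂(μ.map Z₀) := by
        refine lintegral_mono fun x => ?_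
        rw [Measure.map_apply hZm (measurable_prodMk_left hBm)]
        exact measure_abs_avg_sub_ge_le (f := F x) hβ hc (hF.comp measurable_prodMk_left) (hFq x)
          hint hle hZ hlaw hind hm hs hs1
    _ = _ := by simp

omit [IsProbabilityMeasure μ] in
-- Markov's inequality applied to `exp (β a²)`.
lemma measure_ge_le_of_exp_sq {a : E → ℝ} (ha : Measurable a) (hβ : 0 < β)
    (hint : Integrable (fun z => Real.exp (β * a z ^ 2)) ρ)
    (hle : ∫ z, Real.exp (β * a z ^ 2) ∂ρ ≤ c) {Z : Ω → E} (hZ : Measurable Z)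
    (hlaw : μ.map Z = ρ) {r : ℝ} (hr : 0 ≤ r) :
    μ {ω | r ≤ a (Z ω)} ≤ ENNReal.ofReal (c * Real.exp (-(β * r ^ 2))) := by
  have h1 : μ {ω | r ≤ a (Z ω)} = ρ {z | r ≤ a z} := by
    rw [← hlaw, Measure.map_apply hZ (measurableSet_le measurable_const ha)]
    rfl
  have h2 := mul_meas_ge_le_integral_of_nonneg (μ := ρ)
    (ae_of_all _ fun z => (Real.exp_pos (β * a z ^ 2)).le) hint (Real.exp (β * r ^ 2))
  have h3 : ρ.real {z | r ≤ a z} ≤ ρ.real {z | Real.exp (β * r ^ 2) ≤ Real.exp (β * a z ^ 2)} := by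
    refine measureReal_mono fun z hz => ?_
    have hz : r ≤ a z := hz
    simp only [mem_ofPred_eq]
    gcongr
  rw [h1, ← ofReal_measureReal]
  refine ENNReal.ofReal_le_ofReal ?_
  rw [Real.exp_neg, ← div_eq_mul_inv, le_div_iff₀ (Real.exp_pos _)]
  nlinarith [Real.exp_pos (β * r ^ 2)]

omit [IsProbabilityMeasure μ] in
lemma measure_iUnion_le_card_mul {ι : Type*} [Fintype ι] {s : ι → Set Ω} {p : ℝ}
    (h : ∀ i, μ (s i) ≤ ENNReal.ofReal p) :
    μ (⋃ i, s i) ≤ ENNReal.ofReal (Fintype.card ι * p) := by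
  refine (measure_iUnion_fintype_le μ s).trans ((Finset.sum_le_sum fun i _ => h i).trans_eq ?_)
  rw [Finset.sum_const, Finset.card_univ, nsmul_eq_mul, ENNReal.ofReal_mul (by positivity),
    ENNReal.ofReal_natCast]

end Deviation

/-! ### Weighted averages and the constants of the union bound -/

lemma abs_avg_le_mul {m : ℕ} {f q : Fin m → ℝ} {A B : ℝ} (hB : 0 ≤ B)
    (hf : ∀ i, |f i| ≤ B * q i) (hA : (1 / (m : ℝ)) * ∑ i, q i ≤ A) :
    |(1 / (m : ℝ)) * ∑ i, f i| ≤ B * A := by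
  rw [abs_mul, abs_of_nonneg (by positivity)]
  calc (1 / (m : ℝ)) * |∑ i, f i| ≤ (1 / (m : ℝ)) * ∑ i, B * q i := by
        gcongr
        exact (Finset.abs_sum_le_sum_abs _ _).trans (Finset.sum_le_sum fun i _ => hf i)
    _ = B * ((1 / (m : ℝ)) * ∑ i, q i) := by rw [← Finset.mul_sum]; ring
    _ ≤ B * A := by gcongr

/-- Comparison of averages of two families. -/
lemma abs_avg_sub_avg_le {m : ℕ} {f g q : Fin m → ℝ} {A B : ℝ} (hB : 0 ≤ B)
    (hf : ∀ i, |f i - g i| ≤ B * q i) (hA : (1 / (m : ℝ)) * ∑ i, q i ≤ A) :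
    |(1 / (m : ℝ)) * ∑ i, f i - (1 / (m : ℝ)) * ∑ i, g i| ≤ B * A := by
  rw [← mul_sub, ← Finset.sum_sub_distrib]
  exact abs_avg_le_mul hB hf hA

/-- A tail of rate `m ε²` beats the size of the union bound. -/
lemma exists_tail_const (κ C₀ : ℝ) (hκ : 0 < κ) (hC₀ : 0 ≤ C₀) : ∃ A : ℝ, 0 < A ∧
    ∀ ε δ m : ℝ, 0 < ε → ε ≤ 1 → 0 < δ → δ ≤ 1 →
      A * (ε ^ 2)⁻¹ * Real.log (Real.exp 1 / (ε * δ)) ≤ m →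
      C₀ * (m / ε) * Real.exp (-(κ * (m * ε ^ 2))) ≤ δ / 2 := by
  set B := 4 * C₀ / κ with hB
  have hB0 : 0 ≤ B := by positivity
  -- Half of the exponent, `y = κ m ε² / 2`, is spent on the factor `m` through `y exp(-y) ≤ 1`.
  -- Substituting for `m` and dividing by `ε` leaves `ε⁻³`, so the other half has to supply `ε³ δ`,
  -- hence the `3`. The extra `B` absorbs `C₀` through `B exp(-B) ≤ 1`.
  refine ⟨2 / κ * (3 + B), by positivity, fun ε δ m hε hε1 hδ hδ1 hm => ?_⟩
  set l := Real.log (Real.exp 1 / (ε * δ)) with hl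
  have hl' : Real.exp (-l) = ε * δ / Real.exp 1 := by
    rw [Real.exp_neg, hl, Real.exp_log (by positivity), inv_div]
  have hl1 : 1 ≤ l := by
    rw [hl, Real.le_log_iff_exp_le (by positivity), le_div_iff₀ (by positivity)]
    have : ε * δ ≤ 1 := mul_le_one₀ hε1 hδ.le hδ1
    nlinarith [Real.exp_pos 1]
  set y := κ * (m * ε ^ 2) / 2 with hy
  have hyl : (3 + B) * l ≤ y := by
    rw [hy]
    have : 2 / κ * (3 + B) * l ≤ m * ε ^ 2 := by
      calc 2 / κ * (3 + B) * l = (2 / κ * (3 + B) * (ε ^ 2)⁻¹ * l) * ε ^ 2 := by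
            field_simp
        _ ≤ m * ε ^ 2 := by gcongr
    calc (3 + B) * l = κ * (2 / κ * (3 + B) * l) / 2 := by field_simp
      _ ≤ _ := by gcongr
  have h1 : Real.exp (-y) ≤ ε ^ 3 * δ * Real.exp (-B) := by
    calc Real.exp (-y) ≤ Real.exp (-((3 + B) * l)) := by gcongr
      _ ≤ Real.exp (-l + (-l) + (-l) + -B) := by
          gcongr
          nlinarith
      _ = (ε * δ / Real.exp 1) ^ 3 * Real.exp (-B) := by
          rw [Real.exp_add, Real.exp_add, Real.exp_add, hl']; ring
      _ ≤ (ε ^ 3 * δ) * Real.exp (-B) := by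
          gcongr
          have h3 : ε * δ / Real.exp 1 ≤ ε * δ :=
            div_le_self (by positivity) (Real.one_le_exp (by norm_num))
          calc (ε * δ / Real.exp 1) ^ 3 ≤ (ε * δ) ^ 3 := by gcongr
            _ = ε ^ 3 * δ * (δ * δ) := by ring
            _ ≤ ε ^ 3 * δ * 1 := by
              gcongr
              exact mul_le_one₀ hδ1 hδ.le hδ1
            _ = ε ^ 3 * δ := mul_one _
  have hy2 : Real.exp (-(κ * (m * ε ^ 2))) = Real.exp (-y) * Real.exp (-y) := by
    rw [← Real.exp_add, hy]; ring_nf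
  have hy3 : y * Real.exp (-y) ≤ 1 := by
    rw [Real.exp_neg, ← div_eq_mul_inv, div_le_one (Real.exp_pos _)]
    linarith [Real.add_one_le_exp y]
  have hB1 : B * Real.exp (-B) ≤ 1 := by
    rw [Real.exp_neg, ← div_eq_mul_inv, div_le_one (Real.exp_pos _)]
    linarith [Real.add_one_le_exp B]
  calc C₀ * (m / ε) * Real.exp (-(κ * (m * ε ^ 2)))
      = C₀ * (2 / κ) * (ε ^ 3)⁻¹ * (y * Real.exp (-y)) * Real.exp (-y) := by
        rw [hy2, hy]; field_simp
    _ ≤ C₀ * (2 / κ) * (ε ^ 3)⁻¹ * 1 * (ε ^ 3 * δ * Real.exp (-B)) := by gcongr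
    _ = (B * Real.exp (-B)) * (δ / 2) := by rw [hB]; field_simp; norm_num
    _ ≤ 1 * (δ / 2) := by gcongr
    _ = δ / 2 := one_mul _

lemma one_le_log {m δ : ℝ} (hm : 1 ≤ m) (hδ : 0 < δ) (hδ1 : δ ≤ 1) :
    1 ≤ Real.log (Real.exp 1 * m / δ) := by
  rw [Real.le_log_iff_exp_le (by positivity), le_div_iff₀ hδ]
  have := Real.exp_pos 1
  nlinarith

/-- The tail of the largest of order `m` node sizes. With `l` the logarithm, the threshold is at
least `1`, so its square dominates it and the exponent is at least `l + B`: then `exp(-l)` cancels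
`m` and produces `δ`, while `exp(-B)` cancels `C₀`. -/
lemma exists_max_const (β C₀ : ℝ) (hβ : 0 < β) (hC₀ : 0 ≤ C₀) : ∃ R : ℝ, 0 < R ∧
    ∀ δ m : ℝ, 1 ≤ m → 0 < δ → δ ≤ 1 →
      C₀ * m * Real.exp (-(β * (R * Real.log (Real.exp 1 * m / δ)) ^ 2)) ≤ δ / 2 := by
  set B := 2 * C₀ with hB
  have hB0 : 0 ≤ B := by positivity
  refine ⟨(1 + B) / β + 1, by positivity, fun δ m hm hδ hδ1 => ?_⟩
  set l := Real.log (Real.exp 1 * m / δ) with hl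
  have hl1 : 1 ≤ l := one_le_log hm hδ hδ1
  have hl' : Real.exp (-l) = δ / (Real.exp 1 * m) := by
    rw [Real.exp_neg, hl, Real.exp_log (by positivity), inv_div]
  have h1 : l + B ≤ β * (((1 + B) / β + 1) * l) ^ 2 := by
    have h2 : 1 ≤ ((1 + B) / β + 1) * l :=
      one_le_mul_of_one_le_of_one_le (by
        have : 0 ≤ (1 + B) / β := by positivity
        linarith) hl1
    calc l + B ≤ (1 + B) * l := by nlinarith
      _ = β * ((1 + B) / β * l) := by field_simp
      _ ≤ β * (((1 + B) / β + 1) * l) := by gcongr; linarith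
      _ ≤ β * (((1 + B) / β + 1) * l) ^ 2 := by
          gcongr
          nlinarith
  have hB1 : B * Real.exp (-B) ≤ 1 := by
    rw [Real.exp_neg, ← div_eq_mul_inv, div_le_one (Real.exp_pos _)]
    linarith [Real.add_one_le_exp B]
  have he : (1 : ℝ) ≤ Real.exp 1 := Real.one_le_exp (by norm_num)
  calc C₀ * m * Real.exp (-(β * (((1 + B) / β + 1) * l) ^ 2))
      ≤ C₀ * m * Real.exp (-l + -B) := by gcongr; linarith
    _ = (B * Real.exp (-B)) * (δ / 2) / Real.exp 1 := by
        rw [Real.exp_add, hl', hB]; field_simp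
    _ ≤ (1 * (δ / 2)) / Real.exp 1 := by gcongr
    _ ≤ 1 * (δ / 2) := div_le_self (by positivity) he
    _ = δ / 2 := one_mul _

/-! ### Typical samples of the limit network -/

namespace LimitNet

variable {d N K : ℕ} (M : LimitNet d N K)

/-- Samples `Z k i` of the nodes: independent within each layer and between neighbouring layers. -/
structure IsSample {Ω : Type*} [MeasurableSpace Ω] (β c : ℝ) (μ : Measure Ω) {m : ℕ}
    (Z : ∀ k, Fin m → Ω → M.S k) : Prop where
  meas : ∀ k ≤ K, ∀ i, Measurable (Z k i)
  law : ∀ k ≤ K, ∀ i, μ.map (Z k i) = M.ρ k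
  indep : ∀ k ≤ K, iIndepFun (Z k) μ
  indep_up : ∀ k < K, ∀ j, IndepFun (Z (k + 1) j) (fun ω i => Z k i ω) μ
  indep_down : ∀ k < K, ∀ i, IndepFun (Z k i) (fun ω j => Z (k + 1) j ω) μ
  exp_int : ∀ k ≤ K, Integrable (fun z => Real.exp (β * M.a k z ^ 2)) (M.ρ k)
  exp_le : ∀ k ≤ K, ∫ z, Real.exp (β * M.a k z ^ 2) ∂(M.ρ k) ≤ c

/-- The averages over the sampled nodes are close to their means, at all times. -/
structure IsTypical (C ε T r : ℝ) {m : ℕ} (z : ∀ k, Fin m → M.S k) : Prop where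
  avg_sq : ∀ k ≤ K, (1 / (m : ℝ)) * ∑ i, M.a k (z k i) ^ 2 ≤ C
  max_le : ∀ k ≤ K, ∀ i, M.a k (z k i) ≤ r
  fwd : ∀ t ∈ Icc 0 T, ∀ k < K, ∀ j n,
    |(1 / (m : ℝ)) * ∑ i, M.w k (z k i) (z (k + 1) j) t * M.h (M.x k (z k i) t n)
      - M.x (k + 1) (z (k + 1) j) t n| ≤ C * ε * M.a (k + 1) (z (k + 1) j)
  bwd : ∀ t ∈ Icc 0 T, ∀ k < K, ∀ i n,
    |(1 / (m : ℝ)) * ∑ j, M.w k (z k i) (z (k + 1) j) t * M.D (k + 1) (z (k + 1) j) t n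
      - ∫ z', M.w k (z k i) z' t * M.D (k + 1) z' t n ∂(M.ρ (k + 1))| ≤ C * ε
  out : ∀ t ∈ Icc 0 T, ∀ n,
    |(1 / (m : ℝ)) * ∑ i, M.v (z K i) t * M.h (M.x K (z K i) t n) - M.out t n| ≤ C * ε

variable {M} {c T : ℝ}

lemma abs_three_le {a b c d x y z : ℝ} (h₁ : |a - b| ≤ x) (h₂ : |b - c| ≤ y)
    (h₃ : |c - d| ≤ z) : |a - d| ≤ x + y + z := by
  have := abs_sub_le a b d
  have := abs_sub_le b c d
  linarith

/-- Deviation bounds on the time net `ε ℕ` extend to all times. -/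
lemma IsRegular.isTypical (H : M.IsRegular c T) {ε r : ℝ} {m : ℕ} {z : ∀ k, Fin m → M.S k}
    (hε : 0 < ε)
    (avg_sq : ∀ k ≤ K, (1 / (m : ℝ)) * ∑ i, M.a k (z k i) ^ 2 ≤ c + 1)
    (max_le : ∀ k ≤ K, ∀ i, M.a k (z k i) ≤ r)
    (fwd : ∀ q : ℕ, q * ε ∈ Icc 0 T → ∀ k < K, ∀ j n,
      |(1 / (m : ℝ)) * ∑ i, M.w k (z k i) (z (k + 1) j) (q * ε) * M.h (M.x k (z k i) (q * ε) n)
        - M.x (k + 1) (z (k + 1) j) (q * ε) n| ≤ c * c * ε * M.a (k + 1) (z (k + 1) j))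
    (bwd : ∀ q : ℕ, q * ε ∈ Icc 0 T → ∀ k < K, ∀ i n,
      |(1 / (m : ℝ)) * ∑ j, M.w k (z k i) (z (k + 1) j) (q * ε)
          * M.D (k + 1) (z (k + 1) j) (q * ε) n
        - ∫ z', M.w k (z k i) z' (q * ε) * M.D (k + 1) z' (q * ε) n ∂(M.ρ (k + 1))|
        ≤ c * c * ε)
    (out : ∀ q : ℕ, q * ε ∈ Icc 0 T → ∀ n,
      |(1 / (m : ℝ)) * ∑ i, M.v (z K i) (q * ε) * M.h (M.x K (z K i) (q * ε) n)
        - M.out (q * ε) n| ≤ c * c * ε) :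
    M.IsTypical ((c * c * c + c * c) * (c + 1) + c * c + (c * c * c + c * c) * c + c + 1) ε T r z
    := by
  have hc := H.c_nonneg
  have hc1 := H.one_le
  -- Round `t` down to a multiple of `ε`; rounding down keeps the net point inside `[0, T]`.
  have net : ∀ t ∈ Icc 0 T, ∃ q : ℕ, q * ε ∈ Icc 0 T ∧ |t - q * ε| ≤ ε ∧ |q * ε - t| ≤ ε := by
    intro t ht
    have h1 : ⌊t / ε⌋₊ * ε ≤ t := by
      rw [← le_div_iff₀ hε]; exact Nat.floor_le (div_nonneg ht.1 hε.le)
    have h2 : t < (⌊t / ε⌋₊ + 1) * ε := by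
      rw [← div_lt_iff₀ hε]; exact Nat.lt_floor_add_one _
    refine ⟨⌊t / ε⌋₊, ⟨by positivity, h1.trans ht.2⟩, ?_, ?_⟩ <;>
    · rw [abs_le]; constructor <;> linarith
  -- A common Lipschitz constant in time, relative to the squared sizes, for the products `w h(x)`,
  -- `w D` and `v h(x)`; for the first there is the additional size of the target node. Each
  -- estimate below passes from the average at `t` to the average at the net point, then to the mean
  -- there, then to the mean at `t`.
  set P := c * c * c + c * c with hP
  have hP0 : 0 ≤ P := by positivity
  have hPc : 0 ≤ P * (c + 1) := by positivity
  have hPc' : 0 ≤ P * c := by positivity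
  have hcc : 0 ≤ c * c := by positivity
  have sq1 : ∀ k z, 1 ≤ M.a k z ^ 2 := fun k z => (H.one_le_a k z).trans (H.a_le_sq k z)
  refine ⟨fun k hk => (avg_sq k hk).trans (by linarith), max_le, ?_, ?_, ?_⟩
  · intro t ht k hk j n
    obtain ⟨q, hq, h1, h2⟩ := net t ht
    set s := q * ε
    have ha := H.a_nonneg (k + 1) (z (k + 1) j)
    have ha1 := H.one_le_a (k + 1) (z (k + 1) j)
    have e1 := abs_avg_sub_avg_le (f := fun i => M.w k (z k i) (z (k + 1) j) t *
        M.h (M.x k (z k i) t n)) (g := fun i => M.w k (z k i) (z (k + 1) j) s *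
        M.h (M.x k (z k i) s n)) (q := fun i => M.a k (z k i) ^ 2)
      (B := P * ε * M.a (k + 1) (z (k + 1) j)) (by positivity) (fun i => by
        refine (abs_mul_sub_mul_le (H.w_bound k hk _ _ t ht) (H.h_bound _)
          (H.w_lip k hk _ _ s hq t ht) (H.h_lip _ _)).trans ?_
        have hx := H.x_lip k hk.le (z k i) s hq t ht n
        have hai := H.a_le_sq k (z k i)
        have hai1 := sq1 k (z k i)
        have hai0 := H.a_nonneg k (z k i)
        calc _ ≤ c * M.a (k + 1) (z (k + 1) j) * (c * (c * ε * M.a k (z k i) ^ 2)) +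
              c * ε * c * (M.a (k + 1) (z (k + 1) j) * M.a k (z k i) ^ 2) := by
              refine add_le_add ?_ ?_
              · gcongr
                refine hx.trans ?_
                gcongr
              · exact (by gcongr : c * |t - s| * c ≤ c * ε * c).trans
                  (le_mul_of_one_le_right (by positivity)
                    (one_le_mul_of_one_le_of_one_le ha1 hai1))
          _ = _ := by rw [hP]; ring) (avg_sq k hk.le)
    have e3 := H.x_lip (k + 1) hk (z (k + 1) j) t ht s hq n
    refine (abs_three_le e1 (fwd q hq k hk j n) e3).trans ?_
    have e4 : c * |s - t| * M.a (k + 1) (z (k + 1) j) ≤ c * ε * M.a (k + 1) (z (k + 1) j) := by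
      gcongr
    have e5 : 0 ≤ (P * c + 1) * (ε * M.a (k + 1) (z (k + 1) j)) := by positivity
    linarith
  · intro t ht k hk i n
    obtain ⟨q, hq, h1, h2⟩ := net t ht
    set s := q * ε
    have key : ∀ z' t s, t ∈ Icc 0 T → s ∈ Icc 0 T → |t - s| ≤ ε →
        |M.w k (z k i) z' t * M.D (k + 1) z' t n - M.w k (z k i) z' s * M.D (k + 1) z' s n|
          ≤ P * ε * M.a (k + 1) z' ^ 2 := by
      intro z' t s ht hs h1
      refine (abs_mul_sub_mul_le (H.w_bound k hk _ _ t ht) (H.D_bound (k + 1) hk _ s hs n)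
          (H.w_lip k hk _ _ s hs t ht) (H.D_lip (k + 1) hk _ s hs t ht n)).trans ?_
      have ha := H.a_nonneg (k + 1) z'
      have ha1 := sq1 (k + 1) z'
      calc _ ≤ c * M.a (k + 1) z' * (c * ε * M.a (k + 1) z') * c +
            c * ε * c * M.a (k + 1) z' ^ 2 := by
              refine add_le_add ?_ ?_
              · refine le_trans ?_ (le_mul_of_one_le_right (by positivity) hc1)
                gcongr
              · exact (by gcongr : c * |t - s| * c ≤ c * ε * c).trans
                  (le_mul_of_one_le_right (by positivity) ha1)
        _ = _ := by rw [hP]; ring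
    have e1 := abs_avg_sub_avg_le (f := fun j => M.w k (z k i) (z (k + 1) j) t *
        M.D (k + 1) (z (k + 1) j) t n) (g := fun j => M.w k (z k i) (z (k + 1) j) s *
        M.D (k + 1) (z (k + 1) j) s n) (q := fun j => M.a (k + 1) (z (k + 1) j) ^ 2)
      (B := P * ε) (by positivity) (fun j => key _ t s ht hq h1) (avg_sq (k + 1) hk)
    have e3 : |(∫ z', M.w k (z k i) z' s * M.D (k + 1) z' s n ∂(M.ρ (k + 1)))
        - ∫ z', M.w k (z k i) z' t * M.D (k + 1) z' t n ∂(M.ρ (k + 1))| ≤ P * ε * c := by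
      rw [← integral_sub (H.integrable_w_mul_D hk hq _ n) (H.integrable_w_mul_D hk ht _ n)]
      exact H.abs_integral_le_sq hk (by positivity) fun z' => key z' s t hq ht h2
    refine (abs_three_le e1 (bwd q hq k hk i n) e3).trans ?_
    have e5 : 0 ≤ (c + 1) * ε := by positivity
    linarith
  · intro t ht n
    obtain ⟨q, hq, h1, h2⟩ := net t ht
    set s := q * ε
    have key : ∀ z t s, t ∈ Icc 0 T → s ∈ Icc 0 T → |t - s| ≤ ε →
        |M.v z t * M.h (M.x K z t n) - M.v z s * M.h (M.x K z s n)|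
          ≤ P * ε * M.a K z ^ 2 := by
      intro z' t s ht hs h1
      refine (abs_mul_sub_mul_le (H.v_bound _ t ht) (H.h_bound _)
          (H.v_lip _ s hs t ht) (H.h_lip _ _)).trans ?_
      have hx := H.x_lip K le_rfl z' s hs t ht n
      have ha := H.a_nonneg K z'
      have ha1 := sq1 K z'
      have hai := H.a_le_sq K z'
      calc _ ≤ c * (c * (c * ε * M.a K z' ^ 2)) + c * ε * c * M.a K z' ^ 2 := by
              refine add_le_add ?_ ?_
              · gcongr
                refine hx.trans ?_
                gcongr
              · exact (by gcongr : c * |t - s| * c ≤ c * ε * c).trans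
                  (le_mul_of_one_le_right (by positivity) ha1)
        _ = _ := by rw [hP]; ring
    have e1 := abs_avg_sub_avg_le (f := fun i => M.v (z K i) t * M.h (M.x K (z K i) t n))
      (g := fun i => M.v (z K i) s * M.h (M.x K (z K i) s n))
      (q := fun j => M.a K (z K j) ^ 2)
      (B := P * ε) (by positivity) (fun j => key _ t s ht hq h1) (avg_sq K le_rfl)
    have hint : ∀ t ∈ Icc 0 T, Integrable (fun z => M.v z t * M.h (M.x K z t n)) (M.ρ K) :=
      fun t ht => H.integrable_of_le le_rfl ((H.v_meas t ht).mul (H.h_x_meas le_rfl ht n))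
        fun z => H.abs_v_mul_h_le ht z n
    have e3 : |M.out s n - M.out t n| ≤ P * ε * c := by
      rw [LimitNet.out, LimitNet.out, ← integral_sub (hint s hq) (hint t ht)]
      exact H.abs_integral_le_sq le_rfl (by positivity) fun z' => key z' s t hq ht h2
    refine (abs_three_le e1 (out q hq n) e3).trans ?_
    have e5 : 0 ≤ (c + 1) * ε := by positivity
    linarith

end LimitNet

/-- Undoes the normalization under which the deviation events are formulated. -/
lemma abs_avg_sub_integral_le_of_div {E : Type*} [MeasurableSpace E] {ρ : Measure E} {m : ℕ}
    {g : Fin m → ℝ} {G : E → ℝ} {b ε : ℝ} (hb : 0 < b)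
    (h : |(1 / (m : ℝ)) * ∑ i, g i / b - ∫ z, G z / b ∂ρ| < ε) :
    |(1 / (m : ℝ)) * ∑ i, g i - ∫ z, G z ∂ρ| ≤ b * ε := by
  rw [integral_div, ← Finset.sum_div, ← mul_div_assoc, ← sub_div, abs_div, abs_of_pos hb,
    div_lt_iff₀ hb] at h
  linarith

namespace LimitNet

variable {d N K : ℕ} {M : LimitNet d N K} {c T β : ℝ} {Ω : Type*} [MeasurableSpace Ω]
  {μ : Measure Ω} [IsProbabilityMeasure μ] {m : ℕ} {Z : ∀ k, Fin m → Ω → M.S k}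

section Events

variable (H : M.IsRegular c T) (hβ : 0 < β) (hZ : M.IsSample β c μ Z) (hm : 0 < m)
include H hβ hZ hm

/-- Only a deviation of size `1` is needed. Its probability is weakened to the rate at scale `ε` so
that all deviation events share one tail. -/
lemma measure_avg_sq_dev_le {ε : ℝ} (hε : 0 < ε) (hε1 : ε ≤ 1) {k : ℕ} (hk : k ≤ K) :
    μ {ω | 1 ≤ |(1 / (m : ℝ)) * ∑ i, M.a k (Z k i ω) ^ 2 - ∫ z, M.a k z ^ 2 ∂(M.ρ k)|}
      ≤ ENNReal.ofReal (2 * Real.exp (-(devRate β c * (m * ε ^ 2)))) := by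
  have hc : 0 < c := zero_lt_one.trans_le H.one_le
  have := H.prob k hk
  refine (measure_abs_avg_sub_ge_le (f := fun z => M.a k z ^ 2) (s := 1) hβ hc
    ((H.a_meas k hk).pow_const 2) (q := fun z => M.a k z ^ 2)
    (fun z => (abs_of_nonneg (by positivity)).le) (hZ.exp_int k hk) (hZ.exp_le k hk)
    (hZ.meas k hk) (hZ.law k hk) (hZ.indep k hk) hm zero_le_one le_rfl).trans ?_
  refine ENNReal.ofReal_le_ofReal ?_
  have := devRate_pos hβ hc
  have h2 : ε ^ 2 ≤ 1 ^ 2 := by gcongr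
  gcongr

/-- Conditionally on the target node, the summands are i.i.d. over the lower layer. The weight grows
with the target, so division by `c * c` times its size gives a majorant uniform in that node. -/
lemma measure_fwd_dev_le {ε : ℝ} (hε : 0 < ε) (hε1 : ε ≤ 1) {k : ℕ} (hk : k < K) {t : ℝ}
    (ht : t ∈ Icc 0 T) (j : Fin m) (n : Fin N) :
    μ {ω | ε ≤ |(1 / (m : ℝ)) * ∑ i, M.w k (Z k i ω) (Z (k + 1) j ω) t *
          M.h (M.x k (Z k i ω) t n) / (c * c * M.a (k + 1) (Z (k + 1) j ω))
        - ∫ z, M.w k z (Z (k + 1) j ω) t * M.h (M.x k z t n) /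
          (c * c * M.a (k + 1) (Z (k + 1) j ω)) ∂(M.ρ k)|}
      ≤ ENNReal.ofReal (2 * Real.exp (-(devRate β c * (m * ε ^ 2)))) := by
  have hc : 0 < c := zero_lt_one.trans_le H.one_le
  have := H.prob k hk.le
  refine measure_abs_avg_sub_ge_le_of_indep (Z₀ := Z (k + 1) j) (Z := Z k)
    (F := fun z' z => M.w k z z' t * M.h (M.x k z t n) / (c * c * M.a (k + 1) z'))
    (q := fun z => M.a k z ^ 2) hβ hc ?_ (fun z' z => ?_) (hZ.exp_int k hk.le)
    (hZ.exp_le k hk.le) (hZ.meas k hk.le) (hZ.law k hk.le) (hZ.indep k hk.le) hm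
    (hZ.meas (k + 1) hk j) (hZ.indep_up k hk j) hε.le hε1
  · exact (((H.w_meas k hk t ht).comp measurable_swap).mul
      ((H.h_x_meas hk.le ht n).comp measurable_snd)).div
      (((H.a_meas (k + 1) hk).comp measurable_fst).const_mul _)
  · have ha := H.one_le_a (k + 1) z'
    have hpos : 0 < c * c * M.a (k + 1) z' := by positivity
    rw [abs_div, abs_of_pos hpos, div_le_iff₀ hpos]
    have h1 : 1 ≤ M.a k z ^ 2 := (H.one_le_a k z).trans (H.a_le_sq k z)
    calc _ ≤ c * M.a (k + 1) z' * c := H.abs_w_mul_h_le hk ht z z' n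
      _ = 1 * (c * c * M.a (k + 1) z') := by ring
      _ ≤ _ := by gcongr

/-- Conditionally on the source node, the summands are i.i.d. over the upper layer. The growth is in
the averaged variable, so a constant normalization suffices and `a ≤ a ^ 2` supplies the majorant.
-/
lemma measure_bwd_dev_le {ε : ℝ} (hε : 0 < ε) (hε1 : ε ≤ 1) {k : ℕ} (hk : k < K) {t : ℝ}
    (ht : t ∈ Icc 0 T) (i : Fin m) (n : Fin N) :
    μ {ω | ε ≤ |(1 / (m : ℝ)) * ∑ j, M.w k (Z k i ω) (Z (k + 1) j ω) t *
          M.D (k + 1) (Z (k + 1) j ω) t n / (c * c)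
        - ∫ z', M.w k (Z k i ω) z' t * M.D (k + 1) z' t n / (c * c) ∂(M.ρ (k + 1))|}
      ≤ ENNReal.ofReal (2 * Real.exp (-(devRate β c * (m * ε ^ 2)))) := by
  have hc : 0 < c := zero_lt_one.trans_le H.one_le
  have := H.prob (k + 1) hk
  refine measure_abs_avg_sub_ge_le_of_indep (Z₀ := Z k i) (Z := Z (k + 1))
    (F := fun z z' => M.w k z z' t * M.D (k + 1) z' t n / (c * c))
    (q := fun z => M.a (k + 1) z ^ 2) hβ hc ?_ (fun z z' => ?_) (hZ.exp_int (k + 1) hk)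
    (hZ.exp_le (k + 1) hk) (hZ.meas (k + 1) hk) (hZ.law (k + 1) hk) (hZ.indep (k + 1) hk) hm
    (hZ.meas k hk.le i) (hZ.indep_down k hk i) hε.le hε1
  · exact ((H.w_meas k hk t ht).mul ((H.D_meas hk ht n).comp measurable_snd)).div_const _
  · have hpos : 0 < c * c := by positivity
    rw [abs_div, abs_of_pos hpos, div_le_iff₀ hpos, mul_comm (M.a (k + 1) z' ^ 2)]
    refine (H.abs_w_mul_D_le hk ht z z' n).trans ?_
    have := H.a_le_sq (k + 1) z'
    gcongr

lemma measure_out_dev_le {ε : ℝ} (hε : 0 < ε) (hε1 : ε ≤ 1) {t : ℝ}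
    (ht : t ∈ Icc 0 T) (n : Fin N) :
    μ {ω | ε ≤ |(1 / (m : ℝ)) * ∑ i, M.v (Z K i ω) t * M.h (M.x K (Z K i ω) t n) / (c * c)
        - ∫ z, M.v z t * M.h (M.x K z t n) / (c * c) ∂(M.ρ K)|}
      ≤ ENNReal.ofReal (2 * Real.exp (-(devRate β c * (m * ε ^ 2)))) := by
  have hc : 0 < c := zero_lt_one.trans_le H.one_le
  have := H.prob K le_rfl
  refine measure_abs_avg_sub_ge_le (Z := Z K)
    (f := fun z => M.v z t * M.h (M.x K z t n) / (c * c))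
    (q := fun z => M.a K z ^ 2) hβ hc ?_ (fun z => ?_) (hZ.exp_int K le_rfl)
    (hZ.exp_le K le_rfl) (hZ.meas K le_rfl) (hZ.law K le_rfl) (hZ.indep K le_rfl) hm
    hε.le hε1
  · exact ((H.v_meas t ht).mul (H.h_x_meas le_rfl ht n)).div_const _
  · have hpos : 0 < c * c := by positivity
    rw [abs_div, abs_of_pos hpos, div_le_iff₀ hpos, mul_comm (M.a K z ^ 2)]
    refine (H.abs_v_mul_h_le ht z n).trans ?_
    have := H.a_le_sq K z
    gcongr

end Events

/-- With probability at least `1 - δ` the sampled nodes are typical. -/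
theorem exists_isTypical (d N K : ℕ) (c T β : ℝ) (hc : 1 ≤ c) (hT : 0 ≤ T) (hβ : 0 < β) :
    ∃ A C R : ℝ, 0 < A ∧ 1 ≤ C ∧ 0 < R ∧
      ∀ M : LimitNet d N K, M.IsRegular c T →
      ∀ (Ω : Type*) [MeasurableSpace Ω] (μ : Measure Ω) [IsProbabilityMeasure μ] (m : ℕ)
        (Z : ∀ k, Fin m → Ω → M.S k), M.IsSample β c μ Z →
      ∀ ε δ : ℝ, 0 < ε → ε ≤ 1 → 0 < δ → δ ≤ 1 →
        A * (ε ^ 2)⁻¹ * Real.log (Real.exp 1 / (ε * δ)) ≤ m →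
      ∃ B : Set Ω, μ B ≤ ENNReal.ofReal δ ∧ ∀ ω ∉ B,
        M.IsTypical C ε T (R * Real.log (Real.exp 1 * m / δ)) (fun k i => Z k i ω) := by
  have hc0 : 0 < c := zero_lt_one.trans_le hc
  have hκ := devRate_pos hβ hc0
  -- Counts the deviation events in units of `m / ε`: one per layer for the squared sizes, the
  -- forward and backward events, and those of the output. The factor `2` below comes from the
  -- two-sided tail.
  set C₁ : ℝ := (K + 1) + 2 * ((T + 1) * (K * N)) + (T + 1) * N with hC₁
  obtain ⟨A, hA, hA'⟩ := exists_tail_const (devRate β c) (2 * C₁) hκ (by positivity)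
  obtain ⟨R, hR, hR'⟩ := exists_max_const β ((K + 1) * c) hβ (by positivity)
  refine ⟨A, (c * c * c + c * c) * (c + 1) + c * c + (c * c * c + c * c) * c + c + 1, R, hA,
    ?_, hR, ?_⟩
  · have : 0 ≤ (c * c * c + c * c) * (c + 1) + c * c + (c * c * c + c * c) * c := by positivity
    linarith
  · intro M H Ω _ μ _ m Z hZ ε δ hε hε1 hδ hδ1 hm
    have hm0 : (0 : ℝ) < m := by
      refine lt_of_lt_of_le ?_ hm
      have : 0 < Real.log (Real.exp 1 / (ε * δ)) := by
        have h := one_le_log (m := 1) (δ := ε * δ) le_rfl (by positivity)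
          (mul_le_one₀ hε1 hδ.le hδ1)
        rw [mul_one] at h
        linarith
      positivity
    have hm1 : 0 < m := by exact_mod_cast hm0
    have hm1' : (1 : ℝ) ≤ m := by exact_mod_cast hm1
    set p := 2 * Real.exp (-(devRate β c * (m * ε ^ 2))) with hp
    have hp0 : 0 ≤ p := by positivity
    set r := R * Real.log (Real.exp 1 * m / δ) with hr
    have hr0 : 0 ≤ r := mul_nonneg hR.le (zero_le_one.trans (one_le_log hm1' hδ hδ1))
    -- The number of multiples of `ε` in `[0, T]`, counting `0`.
    set Q := ⌊T / ε⌋₊ + 1 with hQ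
    have hQ' : (Q : ℝ) ≤ (T + 1) / ε := by
      rw [hQ, add_div]
      push_cast
      refine add_le_add (Nat.floor_le (by positivity)) ?_
      rw [le_div_iff₀ hε]
      linarith
    have hq : ∀ q : Fin Q, (q : ℕ) * ε ∈ Icc 0 T := fun q => by
      refine ⟨by positivity, ?_⟩
      rw [← le_div_iff₀ hε]
      exact (Nat.le_floor_iff (by positivity)).1 (Nat.lt_succ_iff.1 q.2)
    set B₁ : Set Ω := ⋃ k : Fin (K + 1), {ω | 1 ≤ |(1 / (m : ℝ)) *
      ∑ i, M.a k (Z k i ω) ^ 2 - ∫ z, M.a k z ^ 2 ∂(M.ρ k)|} with hB₁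
    set B₂ : Set Ω := ⋃ y : Fin (K + 1) × Fin m, {ω | r ≤ M.a y.1 (Z y.1 y.2 ω)} with hB₂
    set B₃ : Set Ω := ⋃ y : Fin Q × Fin K × Fin N × Fin m, {ω | ε ≤ |(1 / (m : ℝ)) *
      ∑ i, M.w y.2.1 (Z y.2.1 i ω) (Z (y.2.1 + 1) y.2.2.2 ω) (y.1 * ε) *
          M.h (M.x y.2.1 (Z y.2.1 i ω) (y.1 * ε) y.2.2.1) /
            (c * c * M.a (y.2.1 + 1) (Z (y.2.1 + 1) y.2.2.2 ω))
        - ∫ z, M.w y.2.1 z (Z (y.2.1 + 1) y.2.2.2 ω) (y.1 * ε) *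
          M.h (M.x y.2.1 z (y.1 * ε) y.2.2.1) /
          (c * c * M.a (y.2.1 + 1) (Z (y.2.1 + 1) y.2.2.2 ω)) ∂(M.ρ y.2.1)|} with hB₃
    set B₄ : Set Ω := ⋃ y : Fin Q × Fin K × Fin N × Fin m, {ω | ε ≤ |(1 / (m : ℝ)) *
      ∑ j, M.w y.2.1 (Z y.2.1 y.2.2.2 ω) (Z (y.2.1 + 1) j ω) (y.1 * ε) *
          M.D (y.2.1 + 1) (Z (y.2.1 + 1) j ω) (y.1 * ε) y.2.2.1 / (c * c)
        - ∫ z', M.w y.2.1 (Z y.2.1 y.2.2.2 ω) z' (y.1 * ε) *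
          M.D (y.2.1 + 1) z' (y.1 * ε) y.2.2.1 / (c * c) ∂(M.ρ (y.2.1 + 1))|} with hB₄
    set B₅ : Set Ω := ⋃ y : Fin Q × Fin N, {ω | ε ≤ |(1 / (m : ℝ)) *
      ∑ i, M.v (Z K i ω) (y.1 * ε) * M.h (M.x K (Z K i ω) (y.1 * ε) y.2) / (c * c)
        - ∫ z, M.v z (y.1 * ε) * M.h (M.x K z (y.1 * ε) y.2) / (c * c) ∂(M.ρ K)|} with hB₅
    have h₁ : μ B₁ ≤ ENNReal.ofReal ((K + 1) * p) := by
      refine (measure_iUnion_le_card_mul fun k : Fin (K + 1) =>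
        measure_avg_sq_dev_le H hβ hZ hm1 hε hε1 (Nat.lt_succ_iff.1 k.2)).trans_eq ?_
      simp [hp]
    have h₂ : μ B₂ ≤ ENNReal.ofReal (((K + 1) * m) * (c * Real.exp (-(β * r ^ 2)))) := by
      refine (measure_iUnion_le_card_mul (p := c * Real.exp (-(β * r ^ 2)))
        fun y : Fin (K + 1) × Fin m => ?_).trans_eq (by simp)
      have hy : (y.1 : ℕ) ≤ K := Nat.lt_succ_iff.1 y.1.2
      have := H.prob y.1 hy
      exact measure_ge_le_of_exp_sq (H.a_meas y.1 hy) hβ (hZ.exp_int y.1 hy)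
        (hZ.exp_le y.1 hy) (hZ.meas y.1 hy y.2) (hZ.law y.1 hy y.2) hr0
    have h₃ : μ B₃ ≤ ENNReal.ofReal ((Q * (K * (N * m))) * p) := by
      refine (measure_iUnion_le_card_mul fun y : Fin Q × Fin K × Fin N × Fin m =>
        measure_fwd_dev_le H hβ hZ hm1 hε hε1 y.2.1.2 (hq y.1) y.2.2.2 y.2.2.1).trans_eq ?_
      simp [hp]
    have h₄ : μ B₄ ≤ ENNReal.ofReal ((Q * (K * (N * m))) * p) := by
      refine (measure_iUnion_le_card_mul fun y : Fin Q × Fin K × Fin N × Fin m =>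
        measure_bwd_dev_le H hβ hZ hm1 hε hε1 y.2.1.2 (hq y.1) y.2.2.2 y.2.2.1).trans_eq ?_
      simp [hp]
    have h₅ : μ B₅ ≤ ENNReal.ofReal ((Q * N) * p) := by
      refine (measure_iUnion_le_card_mul fun y : Fin Q × Fin N =>
        measure_out_dev_le H hβ hZ hm1 hε hε1 (hq y.1) y.2).trans_eq ?_
      simp [hp]
    refine ⟨B₁ ∪ B₂ ∪ B₃ ∪ B₄ ∪ B₅, ?_, ?_⟩
    -- The budget `δ` is split in two: one half for all the deviation events, the other for the
    -- largest node size.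
    · have e1 : 1 ≤ m / ε := by rw [le_div_iff₀ hε]; linarith
      have e2 : (Q : ℝ) ≤ (T + 1) * (m / ε) := by
        refine hQ'.trans ?_
        rw [mul_div_assoc']
        gcongr
        exact le_mul_of_one_le_right (by positivity) hm1'
      have e3 : (Q : ℝ) * m ≤ (T + 1) * (m / ε) := by
        calc (Q : ℝ) * m ≤ (T + 1) / ε * m := by gcongr
          _ = (T + 1) * (m / ε) := by ring
      have t1 := hA' ε δ m hε hε1 hδ hδ1 hm
      have t2 := hR' δ m hm1' hδ hδ1
      rw [← hr] at t2
      have u1 : (K + 1) * p ≤ (K + 1) * (m / ε) * p := by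
        gcongr
        exact le_mul_of_one_le_right (by positivity) e1
      have u3 : (Q * (K * (N * m))) * p ≤ (T + 1) * (K * N) * (m / ε) * p := by
        calc (Q * (K * (N * m))) * p = (K * N) * (Q * m) * p := by ring
          _ ≤ (K * N) * ((T + 1) * (m / ε)) * p := by gcongr
          _ = _ := by ring
      have u5 : (Q * N) * p ≤ (T + 1) * N * (m / ε) * p := by
        calc (Q * N) * p ≤ ((T + 1) * (m / ε) * N) * p := by gcongr
          _ = _ := by ring
      refine (measure_union_le _ _).trans ((add_le_add (measure_union_le _ _) h₅).trans ?_)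
      refine (add_le_add (add_le_add (measure_union_le _ _) h₄) le_rfl).trans ?_
      refine (add_le_add (add_le_add (add_le_add (measure_union_le _ _) h₃) le_rfl)
        le_rfl).trans ?_
      refine (add_le_add (add_le_add (add_le_add (add_le_add h₁ h₂) le_rfl) le_rfl)
        le_rfl).trans ?_
      rw [← ENNReal.ofReal_add (by positivity) (by positivity),
        ← ENNReal.ofReal_add (by positivity) (by positivity),
        ← ENNReal.ofReal_add (by positivity) (by positivity),
        ← ENNReal.ofReal_add (by positivity) (by positivity)]
      refine ENNReal.ofReal_le_ofReal ?_
      have t1' : (K + 1) * (m / ε) * p + (T + 1) * (K * N) * (m / ε) * p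
          + (T + 1) * (K * N) * (m / ε) * p + (T + 1) * N * (m / ε) * p ≤ δ / 2 := by
        refine le_trans (le_of_eq ?_) t1
        rw [hp, hC₁]; ring
      have t2' : ((K + 1) * m) * (c * Real.exp (-(β * r ^ 2))) ≤ δ / 2 := by
        refine le_trans (le_of_eq ?_) t2
        ring
      linarith
    · intro ω hω
      simp only [mem_union, not_or, hB₁, hB₂, hB₃, hB₄, hB₅, mem_iUnion, not_exists,
        mem_ofPred_eq, not_le] at hω
      obtain ⟨⟨⟨⟨w1, w2⟩, w3⟩, w4⟩, w5⟩ := hω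
      have hqQ : ∀ q : ℕ, (q : ℝ) * ε ∈ Icc 0 T → q < Q := fun q hq => by
        rw [hQ, Nat.lt_succ_iff, Nat.le_floor_iff (by positivity), le_div_iff₀ hε]
        exact hq.2
      refine H.isTypical hε ?_ ?_ ?_ ?_ ?_
      · intro k hk
        have := (abs_lt.1 (w1 ⟨k, by omega⟩)).2
        have := H.a2_le k hk
        dsimp only at *
        linarith
      · exact fun k hk i => (w2 (⟨k, by omega⟩, i)).le
      · intro q hq k hk j n
        have := w3 (⟨q, hqQ q hq⟩, ⟨k, hk⟩, n, j)
        dsimp only at this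
        have ha := H.one_le_a (k + 1) (Z (k + 1) j ω)
        -- The events are centred at the integral; persistence of forward propagation identifies it
        -- with the feature of the target node at this time.
        rw [H.fwd _ hq k hk]
        exact (abs_avg_sub_integral_le_of_div (by positivity) this).trans_eq (by ring)
      · intro q hq k hk i n
        have := w4 (⟨q, hqQ q hq⟩, ⟨k, hk⟩, n, i)
        exact abs_avg_sub_integral_le_of_div (by positivity) this
      · intro q hq n
        have := w5 (⟨q, hqQ q hq⟩, n)
        exact abs_avg_sub_integral_le_of_div (by positivity) this

end LimitNet

/-! ### Backpropagation in the discrete network -/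

section Gradient

variable {d N m : ℕ} {Y : Type*} (P : Problem d N Y) (K : ℕ) (W : Weights d m)

/-- The derivative of the loss at the output of the discrete network. -/
def discDOut (n : Fin N) : ℝ := deriv (fun z => P.φ z (P.y n)) (output P (K + 1) W n)

/-- Backward propagation in the discrete network with `K + 1` hidden layers, counted from the
top. -/
def discBack : ℕ → Fin m → Fin N → ℝ
  | 0 => fun i n => W.wOut i * discDOut P K W n * deriv P.h (feature P W (K + 1) i n)
  | r + 1 => fun i n => ((1 / (m : ℝ)) * ∑ j, W.w (K - r + 1) i j * discBack r j n)
      * deriv P.h (feature P W (K - r) i n)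

/-- Backward features of hidden layer `k`, for `0 ≤ k ≤ K`. -/
def discD (k : ℕ) : Fin m → Fin N → ℝ := discBack P K W (K - k)

lemma discD_top (i : Fin m) (n : Fin N) :
    discD P K W K i n = W.wOut i * discDOut P K W n * deriv P.h (feature P W (K + 1) i n) := by
  simp [discD, discBack]

/-- The index shift to keep in mind: hidden layer `k` here is layer `k + 1` of the network, so the
weights from hidden layer `k` to the next are `W.w (k + 2)`. -/
lemma discD_succ {k : ℕ} (hk : k < K) (i : Fin m) (n : Fin N) :
    discD P K W k i n = ((1 / (m : ℝ)) * ∑ j, W.w (k + 2) i j * discD P K W (k + 1) j n)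
      * deriv P.h (feature P W (k + 1) i n) := by
  have h1 : K - k = (K - (k + 1)) + 1 := by omega
  have h2 : K - (K - (k + 1)) = k + 1 := by omega
  rw [discD, h1, discBack, h2]
  rfl

/-- Derivative of the features in the direction `V`. -/
def featureDot (V : Weights d m) : ℕ → Fin m → Fin N → ℝ
  | 0 => fun _ _ => 0
  | 1 => fun j n => (1 / (d : ℝ)) * ∑ i, V.w₁ i j * P.X n i
  | k + 2 => fun j n => (1 / (m : ℝ)) * ∑ i, (V.w (k + 2) i j * P.h (feature P W (k + 1) i n)
      + W.w (k + 2) i j * (deriv P.h (feature P W (k + 1) i n) * featureDot V (k + 1) i n))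

/-- Derivative of the output in the direction `V`. -/
def outputDot (V : Weights d m) (n : Fin N) : ℝ :=
  (1 / (m : ℝ)) * ∑ i, (V.wOut i * P.h (feature P W (K + 1) i n)
    + W.wOut i * (deriv P.h (feature P W (K + 1) i n) * featureDot P W V (K + 1) i n))

/-- A curve of weights has derivative `V` at the point `W`. -/
structure HasWeightDeriv (γ : ℝ → Weights d m) (V : Weights d m) (s : ℝ) : Prop where
  eq : γ s = W
  w₁ : ∀ i j, HasDerivAt (fun r => (γ r).w₁ i j) (V.w₁ i j) s
  w : ∀ ℓ i j, HasDerivAt (fun r => (γ r).w ℓ i j) (V.w ℓ i j) s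
  wOut : ∀ i, HasDerivAt (fun r => (γ r).wOut i) (V.wOut i) s

variable {P W} {γ : ℝ → Weights d m} {V : Weights d m} {s : ℝ}

lemma HasWeightDeriv.feature (hγ : HasWeightDeriv W γ V s) (hh : Differentiable ℝ P.h) (k : ℕ)
    (j : Fin m) (n : Fin N) :
    HasDerivAt (fun r => DeepMeanField.feature P (γ r) k j n) (featureDot P W V k j n) s := by
  induction k using Nat.twoStepInduction generalizing j n with
  | zero => simpa [DeepMeanField.feature, featureDot] using hasDerivAt_const s (0 : ℝ)
  | one =>
    exact (HasDerivAt.fun_sum fun i _ => (hγ.w₁ i j).mul_const _).const_mul _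
  | more k _ ih =>
    refine (HasDerivAt.fun_sum fun i _ => ?_).const_mul _
    have h1 := (hh (DeepMeanField.feature P (γ s) (k + 1) i n)).hasDerivAt.comp s (ih i n)
    have h2 := (hγ.w (k + 2) i j).mul h1
    simp only [hγ.eq, Function.comp_apply] at h2
    exact h2

lemma HasWeightDeriv.output (hγ : HasWeightDeriv W γ V s) (hh : Differentiable ℝ P.h)
    (n : Fin N) :
    HasDerivAt (fun r => DeepMeanField.output P (K + 1) (γ r) n) (outputDot P K W V n) s := by
  refine (HasDerivAt.fun_sum fun i _ => ?_).const_mul _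
  have h1 := (hh (DeepMeanField.feature P (γ s) (K + 1) i n)).hasDerivAt.comp s
    (hγ.feature hh (K + 1) i n)
  have h2 := (hγ.wOut i).mul h1
  simp only [hγ.eq, Function.comp_apply] at h2
  exact h2

lemma HasWeightDeriv.deriv_loss (hγ : HasWeightDeriv W γ V s) (hh : Differentiable ℝ P.h)
    (hφ : ∀ y, Differentiable ℝ (fun x => P.φ x y)) :
    deriv (fun r => discreteLoss P (K + 1) (γ r)) s
      = (1 / (N : ℝ)) * ∑ n, discDOut P K W n * outputDot P K W V n := by
  refine HasDerivAt.deriv ((HasDerivAt.fun_sum fun n _ => ?_).const_mul _)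
  have h1 := (hφ (P.y n) (DeepMeanField.output P (K + 1) (γ s) n)).hasDerivAt.comp s
    (hγ.output K hh n)
  rw [hγ.eq] at h1
  exact h1

/-- Backward propagation is the adjoint of linearized forward propagation: exchanging the two sums
moves `W` from the perturbed features onto the backward features, and what is left over is the
direct contribution of `V` in this layer. -/
lemma avg_discD_mul_featureDot_succ {k : ℕ} (hk : k < K) (n : Fin N) :
    (1 / (m : ℝ)) * ∑ j, discD P K W (k + 1) j n * featureDot P W V (k + 2) j n
      = (1 / (m : ℝ)) * ∑ j, discD P K W (k + 1) j n *
          ((1 / (m : ℝ)) * ∑ i, V.w (k + 2) i j * P.h (feature P W (k + 1) i n))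
        + (1 / (m : ℝ)) * ∑ i, discD P K W k i n * featureDot P W V (k + 1) i n := by
  have h1 : ∑ i, discD P K W k i n * featureDot P W V (k + 1) i n
      = ∑ j, discD P K W (k + 1) j n * ((1 / (m : ℝ)) * ∑ i, W.w (k + 2) i j *
        (deriv P.h (feature P W (k + 1) i n) * featureDot P W V (k + 1) i n)) := by
    simp_rw [discD_succ P K W hk, Finset.mul_sum, Finset.sum_mul]
    rw [Finset.sum_comm]
    refine Finset.sum_congr rfl fun j _ => Finset.sum_congr rfl fun i _ => ?_
    ring
  rw [h1, ← mul_add, ← Finset.sum_add_distrib]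
  congr 1
  refine Finset.sum_congr rfl fun j _ => ?_
  simp only [featureDot, Finset.sum_add_distrib]
  ring

lemma avg_discD_mul_featureDot {k : ℕ} (hk : k ≤ K) (n : Fin N) :
    (1 / (m : ℝ)) * ∑ j, discD P K W k j n * featureDot P W V (k + 1) j n
      = (1 / (m : ℝ)) * ∑ j, discD P K W 0 j n * ((1 / (d : ℝ)) * ∑ i, V.w₁ i j * P.X n i)
        + ∑ l ∈ Finset.range k, (1 / (m : ℝ)) * ∑ j, discD P K W (l + 1) j n *
          ((1 / (m : ℝ)) * ∑ i, V.w (l + 2) i j * P.h (feature P W (l + 1) i n)) := by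
  induction k with
  | zero => simp [featureDot]
  | succ k ih =>
    rw [avg_discD_mul_featureDot_succ K hk, ih (by omega), Finset.sum_range_succ]
    ring

/-- The derivative of the output expressed through backward propagation. -/
lemma discDOut_mul_outputDot (n : Fin N) :
    discDOut P K W n * outputDot P K W V n
      = (1 / (m : ℝ)) * ∑ i, V.wOut i * (discDOut P K W n * P.h (feature P W (K + 1) i n))
        + ((1 / (m : ℝ)) * ∑ j, discD P K W 0 j n * ((1 / (d : ℝ)) * ∑ i, V.w₁ i j * P.X n i)
        + ∑ l ∈ Finset.range K, (1 / (m : ℝ)) * ∑ j, discD P K W (l + 1) j n *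
          ((1 / (m : ℝ)) * ∑ i, V.w (l + 2) i j * P.h (feature P W (l + 1) i n))) := by
  rw [← avg_discD_mul_featureDot K le_rfl, outputDot, ← mul_add, ← Finset.sum_add_distrib,
    mul_left_comm, Finset.mul_sum]
  congr 1
  refine Finset.sum_congr rfl fun i _ => ?_
  rw [discD_top]
  ring

variable (W) in
lemma hasWeightDeriv_setOut (i : Fin m) :
    HasWeightDeriv W (W.setOut i) ⟨0, 0, Pi.single i 1⟩ (W.wOut i) where
  eq := by simp [Weights.setOut]
  w₁ _ _ := hasDerivAt_const _ _
  w _ _ _ := hasDerivAt_const _ _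
  wOut i' := hasDerivAt_pi.1 (hasDerivAt_update W.wOut i (W.wOut i)) i'

variable (W) in
lemma hasWeightDeriv_setFirst (i : Fin d) (j : Fin m) :
    HasWeightDeriv W (W.setFirst i j) ⟨Pi.single i (Pi.single j 1), 0, 0⟩ (W.w₁ i j) where
  eq := by simp [Weights.setFirst]
  w₁ i' j' := by
    by_cases hi : i' = i
    · subst hi
      simpa [Weights.setFirst] using
        hasDerivAt_pi.1 (hasDerivAt_update (W.w₁ i') j (W.w₁ i' j)) j'
    · simpa [Weights.setFirst, hi] using hasDerivAt_const _ _
  w _ _ _ := hasDerivAt_const _ _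
  wOut _ := hasDerivAt_const _ _

variable (W) in
lemma hasWeightDeriv_setMid (l : ℕ) (i j : Fin m) :
    HasWeightDeriv W (W.setMid l i j) ⟨0, Pi.single l (Pi.single i (Pi.single j 1)), 0⟩
      (W.w l i j) where
  eq := by simp [Weights.setMid]
  w₁ _ _ := hasDerivAt_const _ _
  w l' i' j' := by
    by_cases hl : l' = l
    · subst hl
      by_cases hi : i' = i
      · subst hi
        simpa [Weights.setMid] using
          hasDerivAt_pi.1 (hasDerivAt_update (W.w l' i') j (W.w l' i' j)) j'
      · simpa [Weights.setMid, hi] using hasDerivAt_const _ _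
    · simpa [Weights.setMid, hl] using hasDerivAt_const _ _
  wOut _ := hasDerivAt_const _ _

variable (W) in
-- A single-coordinate direction picks one term out of the average; the remaining `1 / m` is exactly
-- what the scaling of the step cancels. The other two layer types work alike, with `d m` and `m²`.
lemma gdStep_wOut (hh : Differentiable ℝ P.h) (hφ : ∀ y, Differentiable ℝ (fun x => P.φ x y))
    (hm : 0 < m) (η : ℝ) (i : Fin m) :
    (gdStep P (K + 1) η W).wOut i = W.wOut i
      - η * ((1 / (N : ℝ)) * ∑ n, discDOut P K W n * P.h (feature P W (K + 1) i n)) := by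
  have hm' : (m : ℝ) ≠ 0 := by positivity
  simp only [gdStep]
  rw [(hasWeightDeriv_setOut W i).deriv_loss K hh hφ]
  simp_rw [discDOut_mul_outputDot]
  simp [Pi.single_apply, ← Finset.mul_sum]
  field_simp

variable (W) in
lemma gdStep_w₁ (hh : Differentiable ℝ P.h) (hφ : ∀ y, Differentiable ℝ (fun x => P.φ x y))
    (hd : 0 < d) (hm : 0 < m) (η : ℝ) (i : Fin d) (j : Fin m) :
    (gdStep P (K + 1) η W).w₁ i j = W.w₁ i j
      - η * ((1 / (N : ℝ)) * ∑ n, P.X n i * discD P K W 0 j n) := by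
  have hm' : (m : ℝ) ≠ 0 := by positivity
  have hd' : (d : ℝ) ≠ 0 := by positivity
  simp only [gdStep]
  rw [(hasWeightDeriv_setFirst W i j).deriv_loss K hh hφ]
  have key : ∀ n, discDOut P K W n * outputDot P K W
      ⟨Pi.single i (Pi.single j 1), 0, 0⟩ n
      = (1 / (m : ℝ)) * (1 / (d : ℝ)) * (P.X n i * discD P K W 0 j n) := fun n => by
    rw [discDOut_mul_outputDot]
    have h1 : ∀ j', ∑ i', (Pi.single i (Pi.single j 1) : Fin d → Fin m → ℝ) i' j' * P.X n i'
        = if j' = j then P.X n i else 0 := fun j' => by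
      rw [Finset.sum_eq_single i]
      · simp [Pi.single_apply]
      · intro b _ hb
        simp [hb]
      · simp
    simp_rw [h1]
    simp
    ring
  simp_rw [key, ← Finset.mul_sum]
  field_simp

variable (W) in
lemma gdStep_w (hh : Differentiable ℝ P.h) (hφ : ∀ y, Differentiable ℝ (fun x => P.φ x y))
    (hm : 0 < m) (η : ℝ) {k : ℕ} (hk : k < K) (i j : Fin m) :
    (gdStep P (K + 1) η W).w (k + 2) i j = W.w (k + 2) i j
      - η * ((1 / (N : ℝ)) * ∑ n, discD P K W (k + 1) j n * P.h (feature P W (k + 1) i n)) := by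
  have hm' : (m : ℝ) ≠ 0 := by positivity
  simp only [gdStep]
  rw [(hasWeightDeriv_setMid W (k + 2) i j).deriv_loss K hh hφ]
  have key : ∀ n, discDOut P K W n * outputDot P K W
      ⟨0, Pi.single (k + 2) (Pi.single i (Pi.single j 1)), 0⟩ n
      = (1 / (m : ℝ)) * (1 / (m : ℝ)) *
        (discD P K W (k + 1) j n * P.h (feature P W (k + 1) i n)) := fun n => by
    -- The direction lives in one layer only, so of the layerwise contributions just this one
    -- survives.
    rw [discDOut_mul_outputDot, Finset.sum_eq_single k]
    · have h1 : ∀ j', ∑ i', (Pi.single i (Pi.single j 1) : Fin m → Fin m → ℝ) i' j' *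
          P.h (feature P W (k + 1) i' n)
          = if j' = j then P.h (feature P W (k + 1) i n) else 0 := fun j' => by
        rw [Finset.sum_eq_single i]
        · simp [Pi.single_apply]
        · intro b _ hb
          simp [hb]
        · simp
      simp only [Pi.single_eq_same, h1]
      simp
      ring
    · intro l _ hl
      have h0 : (Pi.single (k + 2) (Pi.single i (Pi.single j 1)) : ℕ → Fin m → Fin m → ℝ)
          (l + 2) = 0 := Pi.single_eq_of_ne (by omega) _
      simp only [h0]
      simp
    · intro h
      exact absurd (Finset.mem_range.2 hk) h
  simp_rw [key, ← Finset.mul_sum]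
  field_simp

end Gradient

/-! ### Stability of forward and backward propagation -/

/-- A snapshot of the ideal discrete network: node weights `a`, first-layer weights `u`, features
`x`, connecting weights `w`, output weights `v`, backward features `D` and mean-field output. -/
structure IdealNet (d N m : ℕ) where
  a : ℕ → Fin m → ℝ
  u : Fin m → Fin d → ℝ
  x : ℕ → Fin m → Fin N → ℝ
  w : ℕ → Fin m → Fin m → ℝ
  v : Fin m → ℝ
  D : ℕ → Fin m → Fin N → ℝ
  out : Fin N → ℝ

namespace IdealNet

variable {d N m : ℕ} {Y : Type*}

/-- The derivatives of the losses at the output of the ideal network. -/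
def dOut (I : IdealNet d N m) (P : Problem d N Y) (n : Fin N) : ℝ :=
  deriv (fun z => P.φ z (P.y n)) (I.out n)

/-- The ideal network satisfies forward and backward propagation up to an error `e`, with bounds
`c`. -/
structure IsConsistent (I : IdealNet d N m) (P : Problem d N Y) (K : ℕ) (c e : ℝ) : Prop where
  activation : ActivationAssumption P.h c c c
  loss : LossAssumption P.φ c c
  X_bound : ∀ n i, |P.X n i| ≤ c
  one_le : 1 ≤ c
  e_nonneg : 0 ≤ e
  one_le_a : ∀ k i, 1 ≤ I.a k i
  avg_sq : ∀ k ≤ K, (1 / (m : ℝ)) * ∑ i, I.a k i ^ 2 ≤ c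
  x_zero : ∀ i n, I.x 0 i n = (1 / (d : ℝ)) * ∑ l, P.X n l * I.u i l
  fwd : ∀ k < K, ∀ j n, |(1 / (m : ℝ)) * ∑ i, I.w k i j * P.h (I.x k i n) - I.x (k + 1) j n|
    ≤ e * I.a (k + 1) j
  out_le : ∀ n, |(1 / (m : ℝ)) * ∑ i, I.v i * P.h (I.x K i n) - I.out n| ≤ e
  D_top : ∀ i n, I.D K i n = I.v i * I.dOut P n * deriv P.h (I.x K i n)
  bwd : ∀ k < K, ∀ i n, |I.D k i n - ((1 / (m : ℝ)) * ∑ j, I.w k i j * I.D (k + 1) j n)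
    * deriv P.h (I.x k i n)| ≤ e * I.a k i
  w_bound : ∀ k < K, ∀ i j, |I.w k i j| ≤ c * I.a (k + 1) j
  v_bound : ∀ i, |I.v i| ≤ c
  D_bound : ∀ k ≤ K, ∀ i n, |I.D k i n| ≤ c

/-- The weights of a discrete network are within `E` of those of the ideal network, relative to the
node weights. -/
structure IsClose (I : IdealNet d N m) (K : ℕ) (W : Weights d m) (E : ℝ) : Prop where
  nonneg : 0 ≤ E
  w₁ : ∀ l i, |I.u i l - W.w₁ l i| ≤ E * I.a 0 i
  w : ∀ k < K, ∀ i j, |I.w k i j - W.w (k + 2) i j| ≤ E * (I.a k i * I.a (k + 1) j)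
  wOut : ∀ i, |I.v i - W.wOut i| ≤ E * I.a K i

variable {I : IdealNet d N m} {P : Problem d N Y} {K : ℕ} {W : Weights d m} {c e E : ℝ}

namespace IsConsistent

variable (H : I.IsConsistent P K c e)
include H

lemma c_nonneg : 0 ≤ c := zero_le_one.trans H.one_le

lemma a_nonneg (k : ℕ) (i : Fin m) : 0 ≤ I.a k i := zero_le_one.trans (H.one_le_a k i)

lemma a_le_sq (k : ℕ) (i : Fin m) : I.a k i ≤ I.a k i ^ 2 := by nlinarith [H.one_le_a k i]

lemma h_lip (y y' : ℝ) : |P.h y - P.h y'| ≤ c * |y - y'| := by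
  have := Convex.norm_image_sub_le_of_norm_deriv_le (𝕜 := ℝ) (f := P.h) (s := Set.univ) (C := c)
    (fun x _ => H.activation.differentiable x) (fun x _ => H.activation.deriv_bound x)
    convex_univ (Set.mem_univ y') (Set.mem_univ y)
  simpa using this

lemma abs_dOut_le (n : Fin N) : |I.dOut P n| ≤ c := H.loss.deriv_bound _ _

lemma abs_discDOut_le (n : Fin N) : |discDOut P K W n| ≤ c := H.loss.deriv_bound _ _

lemma feature_zero (hW : I.IsClose K W E) (i : Fin m) (n : Fin N) :
    |I.x 0 i n - feature P W 1 i n| ≤ c * (E + e) * I.a 0 i := by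
  have hc := H.c_nonneg
  have ha := H.a_nonneg 0 i
  have he := H.e_nonneg
  have hE := hW.nonneg
  rw [H.x_zero, feature, ← mul_sub, ← Finset.sum_sub_distrib]
  refine abs_avg_le (by positivity) fun l => ?_
  rw [mul_comm (W.w₁ l i), ← mul_sub, abs_mul, mul_assoc]
  have := H.X_bound n l
  have := hW.w₁ l i
  gcongr
  exact this.trans (by gcongr; linarith)

/-- Each summand of the difference is of order `a_i² a_j`: one size of the source comes from the
weight error or the inherited feature error, and the size of the target factors out. Averaging over
`i` uses only the bounded mean of `a_i²`, so the error is again proportional to the size of the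
node. -/
lemma feature_succ (hW : I.IsClose K W E) {k : ℕ} (hk : k < K) {C : ℝ} (hC : 0 ≤ C)
    (ih : ∀ i n, |I.x k i n - feature P W (k + 1) i n| ≤ C * (E + e) * I.a k i) (j : Fin m)
    (n : Fin N) : |I.x (k + 1) j n - feature P W (k + 2) j n|
      ≤ (((c * (c * C) + c) * c) + 1) * (E + e) * I.a (k + 1) j := by
  have hc := H.c_nonneg
  have hj := H.a_nonneg (k + 1) j
  have he := H.e_nonneg
  have hE := hW.nonneg
  have h1 := abs_avg_sub_avg_le (f := fun i => I.w k i j * P.h (I.x k i n))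
    (g := fun i => W.w (k + 2) i j * P.h (feature P W (k + 1) i n))
    (q := fun i => I.a k i ^ 2) (B := (c * (c * C) + c) * (E + e) * I.a (k + 1) j)
    (by positivity) (fun i => by
      refine (abs_mul_sub_mul_le (H.w_bound k hk i j) (H.activation.bound _)
        (hW.w k hk i j) ((H.h_lip _ _).trans (mul_le_mul_of_nonneg_left (ih i n) hc))).trans ?_
      have hi := H.a_le_sq k i
      have hi0 := H.a_nonneg k i
      calc _ ≤ c * I.a (k + 1) j * (c * (C * (E + e) * I.a k i ^ 2)) +
            (E + e) * (I.a k i ^ 2 * I.a (k + 1) j) * c := by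
            refine add_le_add ?_ ?_
            · gcongr
            · gcongr
              linarith
        _ = _ := by ring) (H.avg_sq k hk.le)
  have h2 := H.fwd k hk j n
  rw [feature]
  have h3 := abs_sub_le (I.x (k + 1) j n) ((1 / (m : ℝ)) * ∑ i, I.w k i j * P.h (I.x k i n))
    ((1 / (m : ℝ)) * ∑ i, W.w (k + 2) i j * P.h (feature P W (k + 1) i n))
  rw [abs_sub_comm] at h2
  have h4 : 0 ≤ E * I.a (k + 1) j := by positivity
  refine h3.trans ((add_le_add h2 h1).trans ?_)
  linarith

lemma out_close (hW : I.IsClose K W E) {C : ℝ} (hC : 0 ≤ C)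
    (hx : ∀ i n, |I.x K i n - feature P W (K + 1) i n| ≤ C * (E + e) * I.a K i) (n : Fin N) :
    |I.out n - output P (K + 1) W n| ≤ (((c * (c * C) + c) * c) + 1) * (E + e) := by
  have hc := H.c_nonneg
  have he := H.e_nonneg
  have hE := hW.nonneg
  have h1 := abs_avg_sub_avg_le (f := fun i => I.v i * P.h (I.x K i n))
    (g := fun i => W.wOut i * P.h (feature P W (K + 1) i n))
    (q := fun i => I.a K i ^ 2) (B := (c * (c * C) + c) * (E + e))
    (by positivity) (fun i => by
      refine (abs_mul_sub_mul_le (H.v_bound i) (H.activation.bound _)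
        (hW.wOut i) ((H.h_lip _ _).trans (mul_le_mul_of_nonneg_left (hx i n) hc))).trans ?_
      have hi := H.a_le_sq K i
      have hi0 := H.a_nonneg K i
      calc _ ≤ c * (c * (C * (E + e) * I.a K i ^ 2)) + (E + e) * I.a K i ^ 2 * c := by
            refine add_le_add ?_ ?_
            · gcongr
            · gcongr
              linarith
        _ = _ := by ring) (H.avg_sq K le_rfl)
  have h2 := H.out_le n
  rw [output]
  have h3 := abs_sub_le (I.out n) ((1 / (m : ℝ)) * ∑ i, I.v i * P.h (I.x K i n))
    ((1 / (m : ℝ)) * ∑ i, W.wOut i * P.h (feature P W (K + 1) i n))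
  rw [abs_sub_comm] at h2
  refine h3.trans ((add_le_add h2 h1).trans ?_)
  linarith

lemma dOut_close {C : ℝ} {n : Fin N} (h : |I.out n - output P (K + 1) W n| ≤ C * (E + e)) :
    |I.dOut P n - discDOut P K W n| ≤ c * C * (E + e) := by
  rw [mul_assoc]
  exact (H.loss.deriv_lipschitz _ _ _).trans (mul_le_mul_of_nonneg_left h H.c_nonneg)

lemma h'_close {C : ℝ} {k : ℕ} {i : Fin m} {n : Fin N}
    (h : |I.x k i n - feature P W (k + 1) i n| ≤ C * (E + e) * I.a k i) :
    |deriv P.h (I.x k i n) - deriv P.h (feature P W (k + 1) i n)|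
      ≤ c * (C * (E + e) * I.a k i) :=
  (H.activation.deriv_lipschitz _ _).trans (mul_le_mul_of_nonneg_left h H.c_nonneg)

lemma D_top_close (hW : I.IsClose K W E) {C C' : ℝ} (hC' : 0 ≤ C')
    (hx : ∀ i n, |I.x K i n - feature P W (K + 1) i n| ≤ C * (E + e) * I.a K i)
    (hd : ∀ n, |I.dOut P n - discDOut P K W n| ≤ C' * (E + e)) (i : Fin m) (n : Fin N) :
    |I.D K i n - discD P K W K i n|
      ≤ (c * c * (c * C) + (c * C' + c) * c) * (E + e) * I.a K i := by
  have hc := H.c_nonneg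
  have he := H.e_nonneg
  have hE := hW.nonneg
  have ha := H.one_le_a K i
  have hai := H.a_nonneg K i
  rw [H.D_top, discD_top]
  have h1 : |I.v i * I.dOut P n - W.wOut i * discDOut P K W n|
      ≤ (c * C' + c) * (E + e) * I.a K i := by
    refine (abs_mul_sub_mul_le (H.v_bound i) (H.abs_discDOut_le n) (hW.wOut i) (hd n)).trans ?_
    calc _ ≤ c * (C' * (E + e)) * I.a K i + (E + e) * I.a K i * c := by
          refine add_le_add (le_mul_of_one_le_right (by positivity) ha) ?_
          gcongr
          linarith
      _ = _ := by ring
  have h2 : |I.v i * I.dOut P n| ≤ c * c := by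
    rw [abs_mul]
    exact mul_le_mul (H.v_bound i) (H.abs_dOut_le n) (abs_nonneg _) hc
  refine (abs_mul_sub_mul_le h2 (H.activation.deriv_bound _) h1 (H.h'_close (hx i n))).trans ?_
  exact le_of_eq (by ring)

/-- The discrete backward features have no a priori bound. Comparison with the ideal ones, together
with `E + e ≤ 1`, shows that they are at most `c + C'` times the size, and the products are then of
order `a_i a_j²`, averaged over `j`. -/
lemma D_succ_close (hW : I.IsClose K W E) (hEe : E + e ≤ 1) {k : ℕ} (hk : k < K) {C C' : ℝ}
    (hC' : 0 ≤ C')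
    (hx : ∀ i n, |I.x k i n - feature P W (k + 1) i n| ≤ C * (E + e) * I.a k i)
    (ih : ∀ j n, |I.D (k + 1) j n - discD P K W (k + 1) j n| ≤ C' * (E + e) * I.a (k + 1) j)
    (i : Fin m) (n : Fin N) :
    |I.D k i n - discD P K W k i n|
      ≤ (c * c * c * (c * C) + (c * C' + (c + C')) * c * c + 1) * (E + e) * I.a k i := by
  have hc := H.c_nonneg
  have he := H.e_nonneg
  have hE := hW.nonneg
  have ha := H.one_le_a k i
  have hai := H.a_nonneg k i
  rw [discD_succ P K W hk]
  have hD : ∀ j, |discD P K W (k + 1) j n| ≤ (c + C') * I.a (k + 1) j := fun j => by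
    have h1 := H.D_bound (k + 1) hk j n
    have h2 := ih j n
    have h3 := H.one_le_a (k + 1) j
    have h4 : C' * (E + e) * I.a (k + 1) j ≤ C' * I.a (k + 1) j := by
      gcongr
      exact mul_le_of_le_one_right hC' hEe
    have h5 : |discD P K W (k + 1) j n| ≤ |I.D (k + 1) j n|
        + |I.D (k + 1) j n - discD P K W (k + 1) j n| := by
      have := abs_sub (I.D (k + 1) j n) (I.D (k + 1) j n - discD P K W (k + 1) j n)
      simpa using this
    have h6 : c ≤ c * I.a (k + 1) j := le_mul_of_one_le_right hc h3
    linarith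
  have h1 := abs_avg_sub_avg_le (f := fun j => I.w k i j * I.D (k + 1) j n)
    (g := fun j => W.w (k + 2) i j * discD P K W (k + 1) j n)
    (q := fun j => I.a (k + 1) j ^ 2) (B := (c * C' + (c + C')) * (E + e) * I.a k i)
    (by positivity) (fun j => by
      refine (abs_mul_sub_mul_le (H.w_bound k hk i j) (hD j) (hW.w k hk i j) (ih j n)).trans ?_
      have hj := H.a_nonneg (k + 1) j
      calc _ ≤ c * I.a (k + 1) j * (C' * (E + e) * I.a (k + 1) j) * I.a k i
            + (E + e) * (I.a k i * I.a (k + 1) j) * ((c + C') * I.a (k + 1) j) := by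
            refine add_le_add (le_mul_of_one_le_right (by positivity) ha) ?_
            gcongr
            linarith
        _ = _ := by ring) (H.avg_sq (k + 1) hk)
  have h2 : |(1 / (m : ℝ)) * ∑ j, I.w k i j * I.D (k + 1) j n| ≤ c * c * c := by
    refine abs_avg_le_mul (q := fun j => I.a (k + 1) j ^ 2) (by positivity) (fun j => ?_)
      (H.avg_sq (k + 1) hk)
    have hj := H.a_le_sq (k + 1) j
    rw [abs_mul]
    calc _ ≤ (c * I.a (k + 1) j ^ 2) * c := by
          have h3 := H.w_bound k hk i j
          have h4 := H.D_bound (k + 1) hk j n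
          gcongr
          exact h3.trans (by gcongr)
      _ = _ := by ring
  have h3 := abs_mul_sub_mul_le h2 (H.activation.deriv_bound _) h1 (H.h'_close (hx i n))
  have h4 := H.bwd k hk i n
  refine (abs_sub_le _ _ _).trans ((add_le_add h4 h3).trans ?_)
  have h5 : 0 ≤ E * I.a k i := by positivity
  linarith

/-- The resulting weight `a_i a_j` is the one in which closeness of the connecting weights is
measured, so the estimate can be fed back into the next gradient step. -/
lemma grad_close (hW : I.IsClose K W E) {k : ℕ} {C C' : ℝ} (hC : 0 ≤ C) (hC' : 0 ≤ C')
    (hk : k < K) {i j : Fin m}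
    (hx : ∀ n, |I.x k i n - feature P W (k + 1) i n| ≤ C * (E + e) * I.a k i)
    (hD : ∀ n, |I.D (k + 1) j n - discD P K W (k + 1) j n| ≤ C' * (E + e) * I.a (k + 1) j) :
    |(1 / (N : ℝ)) * ∑ n, I.D (k + 1) j n * P.h (I.x k i n)
      - (1 / (N : ℝ)) * ∑ n, discD P K W (k + 1) j n * P.h (feature P W (k + 1) i n)|
      ≤ (c * (c * C) + C' * c) * (E + e) * (I.a k i * I.a (k + 1) j) := by
  have hc := H.c_nonneg
  have he := H.e_nonneg
  have hE := hW.nonneg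
  have hi := H.one_le_a k i
  have hj := H.one_le_a (k + 1) j
  rw [← mul_sub, ← Finset.sum_sub_distrib]
  refine abs_avg_le (by positivity) fun n => ?_
  refine (abs_mul_sub_mul_le (H.D_bound (k + 1) hk j n) (H.activation.bound _) (hD n)
    ((H.h_lip _ _).trans (mul_le_mul_of_nonneg_left (hx n) hc))).trans ?_
  calc _ ≤ c * (c * (C * (E + e) * I.a k i)) * I.a (k + 1) j
        + C' * (E + e) * I.a (k + 1) j * c * I.a k i :=
        add_le_add (le_mul_of_one_le_right (by positivity) hj)
          (le_mul_of_one_le_right (by positivity) hi)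
    _ = _ := by ring

lemma gOut_close (hW : I.IsClose K W E) {C C' : ℝ} (hC : 0 ≤ C) (hC' : 0 ≤ C') {i : Fin m}
    (hx : ∀ n, |I.x K i n - feature P W (K + 1) i n| ≤ C * (E + e) * I.a K i)
    (hd : ∀ n, |I.dOut P n - discDOut P K W n| ≤ C' * (E + e)) :
    |(1 / (N : ℝ)) * ∑ n, I.dOut P n * P.h (I.x K i n)
      - (1 / (N : ℝ)) * ∑ n, discDOut P K W n * P.h (feature P W (K + 1) i n)|
      ≤ (c * (c * C) + C' * c) * (E + e) * I.a K i := by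
  have hc := H.c_nonneg
  have he := H.e_nonneg
  have hE := hW.nonneg
  have hi := H.one_le_a K i
  rw [← mul_sub, ← Finset.sum_sub_distrib]
  refine abs_avg_le (by positivity) fun n => ?_
  refine (abs_mul_sub_mul_le (H.abs_dOut_le n) (H.activation.bound _) (hd n)
    ((H.h_lip _ _).trans (mul_le_mul_of_nonneg_left (hx n) hc))).trans ?_
  calc _ ≤ c * (c * (C * (E + e) * I.a K i)) + C' * (E + e) * c * I.a K i :=
        add_le_add le_rfl (le_mul_of_one_le_right (by positivity) hi)
    _ = _ := by ring

lemma gFirst_close (hW : I.IsClose K W E) {C : ℝ} (hC : 0 ≤ C) {i : Fin m}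
    (hD : ∀ n, |I.D 0 i n - discD P K W 0 i n| ≤ C * (E + e) * I.a 0 i) (l : Fin d) :
    |(1 / (N : ℝ)) * ∑ n, P.X n l * I.D 0 i n - (1 / (N : ℝ)) * ∑ n, P.X n l * discD P K W 0 i n|
      ≤ c * C * (E + e) * I.a 0 i := by
  have hc := H.c_nonneg
  have he := H.e_nonneg
  have hE := hW.nonneg
  have hi := H.a_nonneg 0 i
  rw [← mul_sub, ← Finset.sum_sub_distrib]
  refine abs_avg_le (by positivity) fun n => ?_
  rw [← mul_sub, abs_mul, mul_assoc c C, mul_assoc c]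
  exact mul_le_mul (H.X_bound n l) (hD n) (abs_nonneg _) hc

end IsConsistent

/-- Closeness of the weights passes to the features, the output and the gradients. -/
structure IsGradClose (I : IdealNet d N m) (P : Problem d N Y) (K : ℕ) (W : Weights d m)
    (ζ : ℝ) : Prop where
  feature : ∀ k ≤ K, ∀ i n, |I.x k i n - feature P W (k + 1) i n| ≤ ζ * I.a k i
  output : ∀ n, |I.out n - output P (K + 1) W n| ≤ ζ
  gFirst : ∀ i l, |(1 / (N : ℝ)) * ∑ n, P.X n l * I.D 0 i n
    - (1 / (N : ℝ)) * ∑ n, P.X n l * discD P K W 0 i n| ≤ ζ * I.a 0 i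
  grad : ∀ k < K, ∀ i j, |(1 / (N : ℝ)) * ∑ n, I.D (k + 1) j n * P.h (I.x k i n)
      - (1 / (N : ℝ)) * ∑ n, discD P K W (k + 1) j n * P.h (DeepMeanField.feature P W (k + 1) i n)|
      ≤ ζ * (I.a k i * I.a (k + 1) j)
  gOut : ∀ i, |(1 / (N : ℝ)) * ∑ n, I.dOut P n * P.h (I.x K i n)
      - (1 / (N : ℝ)) * ∑ n, discDOut P K W n * P.h (DeepMeanField.feature P W (K + 1) i n)|
      ≤ ζ * I.a K i

lemma exists_feature_const (K : ℕ) (c : ℝ) (hc : 0 ≤ c) (k : ℕ) : ∃ C : ℝ, 0 ≤ C ∧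
    ∀ {d N m : ℕ} {Y : Type*} (I : IdealNet d N m) (P : Problem d N Y) (W : Weights d m) (e E : ℝ),
      I.IsConsistent P K c e → I.IsClose K W E → k ≤ K → ∀ i n,
      |I.x k i n - DeepMeanField.feature P W (k + 1) i n| ≤ C * (E + e) * I.a k i := by
  induction k with
  | zero => exact ⟨c, hc, fun I P W e E H hW _ i n => H.feature_zero hW i n⟩
  | succ k ih =>
    obtain ⟨C, hC, ih⟩ := ih
    exact ⟨((c * (c * C) + c) * c) + 1, by positivity, fun I P W e E H hW hk j n =>
      H.feature_succ hW hk hC (ih I P W e E H hW (by omega)) j n⟩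

lemma exists_out_const (K : ℕ) (c : ℝ) (hc : 0 ≤ c) : ∃ C : ℝ, 0 ≤ C ∧
    ∀ {d N m : ℕ} {Y : Type*} (I : IdealNet d N m) (P : Problem d N Y) (W : Weights d m) (e E : ℝ),
      I.IsConsistent P K c e → I.IsClose K W E → ∀ n,
      |I.out n - DeepMeanField.output P (K + 1) W n| ≤ C * (E + e) := by
  obtain ⟨C, hC, h⟩ := exists_feature_const K c hc K
  exact ⟨((c * (c * C) + c) * c) + 1, by positivity, fun I P W e E H hW n =>
    H.out_close hW hC (h I P W e E H hW le_rfl) n⟩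

lemma exists_D_const (K : ℕ) (c : ℝ) (hc : 0 ≤ c) (r : ℕ) : ∃ C : ℝ, 0 ≤ C ∧
    ∀ {d N m : ℕ} {Y : Type*} (I : IdealNet d N m) (P : Problem d N Y) (W : Weights d m) (e E : ℝ),
      I.IsConsistent P K c e → I.IsClose K W E → E + e ≤ 1 → ∀ k, k + r = K → ∀ i n,
      |I.D k i n - discD P K W k i n| ≤ C * (E + e) * I.a k i := by
  induction r with
  | zero =>
    obtain ⟨C, hC, hx⟩ := exists_feature_const K c hc K
    obtain ⟨C', hC', ho⟩ := exists_out_const K c hc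
    refine ⟨c * c * (c * C) + (c * (c * C') + c) * c, by positivity,
      fun I P W e E H hW _ k hk i n => ?_⟩
    obtain rfl : k = K := hk
    exact H.D_top_close hW (by positivity) (hx I P W e E H hW le_rfl)
      (fun n => H.dOut_close (ho I P W e E H hW n)) i n
  | succ r ih =>
    obtain ⟨C', hC', ih⟩ := ih
    obtain ⟨C, hC, hx⟩ := exists_feature_const K c hc (K - (r + 1))
    refine ⟨c * c * c * (c * C) + (c * C' + (c + C')) * c * c + 1, by positivity,
      fun I P W e E H hW hEe k hk i n => ?_⟩
    obtain rfl : k = K - (r + 1) := by omega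
    exact H.D_succ_close hW hEe (by omega) hC' (hx I P W e E H hW (by omega))
      (ih I P W e E H hW hEe _ (by omega)) i n

universe u in
-- The gradient is Lipschitz in the weights for the size-weighted norm, up to the consistency error
-- and with a constant independent of width and data. This is the one-step input of the discrete
-- Gronwall argument.
theorem exists_isGradClose (K : ℕ) (c : ℝ) (hc : 0 ≤ c) : ∃ C : ℝ, 1 ≤ C ∧
    ∀ {d N m : ℕ} {Y : Type u} (I : IdealNet d N m) (P : Problem d N Y) (W : Weights d m) (e E : ℝ),
      I.IsConsistent P K c e → I.IsClose K W E → E + e ≤ 1 →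
      I.IsGradClose P K W (C * (E + e)) := by
  obtain ⟨Cx, hx⟩ := exists_uniform_const (P := fun k C => 0 ≤ C ∧
    ∀ {d N m : ℕ} {Y : Type u} (I : IdealNet d N m) (P : Problem d N Y) (W : Weights d m)
      (e E : ℝ), I.IsConsistent P K c e → I.IsClose K W E → k ≤ K → ∀ i n,
      |I.x k i n - DeepMeanField.feature P W (k + 1) i n| ≤ C * (E + e) * I.a k i)
    (fun k C C' hC h => ⟨h.1.trans hC, fun I P W e E H hW hk i n => by
      have := H.a_nonneg k i
      have := hW.nonneg
      have := H.e_nonneg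
      exact (h.2 I P W e E H hW hk i n).trans (by gcongr)⟩) (exists_feature_const K c hc) K
  obtain ⟨CD, hD⟩ := exists_uniform_const (P := fun r C => 0 ≤ C ∧
    ∀ {d N m : ℕ} {Y : Type u} (I : IdealNet d N m) (P : Problem d N Y) (W : Weights d m)
      (e E : ℝ), I.IsConsistent P K c e → I.IsClose K W E → E + e ≤ 1 → ∀ k, k + r = K → ∀ i n,
      |I.D k i n - discD P K W k i n| ≤ C * (E + e) * I.a k i)
    (fun r C C' hC h => ⟨h.1.trans hC, fun I P W e E H hW hEe k hk i n => by
      have := H.a_nonneg k i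
      have := hW.nonneg
      have := H.e_nonneg
      exact (h.2 I P W e E H hW hEe k hk i n).trans (by gcongr)⟩) (exists_D_const K c hc) K
  obtain ⟨Co, hCo, ho⟩ := exists_out_const K c hc
  have hCx : 0 ≤ Cx := (hx 0 (Nat.zero_le _)).1
  have hCD : 0 ≤ CD := (hD 0 (Nat.zero_le _)).1
  have p1 : 0 ≤ c * (c * Cx) := by positivity
  have p2 : 0 ≤ CD * c := by positivity
  have p3 : 0 ≤ c * Co * c := by positivity
  refine ⟨1 + Cx + Co + c * (c * Cx) + CD * c + c * Co * c, by linarith,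
    fun I P W e E H hW hEe => ?_⟩
  have hE := hW.nonneg
  have he := H.e_nonneg
  have hxx : ∀ k ≤ K, ∀ i n, |I.x k i n - DeepMeanField.feature P W (k + 1) i n|
      ≤ Cx * (E + e) * I.a k i := fun k hk => (hx k hk).2 I P W e E H hW hk
  have hDD : ∀ k ≤ K, ∀ i n, |I.D k i n - discD P K W k i n| ≤ CD * (E + e) * I.a k i :=
    fun k hk => (hD (K - k) (by omega)).2 I P W e E H hW hEe k (by omega)
  have hoo := ho I P W e E H hW
  refine ⟨fun k hk i n => ?_, fun n => ?_, fun i l => ?_, fun k hk i j => ?_, fun i => ?_⟩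
  · have := H.a_nonneg k i
    refine (hxx k hk i n).trans ?_
    gcongr
    linarith
  · refine (hoo n).trans ?_
    gcongr
    linarith
  · have := H.a_nonneg 0 i
    refine (H.gFirst_close hW hCD (hDD 0 (Nat.zero_le _) i) l).trans ?_
    gcongr
    linarith
  · have := H.a_nonneg k i
    have := H.a_nonneg (k + 1) j
    refine (H.grad_close hW hCx hCD hk (hxx k hk.le i) (hDD (k + 1) hk j)).trans ?_
    exact mul_le_mul_of_nonneg_right (mul_le_mul_of_nonneg_right (by linarith) (by positivity))
      (by positivity)
  · have := H.a_nonneg K i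
    refine (H.gOut_close hW hCx (C' := c * Co) (by positivity) (hxx K le_rfl i)
      fun n => H.dOut_close (hoo n)).trans ?_
    exact mul_le_mul_of_nonneg_right (mul_le_mul_of_nonneg_right (by linarith) (by positivity))
      (by positivity)

end IdealNet

/-! ### Gradient descent as an Euler scheme -/

/-- The error of an explicit Euler step. -/
lemma abs_euler_step_le {f g : ℝ → ℝ} {T B t t' : ℝ} (hg : ContinuousOn g (Icc 0 T))
    (hf : ∀ t ∈ Icc 0 T, f t = f 0 - ∫ s in (0 : ℝ)..t, g s) (ht : t ∈ Icc 0 T)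
    (ht' : t' ∈ Icc 0 T) (htt' : t ≤ t') (hB : ∀ s ∈ Icc t t', |g s - g t| ≤ B) :
    |f t' - (f t - (t' - t) * g t)| ≤ B * (t' - t) := by
  have hI : ∀ r ∈ Icc 0 T, IntervalIntegrable g volume 0 r := fun r hr =>
    (hg.mono (by rw [uIcc_of_le hr.1]; exact Icc_subset_Icc_right hr.2)).intervalIntegrable
  have hI2 : IntervalIntegrable g volume t t' := (hI t ht).symm.trans (hI t' ht')
  have h1 : f t' - (f t - (t' - t) * g t) = - ∫ r in t..t', (g r - g t) := by
    rw [hf t' ht', hf t ht, intervalIntegral.integral_sub hI2 intervalIntegrable_const,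
      ← intervalIntegral.integral_interval_sub_left (hI t' ht') (hI t ht),
      intervalIntegral.integral_const, smul_eq_mul]
    ring
  have h2 : ‖∫ r in t..t', (g r - g t)‖ ≤ B * |t' - t| :=
    intervalIntegral.norm_integral_le_of_norm_le_const fun r hr => by
      rw [uIoc_of_le htt'] at hr
      exact hB r (Ioc_subset_Icc_self hr)
  rw [h1, abs_neg, ← Real.norm_eq_abs]
  rwa [abs_of_nonneg (by linarith)] at h2

/-- One step of gradient descent compared with one step of the flow. -/
lemma abs_step_sub_step_le {x x' y g ĝ η E ζ Λ q : ℝ} (hη : 0 ≤ η)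
    (h₁ : |x' - (x - η * g)| ≤ Λ * η * q * η) (h₂ : |x - y| ≤ E * q) (h₃ : |g - ĝ| ≤ ζ * q) :
    |x' - (y - η * ĝ)| ≤ (E + η * ζ + Λ * η * η) * q := by
  have e : x' - (y - η * ĝ) = (x' - (x - η * g)) + (x - y) + -(η * (g - ĝ)) := by ring
  have h4 : |η * (g - ĝ)| ≤ η * (ζ * q) := by
    rw [abs_mul, abs_of_nonneg hη]
    gcongr
  rw [e]
  refine (abs_add_three _ _ _).trans ?_
  rw [abs_neg]
  linarith

namespace LimitNet

variable {d N K m : ℕ} {Y : Type*} (M : LimitNet d N K)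

/-- The ideal discrete network of a limit network at time `t`, with nodes `z`. -/
def ideal (z : ∀ k, Fin m → M.S k) (t : ℝ) : IdealNet d N m :=
  { a := fun k i => M.a k (z k i)
    u := fun i => M.u (z 0 i) t
    x := fun k i => M.x k (z k i) t
    w := fun k i j => M.w k (z k i) (z (k + 1) j) t
    v := fun i => M.v (z K i) t
    D := fun k i => M.D k (z k i) t
    out := M.out t }

/-- The limit network uses the activation, the loss and the inputs of the problem `P`. -/
structure Matches (P : Problem d N Y) : Prop where
  h : M.h = P.h
  X : M.X = P.X
  ψ : ∀ n, M.ψ n = deriv (fun x => P.φ x (P.y n))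

variable {M} {P : Problem d N Y} {c T C ε r : ℝ} {z : ∀ k, Fin m → M.S k}

lemma ideal_dOut (hP : M.Matches P) (t : ℝ) (n : Fin N) :
    (M.ideal z t).dOut P n = M.dOut t n := by
  rw [LimitNet.dOut, hP.ψ]
  rfl

/-- Typicality gives an error `C * ε` for the averages. In the backward recursion the average is
multiplied by the derivative of the activation, which accounts for the additional factor `c`. -/
lemma IsRegular.isConsistent (H : M.IsRegular c T) (hP : M.Matches P)
    (hh : ActivationAssumption P.h c c c) (hφ : LossAssumption P.φ c c) (hε : 0 ≤ ε)
    (hC : 1 ≤ C) (hz : M.IsTypical C ε T r z) {t : ℝ} (ht : t ∈ Icc 0 T) :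
    (M.ideal z t).IsConsistent P K (c + C) (c * C * ε) := by
  have hc := H.c_nonneg
  have hc1 := H.one_le
  have hcC : c ≤ c + C := by linarith
  have hC0 : 0 ≤ C := by linarith
  have hCe : C * ε ≤ c * C * ε := by
    rw [mul_assoc]
    exact le_mul_of_one_le_left (by positivity) hc1
  have hMh := hP.h
  refine
    { activation := ⟨hh.differentiable, fun y => (hh.bound y).trans hcC,
        fun y => (hh.deriv_bound y).trans hcC,
        fun y y' => (hh.deriv_lipschitz y y').trans (by gcongr)⟩
      loss := ⟨hφ.differentiable, fun y x => (hφ.deriv_bound y x).trans hcC,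
        fun y x x' => (hφ.deriv_lipschitz y x x').trans (by gcongr)⟩
      X_bound := fun n i => by rw [← hP.X]; exact (H.X_bound n i).trans hcC
      one_le := by linarith
      e_nonneg := by positivity
      one_le_a := fun k i => H.one_le_a k _
      avg_sq := fun k hk => (hz.avg_sq k hk).trans (by linarith)
      x_zero := fun i n => by rw [← hP.X]; exact H.x_zero t ht (z 0 i) n
      fwd := fun k hk j n => ?_
      out_le := fun n => ?_
      D_top := fun i n => by rw [ideal_dOut hP, ← hMh]; exact H.D_top t ht (z K i) n
      bwd := fun k hk i n => ?_
      w_bound := fun k hk i j => (H.w_bound k hk _ _ t ht).trans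
        (mul_le_mul_of_nonneg_right hcC (H.a_nonneg _ _))
      v_bound := fun i => (H.v_bound _ t ht).trans hcC
      D_bound := fun k hk i n => (H.D_bound k hk _ t ht n).trans hcC }
  · rw [← hMh]
    exact (hz.fwd t ht k hk j n).trans (mul_le_mul_of_nonneg_right hCe (H.a_nonneg _ _))
  · rw [← hMh]
    exact (hz.out t ht n).trans hCe
  · rw [← hMh]
    change |M.D k (z k i) t n - _ * deriv M.h (M.x k (z k i) t n)| ≤ _
    rw [H.D_succ t ht k hk, ← sub_mul, abs_mul, abs_sub_comm]
    have h1 := hz.bwd t ht k hk i n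
    have h2 := H.h'_bound (M.x k (z k i) t n)
    calc _ ≤ C * ε * c := mul_le_mul h1 h2 (abs_nonneg _) (by positivity)
      _ = c * C * ε := by ring
      _ ≤ c * C * ε * M.a k (z k i) := le_mul_of_one_le_right (by positivity) (H.one_le_a k _)

/-- The term `η * ζ` is the gap between the two gradients. The quadratic term is the local Euler
error: the gradients of the flow are Lipschitz in time with constant `c³ + c²` relative to the
sizes. -/
lemma IsRegular.isClose_step (H : M.IsRegular c T) (hP : M.Matches P)
    (hh : Differentiable ℝ P.h) (hφ : ∀ y, Differentiable ℝ (fun x => P.φ x y))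
    (hd : 0 < d) (hm : 0 < m) {η t E ζ : ℝ} (hη : 0 < η) (hζ : 0 ≤ ζ)
    (ht : t ∈ Icc 0 T) (ht' : t + η ∈ Icc 0 T)
    {W : Weights d m} (hW : (M.ideal z t).IsClose K W E)
    (hG : (M.ideal z t).IsGradClose P K W ζ) :
    (M.ideal z (t + η)).IsClose K (gdStep P (K + 1) η W)
      (E + η * ζ + (c * c * c + c * c) * η * η) := by
  have hc := H.c_nonneg
  have hE := hW.nonneg
  have htt : t ≤ t + η := by linarith
  have hMh := hP.h
  have mem : ∀ s ∈ Icc t (t + η), s ∈ Icc 0 T ∧ |s - t| ≤ η := fun s hs =>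
    ⟨⟨ht.1.trans hs.1, hs.2.trans ht'.2⟩, by rw [abs_le]; constructor <;> linarith [hs.1, hs.2]⟩
  have hccc : 0 ≤ c * c * c := by positivity
  have hcc : 0 ≤ c * c := by positivity
  refine ⟨by positivity, fun l i => ?_, fun k hk i j => ?_, fun i => ?_⟩
  · rw [gdStep_w₁ K W hh hφ hd hm]
    have h0 := abs_euler_step_le (H.gFirst_cont (z 0 i) l) (fun t ht => H.flow_u_apply ht _ l)
      ht ht' htt (B := (c * c * c + c * c) * η * M.a 0 (z 0 i)) fun s hs => by
        obtain ⟨hs0, hst⟩ := mem s hs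
        have ha := H.a_nonneg 0 (z 0 i)
        rw [gFirst, gFirst, ← mul_sub, ← Finset.sum_sub_distrib]
        refine abs_avg_le (by positivity) fun n => ?_
        rw [← mul_sub, abs_mul]
        have h1 := H.D_lip 0 (Nat.zero_le _) (z 0 i) t ht s hs0 n
        have h2 := H.X_bound n l
        calc _ ≤ c * (c * η * M.a 0 (z 0 i)) := by
              gcongr
              exact h1.trans (by gcongr)
          _ = c * c * η * M.a 0 (z 0 i) := by ring
          _ ≤ _ := by gcongr; linarith
    rw [add_sub_cancel_left] at h0
    refine abs_step_sub_step_le hη.le h0 (hW.w₁ l i) ?_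
    have := hG.gFirst i l
    rw [← hP.X] at this ⊢
    exact this
  · rw [gdStep_w K W hh hφ hm η hk]
    have h0 := abs_euler_step_le (H.grad_cont hk (z k i) (z (k + 1) j))
      (fun t ht => H.flow_w t ht k hk _ _)
      ht ht' htt (B := (c * c * c + c * c) * η * (M.a k (z k i) * M.a (k + 1) (z (k + 1) j)))
      fun s hs => by
        obtain ⟨hs0, hst⟩ := mem s hs
        have ha := H.a_nonneg k (z k i)
        have ha' := H.a_nonneg (k + 1) (z (k + 1) j)
        have ha1 := H.one_le_a k (z k i)
        have ha1' := H.one_le_a (k + 1) (z (k + 1) j)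
        rw [grad, grad, ← mul_sub, ← Finset.sum_sub_distrib]
        refine abs_avg_le (by positivity) fun n => ?_
        have h1 := H.D_lip (k + 1) hk (z (k + 1) j) t ht s hs0 n
        have h2 := H.x_lip k hk.le (z k i) t ht s hs0 n
        refine (abs_mul_sub_mul_le (H.D_bound (k + 1) hk _ s hs0 n) (H.h_bound _) h1
          ((H.h_lip _ _).trans (mul_le_mul_of_nonneg_left h2 hc))).trans ?_
        calc _ ≤ c * (c * (c * η * M.a k (z k i))) * M.a (k + 1) (z (k + 1) j)
              + c * η * M.a (k + 1) (z (k + 1) j) * c * M.a k (z k i) := by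
              refine add_le_add ?_ ?_
              · refine le_trans ?_ (le_mul_of_one_le_right (by positivity) ha1')
                gcongr
              · refine le_trans ?_ (le_mul_of_one_le_right (by positivity) ha1)
                gcongr
          _ = _ := by ring
    rw [add_sub_cancel_left] at h0
    refine abs_step_sub_step_le hη.le h0 (hW.w k hk i j) ?_
    have := hG.grad k hk i j
    rw [← hMh] at this ⊢
    exact this
  · rw [gdStep_wOut K W hh hφ hm]
    have h0 := abs_euler_step_le (H.gOut_cont (z K i)) (fun t ht => H.flow_v t ht _)
      ht ht' htt (B := (c * c * c + c * c) * η * M.a K (z K i)) fun s hs => by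
        obtain ⟨hs0, hst⟩ := mem s hs
        have ha := H.a_nonneg K (z K i)
        have ha1 := H.one_le_a K (z K i)
        rw [LimitNet.gOut, LimitNet.gOut, ← mul_sub, ← Finset.sum_sub_distrib]
        refine abs_avg_le (by positivity) fun n => ?_
        have h1 := H.dOut_lip t ht s hs0 n
        have h2 := H.x_lip K le_rfl (z K i) t ht s hs0 n
        refine (abs_mul_sub_mul_le (H.abs_dOut_le s n) (H.h_bound _) h1
          ((H.h_lip _ _).trans (mul_le_mul_of_nonneg_left h2 hc))).trans ?_
        calc _ ≤ c * (c * (c * η * M.a K (z K i))) + c * η * c * M.a K (z K i) := by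
              refine add_le_add ?_ ?_
              · gcongr
              · refine le_trans ?_ (le_mul_of_one_le_right (by positivity) ha1)
                gcongr
          _ = _ := by ring
    rw [add_sub_cancel_left] at h0
    refine abs_step_sub_step_le hη.le h0 (hW.wOut i) ?_
    have := hG.gOut i
    simp only [ideal_dOut hP] at this
    rw [← hMh] at this ⊢
    exact this

end LimitNet

lemma IdealNet.IsClose.mono {d N m K : ℕ} {I : IdealNet d N m} {W : Weights d m} {E E' : ℝ}
    (h : I.IsClose K W E) (hE : E ≤ E') (ha : ∀ k i, 0 ≤ I.a k i) : I.IsClose K W E' :=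
  ⟨h.nonneg.trans hE, fun l i => (h.w₁ l i).trans (mul_le_mul_of_nonneg_right hE (ha _ _)),
    fun k hk i j => (h.w k hk i j).trans
      (mul_le_mul_of_nonneg_right hE (mul_nonneg (ha _ _) (ha _ _))),
    fun i => (h.wOut i).trans (mul_le_mul_of_nonneg_right hE (ha _ _))⟩

lemma IdealNet.IsGradClose.mono {d N m K : ℕ} {Y : Type*} {P : Problem d N Y}
    {I : IdealNet d N m} {W : Weights d m} {ζ ζ' : ℝ}
    (h : I.IsGradClose P K W ζ) (hζ : ζ ≤ ζ') (ha : ∀ k i, 0 ≤ I.a k i) :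
    I.IsGradClose P K W ζ' :=
  ⟨fun k hk i n => (h.feature k hk i n).trans (mul_le_mul_of_nonneg_right hζ (ha _ _)),
    fun n => (h.output n).trans hζ,
    fun i l => (h.gFirst i l).trans (mul_le_mul_of_nonneg_right hζ (ha _ _)),
    fun k hk i j => (h.grad k hk i j).trans
      (mul_le_mul_of_nonneg_right hζ (mul_nonneg (ha _ _) (ha _ _))),
    fun i => (h.gOut i).trans (mul_le_mul_of_nonneg_right hζ (ha _ _))⟩

namespace LimitNet

/-- Gradient descent from an initialization close to a typical sample tracks the ideal network. -/
theorem exists_tracking (d N K : ℕ) (c T C κ : ℝ) (hd : 0 < d) (hc : 1 ≤ c) (hC : 1 ≤ C)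
    (hκ : 0 < κ) : ∃ ε₀ A : ℝ, 0 < ε₀ ∧ ε₀ ≤ 1 ∧ 0 < A ∧
      ∀ {m : ℕ} {Y : Type*} (M : LimitNet d N K) (P : Problem d N Y) (z : ∀ k, Fin m → M.S k)
        (W : Weights d m) (ε η r : ℝ),
        0 < m → M.IsRegular c T → M.Matches P → ActivationAssumption P.h c c c →
        LossAssumption P.φ c c → M.IsTypical C ε T r z → 0 < ε → ε ≤ ε₀ → 0 < η → η ≤ κ * ε →
        (M.ideal z 0).IsClose K W ε → ∀ k : ℕ, k ≤ ⌊T / η⌋₊ →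
          (M.ideal z (k * η)).IsClose K (gd P (K + 1) η W k) (A * ε) ∧
          (M.ideal z (k * η)).IsGradClose P K (gd P (K + 1) η W k) (A * ε) := by
  obtain ⟨Cg, hCg, hgrad⟩ := IdealNet.exists_isGradClose K (c + C) (by linarith)
  set Λ := c * c * c + c * c with hΛ
  have hΛ0 : 0 ≤ Λ := by positivity
  -- The growth rate per unit time: `Cg` from the stability of the gradient, `Λ * κ` from the local
  -- Euler error after `η ≤ κ ε`.
  set g := Cg + Λ * κ with hg
  have hg0 : 0 ≤ g := by positivity
  set A₀ := 2 * (c * C) * Real.exp (g * T) with hA₀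
  have hA₀pos : 0 < A₀ := by positivity
  -- The second term of the minimum keeps error plus consistency error below `1` up to time `T`, as
  -- the stability estimate requires.
  refine ⟨min 1 (1 / A₀), Cg * A₀, by positivity, min_le_left _ _, by positivity, ?_⟩
  intro m Y M P z W ε η r hm H hP hh hφ hz hε hεε hη hηκ hW₀
  set e := c * C * ε with he
  have he0 : 0 < e := by positivity
  have hεe : ε ≤ e := le_mul_of_one_le_left hε.le (one_le_mul_of_one_le_of_one_le hc hC)
  have hA₀ε : A₀ * ε ≤ 1 := by
    have : ε ≤ 1 / A₀ := hεε.trans (min_le_right _ _)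
    rwa [le_div_iff₀ hA₀pos, mul_comm] at this
  have ha : ∀ t k i, 0 ≤ (M.ideal z t).a k i := fun t k i => H.a_nonneg k _
  have htime : ∀ k : ℕ, k ≤ ⌊T / η⌋₊ → (k : ℝ) * η ∈ Icc 0 T := fun k hk =>
    ⟨by positivity, by
      rw [← le_div_iff₀ hη]
      exact (Nat.le_floor_iff (div_nonneg H.T_nonneg hη.le)).1 hk⟩
  have hone : ∀ k : ℕ, 1 ≤ (1 + η * g) ^ k := fun k =>
    one_le_pow₀ (by have : 0 ≤ η * g := by positivity
                    linarith)
  have hpow : ∀ k : ℕ, k ≤ ⌊T / η⌋₊ → 2 * e * (1 + η * g) ^ k ≤ A₀ * ε := fun k hk => by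
    have h1 : (1 + η * g) ^ k ≤ Real.exp (g * T) := by
      calc (1 + η * g) ^ k ≤ (Real.exp (η * g)) ^ k := by
            gcongr
            linarith [Real.add_one_le_exp (η * g)]
        _ = Real.exp (k * η * g) := by rw [← Real.exp_nat_mul]; ring_nf
        _ ≤ Real.exp (g * T) := by
            rw [Real.exp_le_exp, mul_comm g]
            exact mul_le_mul_of_nonneg_right (htime k hk).2 hg0
    calc 2 * e * (1 + η * g) ^ k ≤ 2 * e * Real.exp (g * T) := by gcongr
      _ = A₀ * ε := by rw [hA₀, he]; ring
  -- The error is written so that, after adding `e`, it is the pure geometric sequence `b = 2 e (1 +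
  -- η g)^k`. It starts at `e`, which dominates the initial error `ε`.
  have main : ∀ k : ℕ, k ≤ ⌊T / η⌋₊ →
      (M.ideal z (k * η)).IsClose K (gd P (K + 1) η W k) (2 * e * (1 + η * g) ^ k - e) := by
    intro k
    induction k with
    | zero =>
      intro _
      simp only [Nat.cast_zero, zero_mul, pow_zero, mul_one]
      exact hW₀.mono (by linarith) (ha 0)
    | succ k ih =>
      intro hk
      have hk' : k ≤ ⌊T / η⌋₊ := by omega
      have ih := ih hk'
      have ht := htime k hk'
      have ht' := htime (k + 1) hk
      have ht2 : ((k + 1 : ℕ) : ℝ) * η = k * η + η := by push_cast; ring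
      rw [ht2] at ht' ⊢
      set b := 2 * e * (1 + η * g) ^ k with hb
      have hbe : e ≤ b := by
        have := hone k
        have : 2 * e * 1 ≤ b := by rw [hb]; gcongr
        linarith
      have hG := hgrad _ P _ _ _ (H.isConsistent hP hh hφ hε.le hC hz ht) ih
        (by linarith [hpow k hk'])
      rw [sub_add_cancel] at hG
      have hstep := H.isClose_step hP hh.differentiable hφ.differentiable hd hm hη
        (mul_nonneg (by linarith) (by linarith)) ht ht' ih hG
      rw [gd, Function.iterate_succ_apply']
      refine hstep.mono ?_ (ha _)
      -- One factor `η` is at most `κ ε ≤ κ b`, which makes the quadratic Euler error proportional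
      -- to the current error.
      have h1 : Λ * η * η ≤ η * (Λ * κ * b) := by
        calc Λ * η * η ≤ Λ * η * (κ * ε) := by gcongr
          _ = η * (Λ * κ * ε) := by ring
          _ ≤ η * (Λ * κ * b) := by
              gcongr
              linarith
      have h2 : 2 * e * (1 + η * g) ^ (k + 1) = b + η * (Cg * b) + η * (Λ * κ * b) := by
        rw [pow_succ, hb, hg]; ring
      rw [h2]
      linarith
  intro k hk
  have h1 := main k hk
  have h2 := hgrad _ P _ _ _ (H.isConsistent hP hh hφ hε.le hC hz (htime k hk)) h1
    (by linarith [hpow k hk])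
  rw [sub_add_cancel] at h2
  have h3 : Cg * (2 * e * (1 + η * g) ^ k) ≤ Cg * A₀ * ε := by
    rw [mul_assoc Cg A₀]
    exact mul_le_mul_of_nonneg_left (hpow k hk) (by linarith)
  have h4 : 2 * e * (1 + η * g) ^ k - e ≤ Cg * A₀ * ε := by
    have : 0 < 2 * e * (1 + η * g) ^ k := by positivity
    have : 2 * e * (1 + η * g) ^ k ≤ Cg * (2 * e * (1 + η * g) ^ k) :=
      le_mul_of_one_le_left this.le hCg
    linarith
  exact ⟨h1.mono h4 (ha _), h2.mono h3 (ha _)⟩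

end LimitNet

/-! ### Laws restricted to their supports, and sub-gaussian moments -/

section Subtype

variable {E : Type*} [MeasurableSpace E] {p : Measure E} {s : Set E}

lemma map_val_comap_val (hs : MeasurableSet s) (hp : s ∈ ae p) :
    (p.comap (Subtype.val : s → E)).map Subtype.val = p := by
  rw [map_comap_subtype_coe hs, Measure.restrict_eq_self_of_ae_mem hp]

lemma integral_comap_val {F : Type*} [NormedAddCommGroup F] [NormedSpace ℝ F]
    (hs : MeasurableSet s) (hp : s ∈ ae p) (f : E → F) :
    ∫ z : s, f z ∂(p.comap Subtype.val) = ∫ x, f x ∂p := by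
  rw [integral_subtype_comap hs, Measure.restrict_eq_self_of_ae_mem hp]

lemma integrable_comap_val (hs : MeasurableSet s) (hp : s ∈ ae p) {f : E → ℝ}
    (hf : Integrable f p) : Integrable (fun z : s => f z) (p.comap Subtype.val) := by
  rw [← map_val_comap_val hs hp, (MeasurableEmbedding.subtype_coe hs).integrable_map_iff] at hf
  exact hf

lemma isProbabilityMeasure_comap_val [IsProbabilityMeasure p] (hs : MeasurableSet s)
    (hp : s ∈ ae p) : IsProbabilityMeasure (p.comap (Subtype.val : s → E)) := by
  constructor
  have h : (p.comap (Subtype.val : s → E)).map Subtype.val univ = 1 := by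
    rw [map_val_comap_val hs hp, measure_univ]
  rwa [Measure.map_apply measurable_subtype_coe MeasurableSet.univ, preimage_univ] at h

/-- A measurable retraction onto a measurable set. -/
lemma exists_measurable_retraction (hs : MeasurableSet s) (hne : s.Nonempty) :
    ∃ g : E → s, Measurable g ∧ ∀ x (hx : x ∈ s), g x = ⟨x, hx⟩ := by
  classical
  obtain ⟨y, hy⟩ := hne
  refine ⟨fun x => if hx : x ∈ s then ⟨x, hx⟩ else ⟨y, hy⟩, ?_, fun x hx => dif_pos hx⟩
  exact Measurable.dite (f := fun x : {x | x ∈ s} => (⟨x.1, x.2⟩ : s))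
    measurable_id measurable_const hs

/-- Ideal nodes lie in the support only almost surely, whereas samples of the limit network take
values in the support. Composition with a retraction repairs this without changing the law. -/
lemma map_retraction (hs : MeasurableSet s) (hp : s ∈ ae p) {g : E → s} (hg : Measurable g)
    (hgs : ∀ x (hx : x ∈ s), g x = ⟨x, hx⟩) : p.map g = p.comap Subtype.val := by
  conv_lhs => rw [← map_val_comap_val hs hp]
  rw [Measure.map_map hg measurable_subtype_coe]
  have : g ∘ Subtype.val = (id : s → s) := by
    ext z
    simp [hgs z.1 z.2]
  rw [this, Measure.map_id]

end Subtype

/-- Testing with coordinate vectors bounds the exponential moments of the coordinates. The max norm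
is attained at some coordinate, so its exponential is at most the sum over all of them, and `(1 +
‖x‖)² ≤ 2 + 2‖x‖²` explains the halved exponent. -/
lemma SubGaussian.integrable_exp_norm {n : ℕ} {p : Measure (Fin n → ℝ)} [IsProbabilityMeasure p]
    {σ : ℝ} (hσ : 0 < σ) (hp : SubGaussian p σ) :
    Integrable (fun x => Real.exp (1 / (2 * σ ^ 2) * (1 + ‖x‖) ^ 2)) p ∧
      ∫ x, Real.exp (1 / (2 * σ ^ 2) * (1 + ‖x‖) ^ 2) ∂p
        ≤ Real.exp (1 / σ ^ 2) * (1 + n * Real.exp 1) := by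
  have hi : ∀ i : Fin n, Integrable (fun x => Real.exp (x i ^ 2 / σ ^ 2)) p ∧
      ∫ x, Real.exp (x i ^ 2 / σ ^ 2) ∂p ≤ Real.exp 1 := by
    intro i
    have h := hp (Pi.single i 1) (by simp [Pi.single_apply])
    simp only [Pi.single_apply, ite_mul, one_mul, zero_mul, Finset.sum_ite_eq', Finset.mem_univ,
      if_true] at h
    have hmeas : AEStronglyMeasurable (fun x : Fin n → ℝ => Real.exp (x i ^ 2 / σ ^ 2)) p :=
      Measurable.aestronglyMeasurable (by fun_prop)
    refine ⟨⟨hmeas, ?_⟩, ?_⟩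
    · rw [hasFiniteIntegral_iff_ofReal (ae_of_all _ fun x => (Real.exp_pos _).le)]
      exact h.trans_lt ENNReal.ofReal_lt_top
    · rw [integral_eq_lintegral_of_nonneg_ae (ae_of_all _ fun x => (Real.exp_pos _).le) hmeas]
      exact ENNReal.toReal_le_of_le_ofReal (Real.exp_pos _).le h
  have hbound : ∀ x : Fin n → ℝ, Real.exp (1 / (2 * σ ^ 2) * (1 + ‖x‖) ^ 2)
      ≤ Real.exp (1 / σ ^ 2) * (1 + ∑ i, Real.exp (x i ^ 2 / σ ^ 2)) := by
    intro x
    have h1 : 1 / (2 * σ ^ 2) * (1 + ‖x‖) ^ 2 ≤ 1 / σ ^ 2 + ‖x‖ ^ 2 / σ ^ 2 := by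
      rw [div_mul_eq_mul_div, ← add_div, div_le_div_iff₀ (by positivity) (by positivity)]
      nlinarith [sq_nonneg (1 - ‖x‖), sq_pos_of_pos hσ,
        mul_nonneg (sq_nonneg (1 - ‖x‖)) (sq_nonneg σ)]
    refine (Real.exp_le_exp.2 h1).trans ?_
    rw [Real.exp_add]
    refine mul_le_mul_of_nonneg_left ?_ (Real.exp_pos _).le
    have hs : ∀ i, 0 ≤ Real.exp (x i ^ 2 / σ ^ 2) := fun i => (Real.exp_pos _).le
    rcases isEmpty_or_nonempty (Fin n) with hn | hn
    · simp [norm_of_subsingleton]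
    · obtain ⟨i, -, hi⟩ := Finset.exists_mem_eq_sup Finset.univ Finset.univ_nonempty
        (fun b => ‖x b‖₊)
      replace hi : ‖x‖ = ‖x i‖ := by rw [Pi.norm_def, hi, coe_nnnorm]
      have := Finset.single_le_sum (f := fun i => Real.exp (x i ^ 2 / σ ^ 2))
        (fun i _ => hs i) (Finset.mem_univ i)
      rw [hi, Real.norm_eq_abs, sq_abs]
      linarith
  have hint : Integrable (fun x : Fin n → ℝ =>
      Real.exp (1 / σ ^ 2) * (1 + ∑ i, Real.exp (x i ^ 2 / σ ^ 2))) p :=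
    ((integrable_const 1).add (integrable_finsetSum _ fun i _ => (hi i).1)).const_mul _
  have hint' : Integrable (fun x => Real.exp (1 / (2 * σ ^ 2) * (1 + ‖x‖) ^ 2)) p :=
    hint.mono' (Measurable.aestronglyMeasurable (by fun_prop))
      (ae_of_all _ fun x => by
        rw [Real.norm_eq_abs, abs_of_pos (Real.exp_pos _)]; exact hbound x)
  refine ⟨hint', (integral_mono hint' hint hbound).trans ?_⟩
  rw [integral_const_mul, integral_add (integrable_const 1)
    (integrable_finsetSum _ fun i _ => (hi i).1), integral_finsetSum _ fun i _ => (hi i).1]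
  refine mul_le_mul_of_nonneg_left ?_ (Real.exp_pos _).le
  have := Finset.sum_le_sum fun i (_ : i ∈ Finset.univ) => (hi i).2
  simp only [Finset.sum_const, Finset.card_univ, Fintype.card_fin, nsmul_eq_mul] at this
  simpa using this

/-! ### Independence of subfamilies -/

section Indep

variable {ι κ Ω : Type*} {mΩ : MeasurableSpace Ω} {μ : Measure Ω} {F : ι → MeasurableSpace Ω}
  {E : κ → Type*} [∀ k, MeasurableSpace (E k)] {f : ∀ k, Ω → E k} {g : κ → ι}

lemma iIndepFun_of_comap_le (hF : iIndep F μ) (hg : Function.Injective g)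
    (hf : ∀ k, MeasurableSpace.comap (f k) inferInstance ≤ F (g k)) : iIndepFun f μ := by
  rw [iIndepFun_iff_iIndep]
  have h := hF.precomp hg
  rw [iIndep_iff] at h ⊢
  exact fun s t ht => h s fun i hi => hf i _ (ht i hi)

/-- Grouping: the σ-algebra with index `i` is independent of the one generated jointly by the
indices in the range of `g`, provided `i` is not among them. -/
lemma indepFun_of_comap_le {E' : Type*} [MeasurableSpace E'] {f' : Ω → E'} {i : ι}
    (hF : iIndep F μ) (hle : ∀ i, F i ≤ mΩ) (hi : i ∉ range g)
    (hf' : MeasurableSpace.comap f' inferInstance ≤ F i)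
    (hf : ∀ k, MeasurableSpace.comap (f k) inferInstance ≤ F (g k)) :
    IndepFun f' (fun ω k => f k ω) μ := by
  rw [IndepFun_iff_Indep]
  have h := indep_iSup_of_disjoint hle hF (S := {i}) (T := range g) (by simpa using hi)
  refine indep_of_indep_of_le_left (indep_of_indep_of_le_right h ?_) ?_
  · rw [MeasurableSpace.pi, MeasurableSpace.comap_iSup]
    refine iSup_le fun k => ?_
    rw [MeasurableSpace.comap_comp]
    exact (hf k).trans (le_iSup₂_of_le (g k) (mem_range_self k) le_rfl)
  · exact hf'.trans (le_iSup₂_of_le i rfl le_rfl)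

end Indep

/-! ### The limit network of a neural feature flow -/

section LimitNet

variable {d N : ℕ} {Y : Type*} (P : Problem d N Y) (J : ℕ) (Q : ContinuousDNN d N)
  (Ψ : Trajectory d N)

/-- The nodes of layer `k + 2`: the support of `Q.p (k + 2)` for `k ≤ J`, where `J + 2` is the
number of hidden layers. -/
def nodeSet (k : ℕ) : Set (Fin N → ℝ) := {θ | k ≤ J → θ ∈ (Q.p (k + 2)).support}

/-- The node spaces of the hidden layers. -/
def NodeSpace : ℕ → Type
  | 0 => Q.p₁.support
  | k + 1 => nodeSet J Q k

instance (k : ℕ) : MeasurableSpace (NodeSpace J Q k) :=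
  match k with
  | 0 => inferInstanceAs (MeasurableSpace Q.p₁.support)
  | k + 1 => inferInstanceAs (MeasurableSpace (nodeSet J Q k))

/-- The laws of the nodes. -/
def nodeLaw : ∀ k, Measure (NodeSpace J Q k)
  | 0 => Q.p₁.comap (Subtype.val : Q.p₁.support → _)
  | k + 1 => (Q.p (k + 2)).comap (Subtype.val : nodeSet J Q k → _)

/-- The sizes of the nodes. -/
def nodeSize : ∀ k, NodeSpace J Q k → ℝ
  | 0 => fun (z : Q.p₁.support) => 1 + ‖z.1‖
  | k + 1 => fun (z : nodeSet J Q k) => 1 + ‖z.1‖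

/-- The features along the trajectory. -/
def nodeFeature : ∀ k, NodeSpace J Q k → ℝ → Fin N → ℝ
  | 0 => fun (z : Q.p₁.support) t => firstFeature P (Ψ.w₁ z.1 t)
  | k + 1 => fun (z : nodeSet J Q k) t => Ψ.θ (k + 2) z.1 t

/-- The connecting weights along the trajectory. -/
def nodeWeight : ∀ k, NodeSpace J Q k → NodeSpace J Q (k + 1) → ℝ → ℝ
  | 0 => fun (z : Q.p₁.support) (z' : nodeSet J Q 0) t => Ψ.w₂ z.1 z'.1 t
  | k + 1 => fun (z : nodeSet J Q k) (z' : nodeSet J Q (k + 1)) t => Ψ.w (k + 3) z.1 z'.1 t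

/-- The backward features along the trajectory. -/
def nodeBack : ∀ k, NodeSpace J Q k → ℝ → Fin N → ℝ
  | 0 => fun (z : Q.p₁.support) t => backFirst P (J + 2) Q Ψ t z.1
  | k + 1 => fun (z : nodeSet J Q k) t => back P (J + 2) Q Ψ t (k + 2) z.1

/-- The limit network of a trajectory of a continuous DNN with `J + 2` hidden layers. -/
def limitNet : LimitNet d N (J + 1) where
  S := NodeSpace J Q
  ρ := nodeLaw J Q
  a := nodeSize J Q
  u := fun (z : Q.p₁.support) t => Ψ.w₁ z.1 t
  x := nodeFeature P J Q Ψ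
  w := nodeWeight J Q Ψ
  v := fun (z : nodeSet J Q J) t => Ψ.wOut z.1 t
  D := nodeBack P J Q Ψ
  h := P.h
  ψ := fun n => deriv (fun x => P.φ x (P.y n))
  X := P.X

lemma limitNet_matches : (limitNet P J Q Ψ).Matches P := ⟨rfl, rfl, fun _ => rfl⟩

variable {J Q}

lemma mem_support_of_nodeSet {k : ℕ} (hk : k ≤ J) (z : nodeSet J Q k) :
    z.1 ∈ (Q.p (k + 2)).support := z.2 hk

lemma nodeSet_eq {k : ℕ} (hk : k ≤ J) : nodeSet J Q k = (Q.p (k + 2)).support := by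
  ext; simp [nodeSet, hk]

variable (Q) in
lemma measurableSet_support₁ : MeasurableSet Q.p₁.support :=
  Measure.isClosed_support.measurableSet

variable (J Q) in
lemma measurableSet_nodeSet (k : ℕ) : MeasurableSet (nodeSet J Q k) := by
  by_cases hk : k ≤ J
  · rw [nodeSet_eq hk]
    exact Measure.isClosed_support.measurableSet
  · have : nodeSet J Q k = univ := by ext; simp [nodeSet, hk]
    rw [this]
    exact MeasurableSet.univ

variable (J Q) in
lemma nodeSet_mem_ae (k : ℕ) : nodeSet J Q k ∈ ae (Q.p (k + 2)) :=
  Filter.mem_of_superset Measure.support_mem_ae fun _ hθ _ => hθ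

/-- Needed for the retraction. A set of full probability is nonempty, and beyond the last hidden
layer the support condition is void, so the whole space is left. -/
lemma nodeSet_nonempty (hQ : IsContinuousDNN P (J + 2) Q) (k : ℕ) : (nodeSet J Q k).Nonempty := by
  by_cases hk : k ≤ J
  · have := hQ.prob (k + 2) (Finset.mem_Icc.2 ⟨by omega, by omega⟩)
    exact Filter.nonempty_of_mem (f := ae (Q.p (k + 2))) (nodeSet_mem_ae J Q k)
  · exact ⟨0, fun h => absurd h hk⟩

lemma support₁_nonempty (hQ : IsContinuousDNN P (J + 2) Q) : Q.p₁.support.Nonempty := by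
  have := hQ.prob₁
  exact Filter.nonempty_of_mem (f := ae Q.p₁) Measure.support_mem_ae

/-- Integrals over the first layer of nodes. -/
lemma integral_nodeLaw_zero (f : (Fin d → ℝ) → ℝ) :
    ∫ z : Q.p₁.support, f z.1 ∂(nodeLaw J Q 0) = ∫ u, f u ∂Q.p₁ :=
  integral_comap_val (measurableSet_support₁ Q) Measure.support_mem_ae f

/-- Integrals over the further layers of nodes. -/
lemma integral_nodeLaw_succ (k : ℕ) (f : (Fin N → ℝ) → ℝ) :
    ∫ z : nodeSet J Q k, f z.1 ∂(nodeLaw J Q (k + 1)) = ∫ θ, f θ ∂(Q.p (k + 2)) :=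
  integral_comap_val (measurableSet_nodeSet J Q k) (nodeSet_mem_ae J Q k) f

variable {P Ψ}

lemma limitNet_out (t : ℝ) : (limitNet P J Q Ψ).out t = flowOutput P (J + 2) Q Ψ t := by
  funext n
  exact integral_nodeLaw_succ J fun θ => Ψ.wOut θ t * P.h (Ψ.θ (J + 2) θ t n)

lemma limitNet_dOut (t : ℝ) : (limitNet P J Q Ψ).dOut t = backOut P (J + 2) Q Ψ t := by
  funext n
  rw [LimitNet.dOut, limitNet_out]
  rfl

lemma limitNet_gOut (z : nodeSet J Q J) (t : ℝ) :
    (limitNet P J Q Ψ).gOut z t = gradOut P (J + 2) Q Ψ t z.1 := by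
  change (1 / (N : ℝ)) * ∑ n, (limitNet P J Q Ψ).dOut t n * P.h (Ψ.θ (J + 2) z.1 t n) = _
  rw [limitNet_dOut]
  rfl

lemma limitNet_Γ_one (z : nodeSet J Q 0) (t : ℝ) :
    (limitNet P J Q Ψ).Γ 1 z t = drift P (J + 2) Q Ψ t 2 z.1 := by
  funext n
  exact congrArg₂ (· + ·)
    (integral_nodeLaw_zero fun u => Ψ.w₂ u z.1 t *
      (deriv P.h (firstFeature P (Ψ.w₁ u t) n) * driftFirst P (J + 2) Q Ψ t u n))
    (integral_nodeLaw_zero fun u => P.h (firstFeature P (Ψ.w₁ u t) n) *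
      gradSecond P (J + 2) Q Ψ t u z.1)

lemma limitNet_Γ_succ (k : ℕ) (z : nodeSet J Q k) (t : ℝ) :
    (limitNet P J Q Ψ).Γ (k + 1) z t = drift P (J + 2) Q Ψ t (k + 2) z.1 := by
  induction k with
  | zero => exact limitNet_Γ_one z t
  | succ k ih =>
    funext n
    refine congrArg₂ (· + ·) ?_ (integral_nodeLaw_succ k fun θ => P.h (Ψ.θ (k + 2) θ t n) *
      gradMid P (J + 2) Q Ψ t (k + 3) θ z.1)
    refine Eq.trans ?_ (integral_nodeLaw_succ (J := J) k fun θ => Ψ.w (k + 3) θ z.1 t *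
      (deriv P.h (Ψ.θ (k + 2) θ t n) * drift P (J + 2) Q Ψ t (k + 2) θ n))
    refine integral_congr_ae (ae_of_all _ fun (z' : nodeSet J Q k) => ?_)
    exact congrArg (fun y => Ψ.w (k + 3) z'.1 z.1 t * (deriv P.h (Ψ.θ (k + 2) z'.1 t n) * y))
      (congrFun (ih z') n)

lemma limitNet_D_zero (z : Q.p₁.support) (t : ℝ) (n : Fin N) :
    nodeBack P J Q Ψ 0 z t n =
      (∫ z' : nodeSet J Q 0, Ψ.w₂ z.1 z'.1 t * back P (J + 2) Q Ψ t 2 z'.1 n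
        ∂(nodeLaw J Q 1)) * deriv P.h (firstFeature P (Ψ.w₁ z.1 t) n) := by
  rw [integral_nodeLaw_succ 0 fun θ => Ψ.w₂ z.1 θ t * back P (J + 2) Q Ψ t 2 θ n]
  rfl

lemma limitNet_D_succ {k : ℕ} (hk : k < J) (z : nodeSet J Q k) (t : ℝ) (n : Fin N) :
    nodeBack P J Q Ψ (k + 1) z t n =
      (∫ z' : nodeSet J Q (k + 1), Ψ.w (k + 3) z.1 z'.1 t * back P (J + 2) Q Ψ t (k + 3) z'.1 n
        ∂(nodeLaw J Q (k + 2))) * deriv P.h (Ψ.θ (k + 2) z.1 t n) := by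
  rw [integral_nodeLaw_succ (k + 1) fun θ => Ψ.w (k + 3) z.1 θ t *
    back P (J + 2) Q Ψ t (k + 3) θ n]
  -- Backward features are defined by counting from the top; naming the distance `r` lets one step
  -- of that recursion unfold.
  obtain ⟨r, rfl⟩ : ∃ r, J = k + r + 1 := ⟨J - k - 1, by omega⟩
  change back P _ Q Ψ t (k + 2) z.1 n = _
  unfold back
  rw [show k + r + 1 + 2 - (k + 2) = r + 1 by omega, show k + r + 1 + 2 - (k + 3) = r by omega,
    backAux, show k + r + 1 + 2 - r = k + 3 by omega,
    show k + r + 1 + 2 - (r + 1) = k + 2 by omega]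

end LimitNet

section LimitNet

variable {d N J : ℕ} {Y : Type*} {P : Problem d N Y} {Q : ContinuousDNN d N} {Ψ : Trajectory d N}
  {T σ C₁ C₂ C₃ C₄ : ℝ}

lemma isProbabilityMeasure_nodeLaw (hQ : IsContinuousDNN P (J + 2) Q) :
    ∀ k ≤ J + 1, IsProbabilityMeasure (nodeLaw J Q k)
  | 0, _ =>
    have := hQ.prob₁
    isProbabilityMeasure_comap_val (measurableSet_support₁ Q) Measure.support_mem_ae
  | k + 1, hk =>
    have := hQ.prob (k + 2) (Finset.mem_Icc.2 ⟨by omega, by omega⟩)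
    isProbabilityMeasure_comap_val (measurableSet_nodeSet J Q k) (nodeSet_mem_ae J Q k)

/-- A bound for the exponential moments of the node sizes. -/
def expMoment (d N : ℕ) (σ : ℝ) : ℝ := Real.exp (1 / σ ^ 2) * (1 + (d + N) * Real.exp 1)

lemma exp_nodeSize (hσ : 0 < σ) (hQ : IsContinuousDNN P (J + 2) Q)
    (hI : InitAssumption (J + 2) Q σ C₁ C₂ C₃ C₄) : ∀ k ≤ J + 1,
    Integrable (fun z => Real.exp (1 / (2 * σ ^ 2) * nodeSize J Q k z ^ 2)) (nodeLaw J Q k) ∧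
      ∫ z, Real.exp (1 / (2 * σ ^ 2) * nodeSize J Q k z ^ 2) ∂(nodeLaw J Q k)
        ≤ expMoment d N σ
  | 0, _ => by
    have := hQ.prob₁
    obtain ⟨h1, h2⟩ := hI.subGaussian₁.integrable_exp_norm hσ
    refine ⟨integrable_comap_val (measurableSet_support₁ Q) Measure.support_mem_ae h1, ?_⟩
    refine (integral_nodeLaw_zero (J := J) _).trans_le (h2.trans ?_)
    unfold expMoment
    gcongr
    simp
  | k + 1, hk => by
    have hmem : k + 2 ∈ Finset.Icc 2 (J + 2) := Finset.mem_Icc.2 ⟨by omega, by omega⟩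
    have := hQ.prob (k + 2) hmem
    obtain ⟨h1, h2⟩ := (hI.subGaussian _ hmem).integrable_exp_norm hσ
    refine ⟨integrable_comap_val (measurableSet_nodeSet J Q k) (nodeSet_mem_ae J Q k) h1, ?_⟩
    refine (integral_nodeLaw_succ (J := J) k _).trans_le (h2.trans ?_)
    unfold expMoment
    gcongr
    simp

lemma one_le_nodeSize : ∀ k z, 1 ≤ nodeSize J Q k z
  | 0, (z : Q.p₁.support) => le_add_of_nonneg_right (norm_nonneg z.1)
  | _ + 1, (z : nodeSet J Q _) => le_add_of_nonneg_right (norm_nonneg z.1)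

lemma measurable_nodeSize : ∀ k, Measurable (nodeSize J Q k)
  | 0 => measurable_const.add (measurable_norm.comp measurable_subtype_coe)
  | _ + 1 => measurable_const.add (measurable_norm.comp measurable_subtype_coe)

variable (J Q) in
/-- The identification of a node space with the support of the law of the features. -/
def toSupport {k : ℕ} (hk : k ≤ J) (z : nodeSet J Q k) : (Q.p (k + 2)).support :=
  ⟨z.1, mem_support_of_nodeSet hk z⟩

lemma measurable_toSupport {k : ℕ} (hk : k ≤ J) : Measurable (toSupport J Q hk) :=
  measurable_subtype_coe.subtype_mk

lemma zero_mem_Icc (hT : 0 ≤ T) : (0 : ℝ) ∈ Icc 0 T := ⟨le_rfl, hT⟩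

section Initial

variable (hT : 0 ≤ T) (hΨ : IsNeuralFeatureFlow P (J + 2) Q T Ψ)
include hT hΨ

lemma w₁_zero (z : Q.p₁.support) : Ψ.w₁ z.1 0 = z.1 := by
  rw [hΨ.flow_w₁ 0 (zero_mem_Icc hT) z.1 z.2, intervalIntegral.integral_same, sub_zero]

lemma θ_zero {k : ℕ} (hk : k ≤ J) (z : nodeSet J Q k) : Ψ.θ (k + 2) z.1 0 = z.1 := by
  rw [hΨ.flow_θ 0 (zero_mem_Icc hT) (k + 2) (Finset.mem_Icc.2 ⟨by omega, by omega⟩) z.1 (z.2 hk),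
    intervalIntegral.integral_same, sub_zero]

lemma w₂_zero (z : Q.p₁.support) (z' : nodeSet J Q 0) :
    Ψ.w₂ z.1 z'.1 0 = Q.w₂ z.1 z'.1 := by
  rw [hΨ.flow_w₂ 0 (zero_mem_Icc hT) z.1 z.2 z'.1 (z'.2 (Nat.zero_le _)),
    intervalIntegral.integral_same, sub_zero]

lemma w_zero {k : ℕ} (hk : k < J) (z : nodeSet J Q k) (z' : nodeSet J Q (k + 1)) :
    Ψ.w (k + 3) z.1 z'.1 0 = Q.w (k + 3) z.1 z'.1 := by
  rw [hΨ.flow_w 0 (zero_mem_Icc hT) (k + 3) (Finset.mem_Icc.2 ⟨by omega, by omega⟩) z.1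
    (z.2 hk.le) z'.1 (z'.2 hk), intervalIntegral.integral_same, sub_zero]

lemma wOut_zero (z : nodeSet J Q J) : Ψ.wOut z.1 0 = Q.wOut z.1 := by
  rw [hΨ.flow_wOut 0 (zero_mem_Icc hT) z.1 (z.2 le_rfl), intervalIntegral.integral_same, sub_zero]

end Initial

/-- The neural feature flow is a flow of the associated limit network. -/
theorem limitNet_isFlow {B L₁ L₂ L₃ L₄ L₅ c : ℝ} (hT : 0 ≤ T) (hσ : 0 < σ)
    (hh : ActivationAssumption P.h L₁ L₂ L₃) (hφ : LossAssumption P.φ L₄ L₅)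
    (hX : ∀ n i, |P.X n i| ≤ B) (hQ : IsContinuousDNN P (J + 2) Q)
    (hI : InitAssumption (J + 2) Q σ C₁ C₂ C₃ C₄) (hΨ : IsNeuralFeatureFlow P (J + 2) Q T Ψ)
    (hc : 1 ≤ c) (hTc : T ≤ c) (hB : B ≤ c) (h₁ : L₁ ≤ c) (h₂ : L₂ ≤ c) (h₃ : L₃ ≤ c)
    (h₄ : L₄ ≤ c) (h₅ : L₅ ≤ c) (hC₁ : C₁ ≤ c) (hC₃ : C₃ ≤ c)
    (hm : expMoment d N σ / (1 / (2 * σ ^ 2)) ≤ c) :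
    (limitNet P J Q Ψ).IsFlow c T where
  one_le := hc
  T_nonneg := hT
  T_le := hTc
  h_diff := hh.differentiable
  h_bound y := (hh.bound y).trans h₁
  h'_bound y := (hh.deriv_bound y).trans h₂
  h'_lip y y' := (hh.deriv_lipschitz y y').trans (by gcongr)
  ψ_bound n y := (hφ.deriv_bound (P.y n) y).trans h₄
  ψ_lip n y y' := (hφ.deriv_lipschitz (P.y n) y y').trans (by gcongr)
  X_bound n i := (hX n i).trans hB
  prob := isProbabilityMeasure_nodeLaw hQ
  a_meas k _ := measurable_nodeSize k
  one_le_a := one_le_nodeSize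
  -- Squared sizes are dominated by their exponentials through `q ≤ exp(β q) / β`, with `β = 1 / (2
  -- σ²)`; the same inequality yields the second-moment constant.
  a2_int k hk := by
    have h := exp_nodeSize hσ hQ hI k hk
    refine (h.1.div_const (1 / (2 * σ ^ 2))).mono'
      ((measurable_nodeSize k).pow_const 2).aestronglyMeasurable (ae_of_all _ fun z => ?_)
    rw [Real.norm_of_nonneg (sq_nonneg _)]
    exact le_exp_mul_div (by positivity) _
  a2_le k hk := by
    have h := exp_nodeSize hσ hQ hI k hk
    refine (le_abs_self _).trans ((abs_integral_le_of_exp (β := 1 / (2 * σ ^ 2)) (by positivity)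
      (fun z => ?_) h.1 h.2).trans hm)
    exact (abs_of_nonneg (sq_nonneg _)).le
  x_cont
    | 0, _, (z : Q.p₁.support), n => by
      have h := continuousOn_pi.1 (hΨ.continuous_w₁ z.1 z.2)
      exact continuousOn_const.mul (continuousOn_finsetSum _ fun i _ =>
        continuousOn_const.mul (h i))
    | k + 1, hk, (z : nodeSet J Q k), n =>
      continuousOn_pi.1 (hΨ.continuous_θ (k + 2) (Finset.mem_Icc.2 ⟨by omega, by omega⟩) z.1
        (z.2 (by omega))) n
  x_meas
    | 0, _, t, ht, n => by
      have h := measurable_pi_iff.1 (hΨ.measurable_w₁ t ht)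
      exact measurable_const.mul (Finset.measurable_sum _ fun i _ => measurable_const.mul (h i))
    | k + 1, hk, t, ht, n =>
      measurable_pi_iff.1 ((hΨ.measurable_θ (k + 2) (Finset.mem_Icc.2 ⟨by omega, by omega⟩)
        t ht).comp (measurable_toSupport (J := J) (by omega))) n
  w_cont
    | 0, _, (z : Q.p₁.support), (z' : nodeSet J Q 0) =>
      hΨ.continuous_w₂ z.1 z.2 z'.1 (z'.2 (Nat.zero_le _))
    | k + 1, hk, (z : nodeSet J Q k), (z' : nodeSet J Q (k + 1)) =>
      hΨ.continuous_w (k + 3) (Finset.mem_Icc.2 ⟨by omega, by omega⟩) z.1 (z.2 (by omega)) z'.1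
        (z'.2 (by omega))
  w_meas
    | 0, _, t, ht =>
      (hΨ.measurable_w₂ t ht).comp
        (measurable_fst.prodMk ((measurable_toSupport (Nat.zero_le J)).comp measurable_snd))
    | k + 1, hk, t, ht =>
      (hΨ.measurable_w (k + 3) (Finset.mem_Icc.2 ⟨by omega, by omega⟩) t ht).comp
        (((measurable_toSupport (J := J) (k := k) (by omega)).comp measurable_fst).prodMk
          ((measurable_toSupport (J := J) (k := k + 1) (by omega)).comp measurable_snd))
  v_cont := fun (z : nodeSet J Q J) => hΨ.continuous_wOut z.1 (z.2 le_rfl)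
  v_meas t ht := (hΨ.measurable_wOut t ht).comp (measurable_toSupport le_rfl)
  w_init
    | 0, _, (z : Q.p₁.support), (z' : nodeSet J Q 0) => by
      change |Ψ.w₂ z.1 z'.1 0| ≤ c * (1 + ‖z'.1‖)
      rw [w₂_zero hT hΨ]
      refine (hI.growth₂ z.1 z.2 z'.1 (z'.2 (Nat.zero_le _))).trans ?_
      gcongr
    | k + 1, hk, (z : nodeSet J Q k), (z' : nodeSet J Q (k + 1)) => by
      change |Ψ.w (k + 3) z.1 z'.1 0| ≤ c * (1 + ‖z'.1‖)
      rw [w_zero hT hΨ (by omega)]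
      refine (hI.growth (k + 3) (Finset.mem_Icc.2 ⟨by omega, by omega⟩) z.1 (z.2 (by omega)) z'.1
        (z'.2 (by omega))).trans ?_
      gcongr
  v_init := fun (z : nodeSet J Q J) => by
    change |Ψ.wOut z.1 0| ≤ c
    rw [wOut_zero hT hΨ]
    exact (hI.boundOut z.1 (z.2 le_rfl)).trans hC₃
  D_top t _ := fun (z : nodeSet J Q J) n => by
    rw [limitNet_dOut]
    change back P (J + 2) Q Ψ t (J + 2) z.1 n = _
    rw [back, Nat.sub_self]
    rfl
  D_succ
    | t, _, 0, _, (z : Q.p₁.support), n => limitNet_D_zero z t n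
    | t, _, k + 1, hk, (z : nodeSet J Q k), n => limitNet_D_succ (by omega) z t n
  x_zero _ _ _ _ := rfl
  fwd_init
    | 0, _, (z' : nodeSet J Q 0), n => by
      change Ψ.θ 2 z'.1 0 n = ∫ z : Q.p₁.support,
        Ψ.w₂ z.1 z'.1 0 * P.h (firstFeature P (Ψ.w₁ z.1 0) n) ∂(nodeLaw J Q 0)
      rw [θ_zero hT hΨ (Nat.zero_le J) z', ← (hQ.forward₂ z'.1 (z'.2 (Nat.zero_le _)) n).2,
        ← integral_nodeLaw_zero (J := J)]
      refine integral_congr_ae (ae_of_all _ fun (z : Q.p₁.support) => ?_)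
      simp only [w₂_zero hT hΨ, w₁_zero hT hΨ]
    | k + 1, hk, (z' : nodeSet J Q (k + 1)), n => by
      have hk' : k < J := by omega
      change Ψ.θ (k + 3) z'.1 0 n = ∫ z : nodeSet J Q k,
        Ψ.w (k + 3) z.1 z'.1 0 * P.h (Ψ.θ (k + 2) z.1 0 n) ∂(nodeLaw J Q (k + 1))
      have h := (hQ.forward (k + 3) (Finset.mem_Icc.2 ⟨by omega, by omega⟩) z'.1 (z'.2 hk') n).2
      rw [θ_zero hT hΨ (k := k + 1) hk' z', ← h]
      refine Eq.trans (integral_nodeLaw_succ (J := J) k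
        fun θ' => Q.w (k + 3) θ' z'.1 * P.h (θ' n)).symm ?_
      refine integral_congr_ae (ae_of_all _ fun (z : nodeSet J Q k) => ?_)
      simp only [w_zero hT hΨ hk', θ_zero hT hΨ hk'.le]
  flow_u t ht := fun (z : Q.p₁.support) => by
    change Ψ.w₁ z.1 t = Ψ.w₁ z.1 0 - ∫ s in (0 : ℝ)..t, gradFirst P (J + 2) Q Ψ s z.1
    rw [w₁_zero hT hΨ]
    exact hΨ.flow_w₁ t ht z.1 z.2
  flow_x t ht k hk := fun (z : nodeSet J Q k) => by
    have hk' : k ≤ J := by omega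
    simp only [limitNet_Γ_succ]
    change Ψ.θ (k + 2) z.1 t = Ψ.θ (k + 2) z.1 0 - _
    rw [θ_zero hT hΨ hk']
    exact hΨ.flow_θ t ht (k + 2) (Finset.mem_Icc.2 ⟨by omega, by omega⟩) z.1 (z.2 hk')
  flow_w
    | t, ht, 0, _, (z : Q.p₁.support), (z' : nodeSet J Q 0) => by
      change Ψ.w₂ z.1 z'.1 t = Ψ.w₂ z.1 z'.1 0
        - ∫ s in (0 : ℝ)..t, gradSecond P (J + 2) Q Ψ s z.1 z'.1
      rw [w₂_zero hT hΨ]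
      exact hΨ.flow_w₂ t ht z.1 z.2 z'.1 (z'.2 (Nat.zero_le _))
    | t, ht, k + 1, hk, (z : nodeSet J Q k), (z' : nodeSet J Q (k + 1)) => by
      change Ψ.w (k + 3) z.1 z'.1 t = Ψ.w (k + 3) z.1 z'.1 0
        - ∫ s in (0 : ℝ)..t, gradMid P (J + 2) Q Ψ s (k + 3) z.1 z'.1
      rw [w_zero hT hΨ (by omega)]
      exact hΨ.flow_w t ht (k + 3) (Finset.mem_Icc.2 ⟨by omega, by omega⟩) z.1 (z.2 (by omega))
        z'.1 (z'.2 (by omega))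
  flow_v t ht := fun (z : nodeSet J Q J) => by
    simp only [limitNet_gOut]
    change Ψ.wOut z.1 t = Ψ.wOut z.1 0 - _
    rw [wOut_zero hT hΨ]
    exact hΨ.flow_wOut t ht z.1 (z.2 le_rfl)

end LimitNet

/-! ### Ideal nodes as a sample of the limit network -/

section Sample

variable {d N m J : ℕ} {Y Ω : Type*} [MeasurableSpace Ω] {P : Problem d N Y}
  {Q : ContinuousDNN d N} {σ C₁ C₂ C₃ C₄ ε : ℝ} {μ : Measure Ω}
  {W : Ω → Weights d m} {u : Fin m → Ω → Fin d → ℝ} {θ : ℕ → Fin m → Ω → Fin N → ℝ}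

/-- The index of an ideal node in the independent family of all ideal nodes. -/
def nodeIndex (J : ℕ) {m : ℕ} : ∀ k, k ≤ J + 1 → Fin m → Fin m ⊕ Finset.Icc 2 (J + 2) × Fin m
  | 0, _, i => Sum.inl i
  | k + 1, hk, i => Sum.inr (⟨k + 2, Finset.mem_Icc.2 ⟨by omega, by omega⟩⟩, i)

lemma nodeIndex_injective : ∀ k hk, Function.Injective (nodeIndex J (m := m) k hk)
  | 0, _ => Sum.inl_injective
  | _ + 1, _ => fun _ _ h => (Prod.ext_iff.1 (Sum.inr_injective h)).2

lemma nodeIndex_ne : ∀ k hk k' hk' (i j : Fin m), k ≠ k' → nodeIndex J k hk i ≠ nodeIndex J k' hk' j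
  | 0, _, 0, _, _, _, h => absurd rfl h
  | 0, _, _ + 1, _, _, _, _ => Sum.inl_ne_inr
  | _ + 1, _, 0, _, _, _, _ => Sum.inr_ne_inl
  | k + 1, _, k' + 1, _, i, j, h => fun h' => h <| by
    have := congrArg Subtype.val (Prod.ext_iff.1 (Sum.inr_injective h')).1
    simp only at this
    omega

omit [MeasurableSpace Ω] in
lemma comap_comp_le {E F : Type*} [MeasurableSpace E] [MeasurableSpace F] {g : E → F}
    (hg : Measurable g) (f : Ω → E) :
    MeasurableSpace.comap (fun ω => g (f ω)) inferInstance
      ≤ MeasurableSpace.comap f inferInstance := by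
  change MeasurableSpace.comap (g ∘ f) _ ≤ _
  rw [← MeasurableSpace.comap_comp]
  exact MeasurableSpace.comap_mono hg.comap_le

/-- The ideal nodes are a sample of the nodes of the limit network. -/
theorem IsEpsIndependent.exists_isSample {c : ℝ}
    (H : IsEpsIndependent P (J + 2) σ C₁ C₂ C₃ C₄ ε μ W Q u θ) (Ψ : Trajectory d N) (hσ : 0 < σ)
    (hc : expMoment d N σ ≤ c) :
    ∃ Z : ∀ k, Fin m → Ω → NodeSpace J Q k,
      (limitNet P J Q Ψ).IsSample (1 / (2 * σ ^ 2)) c μ Z ∧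
      (∀ i ω (h : u i ω ∈ Q.p₁.support), Z 0 i ω = (⟨u i ω, h⟩ : Q.p₁.support)) ∧
      ∀ k i ω (h : θ (k + 2) i ω ∈ nodeSet J Q k),
        Z (k + 1) i ω = (⟨θ (k + 2) i ω, h⟩ : nodeSet J Q k) := by
  have hQ := H.isContinuousDNN
  obtain ⟨g₁, hg₁, hg₁s⟩ :=
    exists_measurable_retraction (measurableSet_support₁ Q) (support₁_nonempty (J := J) P hQ)
  choose g hg hgs using fun k =>
    exists_measurable_retraction (measurableSet_nodeSet J Q k) (nodeSet_nonempty P hQ k)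
  -- Retracting each ideal node places it in its node space at every sample point, not just almost
  -- surely. A measurable function of a node generates a smaller σ-algebra, so independence is
  -- inherited.
  let Z : ∀ k, Fin m → Ω → NodeSpace J Q k := fun k =>
    match k with
    | 0 => fun i ω => g₁ (u i ω)
    | k + 1 => fun i ω => g k (θ (k + 2) i ω)
  have hmem : ∀ k, k + 1 ≤ J + 1 → k + 2 ∈ Finset.Icc 2 (J + 2) :=
    fun k hk => Finset.mem_Icc.2 ⟨by omega, by omega⟩
  set F := Sum.elim (fun i : Fin m => MeasurableSpace.comap (u i) inferInstance)
    (fun q : Finset.Icc 2 (J + 2) × Fin m => MeasurableSpace.comap (θ q.1 q.2) inferInstance)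
    with hF
  have hle : ∀ q, F q ≤ ‹MeasurableSpace Ω› := by
    rintro (i | q)
    · exact (H.measurable₁ i).comap_le
    · exact (H.measurable _ q.1.2 q.2).comap_le
  have hZ : ∀ k hk i, MeasurableSpace.comap (Z k i) inferInstance ≤ F (nodeIndex J k hk i)
    | 0, _, i => comap_comp_le hg₁ (u i)
    | k + 1, _, i => comap_comp_le (hg k) (θ (k + 2) i)
  refine ⟨Z, ?_, fun i ω h => hg₁s _ h, fun k i ω h => hgs k _ h⟩
  refine
    { meas := ?_
      law := ?_
      indep := fun k hk => iIndepFun_of_comap_le H.indep (nodeIndex_injective k hk) (hZ k hk)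
      indep_up := fun k hk j => ?_
      indep_down := fun k hk i => ?_
      exp_int := fun k hk => (exp_nodeSize hσ hQ H.initAssumption k hk).1
      exp_le := fun k hk => (exp_nodeSize hσ hQ H.initAssumption k hk).2.trans hc }
  · rintro (_ | k) hk i
    · exact hg₁.comp (H.measurable₁ i)
    · exact (hg k).comp (H.measurable _ (hmem k hk) i)
  · rintro (_ | k) hk i
    · change μ.map (g₁ ∘ u i) = Q.p₁.comap Subtype.val
      rw [← Measure.map_map hg₁ (H.measurable₁ i), H.law₁ i]
      exact map_retraction (measurableSet_support₁ Q) Measure.support_mem_ae hg₁ hg₁s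
    · change μ.map (g k ∘ θ (k + 2) i) = (Q.p (k + 2)).comap Subtype.val
      rw [← Measure.map_map (hg k) (H.measurable _ (hmem k hk) i), H.law _ (hmem k hk) i]
      exact map_retraction (measurableSet_nodeSet J Q k) (nodeSet_mem_ae J Q k) (hg k) (hgs k)
  -- A node of one layer and all nodes of a neighbouring layer occupy disjoint sets of indices in
  -- the independent family.
  · refine indepFun_of_comap_le H.indep hle (g := nodeIndex J k hk.le) ?_
      (hZ (k + 1) hk j) (hZ k hk.le)
    rintro ⟨i, hi⟩
    exact nodeIndex_ne k hk.le (k + 1) hk i j (by omega) hi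
  · refine indepFun_of_comap_le H.indep hle (g := nodeIndex J (k + 1) hk) ?_
      (hZ k hk.le i) (hZ (k + 1) hk)
    rintro ⟨j, hj⟩
    exact nodeIndex_ne (k + 1) hk k hk.le j i (by omega) hj

/-- Almost surely all ideal nodes lie in the supports. -/
lemma IsEpsIndependent.ae_mem_support
    (H : IsEpsIndependent P (J + 2) σ C₁ C₂ C₃ C₄ ε μ W Q u θ) :
    ∀ᵐ ω ∂μ, (∀ i, u i ω ∈ Q.p₁.support) ∧
      ∀ k i, θ (k + 2) i ω ∈ nodeSet J Q k := by
  refine (ae_all_iff.2 fun i => ?_).and (ae_all_iff.2 fun k => ae_all_iff.2 fun i => ?_)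
  · refine ae_of_ae_map (p := fun x => x ∈ Q.p₁.support) (H.measurable₁ i).aemeasurable ?_
    rw [H.law₁ i]
    exact Measure.support_mem_ae
  · by_cases hk : k ≤ J
    · have hmem : k + 2 ∈ Finset.Icc 2 (J + 2) := Finset.mem_Icc.2 ⟨by omega, by omega⟩
      refine ae_of_ae_map (p := fun x => x ∈ nodeSet J Q k) (H.measurable _ hmem i).aemeasurable ?_
      rw [H.law _ hmem i]
      exact nodeSet_mem_ae J Q k
    · exact ae_of_all _ fun ω h => absurd h hk

end Sample

/-! ### From weighted closeness to the stated bounds -/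

section Final

variable {d N m J : ℕ} {Y : Type*} {P : Problem d N Y} {Q : ContinuousDNN d N}
  {Ψ : Trajectory d N} {T r A ε t : ℝ} {W : Weights d m}
  {u : Fin m → Fin d → ℝ} {θ : ℕ → Fin m → Fin N → ℝ}

/-- The nodes of the limit network given by points of the supports. -/
def nodes (hu : ∀ i, u i ∈ Q.p₁.support) (hθ : ∀ k i, θ (k + 2) i ∈ nodeSet J Q k) :
    ∀ k, Fin m → NodeSpace J Q k
  | 0 => fun i => (⟨u i, hu i⟩ : Q.p₁.support)
  | k + 1 => fun i => (⟨θ (k + 2) i, hθ k i⟩ : nodeSet J Q k)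

variable {hu : ∀ i, u i ∈ Q.p₁.support} {hθ : ∀ k i, θ (k + 2) i ∈ nodeSet J Q k}

/-- An initialization close to the ideal nodes is close to the ideal network at time `0`. -/
lemma isClose_zero (hT : 0 ≤ T) (hε : 0 ≤ ε) (hΨ : IsNeuralFeatureFlow P (J + 2) Q T Ψ)
    (h₁ : ∀ i, ‖(fun a => W.w₁ a i) - u i‖ ≤ (1 + ‖u i‖) * ε)
    (h₂ : ∀ i j, |W.w 2 i j - Q.w₂ (u i) (θ 2 j)| ≤ (1 + ‖u i‖ + ‖θ 2 j‖) * ε)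
    (h : ∀ ℓ ∈ Finset.Icc 3 (J + 2), ∀ i j, |W.w ℓ i j - Q.w ℓ (θ (ℓ - 1) i) (θ ℓ j)|
      ≤ (1 + ‖θ (ℓ - 1) i‖ + ‖θ ℓ j‖) * ε)
    (hOut : ∀ i, |W.wOut i - Q.wOut (θ (J + 2) i)| ≤ (1 + ‖θ (J + 2) i‖) * ε) :
    ((limitNet P J Q Ψ).ideal (nodes hu hθ) 0).IsClose (J + 1) W ε := by
  -- The initialization error is additive in the two node norms; the product of sizes dominates it,
  -- which puts it in the norm used for tracking.
  have hprod : ∀ x y : ℝ, 0 ≤ x → 0 ≤ y → (1 + x + y) * ε ≤ ε * ((1 + x) * (1 + y)) := by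
    intro x y hx hy
    nlinarith [mul_nonneg (mul_nonneg hx hy) hε]
  refine ⟨hε, fun l i => ?_, ?_, fun i => ?_⟩
  · change |Ψ.w₁ (u i) 0 l - W.w₁ l i| ≤ ε * (1 + ‖u i‖)
    rw [w₁_zero hT hΨ ⟨u i, hu i⟩, abs_sub_comm, mul_comm]
    exact (norm_le_pi_norm ((fun a => W.w₁ a i) - u i) l).trans (h₁ i)
  · rintro (_ | k) hk i j
    · change |Ψ.w₂ (u i) (θ 2 j) 0 - W.w 2 i j| ≤ ε * ((1 + ‖u i‖) * (1 + ‖θ 2 j‖))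
      rw [w₂_zero hT hΨ ⟨u i, hu i⟩ ⟨θ 2 j, hθ 0 j⟩, abs_sub_comm]
      exact (h₂ i j).trans (hprod _ _ (norm_nonneg _) (norm_nonneg _))
    · change |Ψ.w (k + 3) (θ (k + 2) i) (θ (k + 3) j) 0 - W.w (k + 3) i j|
        ≤ ε * ((1 + ‖θ (k + 2) i‖) * (1 + ‖θ (k + 3) j‖))
      rw [w_zero hT hΨ (by omega) ⟨θ (k + 2) i, hθ k i⟩ ⟨θ (k + 3) j, hθ (k + 1) j⟩, abs_sub_comm]
      exact (h (k + 3) (Finset.mem_Icc.2 ⟨by omega, by omega⟩) i j).trans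
        (hprod _ _ (norm_nonneg _) (norm_nonneg _))
  · change |Ψ.wOut (θ (J + 2) i) 0 - W.wOut i| ≤ ε * (1 + ‖θ (J + 2) i‖)
    rw [wOut_zero hT hΨ ⟨θ (J + 2) i, hθ J i⟩, abs_sub_comm, mul_comm]
    exact hOut i

/-- Closeness to the ideal network of typical nodes gives the tracking bounds. -/
lemma isTrackedWithin_of_isClose (hr : 1 ≤ r) (hA : 0 ≤ A)
    (ha : ∀ k ≤ J + 1, ∀ i, nodeSize J Q k (nodes hu hθ k i) ≤ r)
    (hW : ((limitNet P J Q Ψ).ideal (nodes hu hθ) t).IsClose (J + 1) W A)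
    (hG : ((limitNet P J Q Ψ).ideal (nodes hu hθ) t).IsGradClose P (J + 1) W A) :
    IsTrackedWithin P (J + 2) Ψ u θ W t (A * r ^ 2) := by
  -- Quantities of a single node need one factor `r`, connecting weights need two; `1 ≤ r` lets all
  -- share the quadratic bound.
  have hrr : r ≤ r ^ 2 := by nlinarith
  have h1 : ∀ k ≤ J + 1, ∀ i, A * nodeSize J Q k (nodes hu hθ k i) ≤ A * r ^ 2 := fun k hk i =>
    mul_le_mul_of_nonneg_left ((ha k hk i).trans hrr) hA
  have h2 : ∀ k < J + 1, ∀ i j, A * (nodeSize J Q k (nodes hu hθ k i) *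
      nodeSize J Q (k + 1) (nodes hu hθ (k + 1) j)) ≤ A * r ^ 2 := fun k hk i j => by
    have h0 : 0 ≤ nodeSize J Q (k + 1) (nodes hu hθ (k + 1) j) :=
      zero_le_one.trans (one_le_nodeSize _ _)
    rw [pow_two]
    exact mul_le_mul_of_nonneg_left
      (mul_le_mul (ha k hk.le i) (ha (k + 1) hk j) h0 (by linarith)) hA
  have h0 : 0 ≤ A * r ^ 2 := by positivity
  refine ⟨fun i => ?_, fun ℓ hℓ i => ?_, fun i j => ?_, fun ℓ hℓ i j => ?_, fun i => ?_⟩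
  · refine (pi_norm_le_iff_of_nonneg h0).2 fun l => ?_
    have h := hW.w₁ l i
    rw [abs_sub_comm] at h
    exact h.trans (h1 0 (Nat.zero_le _) i)
  · obtain ⟨hℓ1, hℓ2⟩ := Finset.mem_Icc.1 hℓ
    obtain ⟨k, rfl⟩ : ∃ k, ℓ = k + 2 := ⟨ℓ - 2, by omega⟩
    refine (pi_norm_le_iff_of_nonneg h0).2 fun n => ?_
    have h := hG.feature (k + 1) (by omega) i n
    rw [abs_sub_comm] at h
    exact h.trans (h1 (k + 1) (by omega) i)
  · have h := hW.w 0 (Nat.succ_pos J) i j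
    rw [abs_sub_comm] at h
    exact h.trans (h2 0 (Nat.succ_pos J) i j)
  · obtain ⟨hℓ1, hℓ2⟩ := Finset.mem_Icc.1 hℓ
    obtain ⟨k, rfl⟩ : ∃ k, ℓ = k + 3 := ⟨ℓ - 3, by omega⟩
    have h := hW.w (k + 1) (by omega) i j
    rw [abs_sub_comm] at h
    exact h.trans (h2 (k + 1) (by omega) i j)
  · have h := hW.wOut i
    rw [abs_sub_comm] at h
    exact h.trans (h1 (J + 1) le_rfl i)

/-- The loss is Lipschitz in the outputs of the network. -/
lemma abs_discreteLoss_sub_flowLoss_le {L₄ L₅ : ℝ} {L : ℕ} (hφ : LossAssumption P.φ L₄ L₅)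
    (hL₄ : 0 ≤ L₄) (hA : 0 ≤ A) (h : ∀ n, |flowOutput P L Q Ψ t n - output P L W n| ≤ A) :
    |discreteLoss P L W - flowLoss P L Q Ψ t| ≤ L₄ * A := by
  rw [discreteLoss, flowLoss, ← mul_sub, ← Finset.sum_sub_distrib]
  refine abs_avg_le (by positivity) fun n => ?_
  have hlip := Convex.norm_image_sub_le_of_norm_deriv_le (f := fun x => P.φ x (P.y n)) (C := L₄)
    (fun x _ => hφ.differentiable (P.y n) x) (fun x _ => hφ.deriv_bound (P.y n) x) convex_univ
    (mem_univ (flowOutput P L Q Ψ t n)) (mem_univ (output P L W n))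
  refine hlip.trans (mul_le_mul_of_nonneg_left ?_ hL₄)
  rw [Real.norm_eq_abs, abs_sub_comm]
  exact h n

end Final

end DeepMeanField

end

/-! ### Assembly of the main theorem -/

open DeepMeanField in
theorem mainTheorem3
    (L d N : ℕ) (hL : 2 ≤ L) (hd : 0 < d) (hN : 0 < N)
    (T B L₁ L₂ L₃ L₄ L₅ σ C₁ C₂ C₃ C₄ κ : ℝ) (hT : 0 ≤ T) (hB : 0 ≤ B)
    (hL₁ : 0 ≤ L₁) (hL₂ : 0 ≤ L₂) (hL₃ : 0 ≤ L₃) (hL₄ : 0 ≤ L₄) (hL₅ : 0 ≤ L₅)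
    (hσ : 0 < σ) (hC₁ : 0 ≤ C₁) (hC₂ : 0 ≤ C₂) (hC₃ : 0 ≤ C₃) (hC₄ : 0 ≤ C₄) (hκ : 0 < κ) :
    ∃ ε₀ A A' A'' : ℝ, ∃ a b : ℕ, 0 < ε₀ ∧ ε₀ ≤ 1 ∧ 0 < A ∧ 0 < A' ∧ 0 < A'' ∧
      ∀ (Y : Type*) (P : Problem d N Y),
        ActivationAssumption P.h L₁ L₂ L₃ → LossAssumption P.φ L₄ L₅ →
        (∀ n i, |P.X n i| ≤ B) →
      ∀ (ε δ η : ℝ) (m : ℕ), 0 < ε → ε ≤ ε₀ → 0 < δ → δ ≤ 1 →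
        A * (ε ^ 2)⁻¹ * Real.log (Real.exp 1 / (ε * δ)) ^ a ≤ (m : ℝ) →
        0 < η → η ≤ κ * ε →
      ∀ (Ω : Type*) [MeasurableSpace Ω] (μ : MeasureTheory.Measure Ω)
        [MeasureTheory.IsProbabilityMeasure μ]
        (W : Ω → Weights d m) (Q : ContinuousDNN d N)
        (u : Fin m → Ω → Fin d → ℝ) (θ : ℕ → Fin m → Ω → Fin N → ℝ),
        IsEpsIndependent P L σ C₁ C₂ C₃ C₄ ε μ W Q u θ →
      ∀ Ψ : Trajectory d N, IsNeuralFeatureFlow P L Q T Ψ →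
      ∃ G : Set Ω, MeasurableSet G ∧ ENNReal.ofReal (1 - δ) ≤ μ G ∧
        ∀ ω ∈ G, ∀ k : ℕ, k ≤ ⌊T / η⌋₊ →
          IsTrackedWithin P L Ψ (fun i => u i ω) (fun ℓ i => θ ℓ i ω)
            (gd P L η (W ω) k) (k * η)
            (A' * ε * Real.log (Real.exp 1 * m / δ) ^ b) ∧
          |discreteLoss P L (gd P L η (W ω) k) - flowLoss P L Q Ψ (k * η)| ≤ A'' * ε := by

  obtain ⟨J, rfl⟩ : ∃ J, L = J + 2 := ⟨L - 2, by omega⟩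
  have hM₀ : 0 < expMoment d N σ := by unfold expMoment; positivity
  have hβ : 0 < 1 / (2 * σ ^ 2) := by positivity
  have hM₁ : 0 < expMoment d N σ / (1 / (2 * σ ^ 2)) := div_pos hM₀ hβ
  -- A single constant dominating all parameters of the flow, the exponential moment of the sizes,
  -- and the bound on second moments derived from it. The regularity theorem then enlarges it once
  -- to `c`.
  set c₀ := 1 + T + B + L₁ + L₂ + L₃ + L₄ + L₅ + C₁ + C₃ + expMoment d N σ
    + expMoment d N σ / (1 / (2 * σ ^ 2)) with hc₀
  obtain ⟨c, hcc, hreg⟩ := LimitNet.exists_isRegular d N (J + 1) c₀ T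
  have hc : 1 ≤ c := by linarith
  obtain ⟨A, C, R, hA, hC, hR, htyp⟩ :=
    LimitNet.exists_isTypical d N (J + 1) c T (1 / (2 * σ ^ 2)) hc hT hβ
  obtain ⟨ε₀, A₁, hε₀, hε₀1, hA₁, htrack⟩ := LimitNet.exists_tracking d N (J + 1) c T C κ hd hc hC hκ
  -- The width condition needs one logarithm, the tracking bounds two, one for each node of a
  -- connecting weight. Using `R + 1` in place of `R` ensures that the bound on the sizes is at
  -- least `1`. In `c * A₁` the factor `c` is the Lipschitz constant of the loss.
  refine ⟨ε₀, A, A₁ * (R + 1) ^ 2, c * A₁, 1, 2, hε₀, hε₀1, hA, by positivity, by positivity, ?_⟩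
  intro Y P hh hφ hX ε δ η m hε hεε hδ hδ1 hm hη hηκ Ω _ μ _ W Q u θ hW Ψ hΨ
  have hε1 : ε ≤ 1 := hεε.trans hε₀1
  rw [pow_one] at hm
  have hlog : 1 ≤ Real.log (Real.exp 1 / (ε * δ)) := by
    have h := one_le_log le_rfl (mul_pos hε hδ) (mul_le_one₀ hε1 hδ.le hδ1)
    rwa [mul_one] at h
  have hm0 : 0 < m := by
    have : (0 : ℝ) < m := lt_of_lt_of_le (by positivity) hm
    exact_mod_cast this
  have hflow := limitNet_isFlow hT hσ hh hφ hX hW.isContinuousDNN hW.initAssumption hΨ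
    (c := c₀) (by linarith) (by linarith) (by linarith) (by linarith) (by linarith) (by linarith)
    (by linarith) (by linarith) (by linarith) (by linarith) (by linarith)
  have hregular := hreg _ hflow
  have hact : ActivationAssumption P.h c c c :=
    ⟨hh.differentiable, fun x => (hh.bound x).trans (by linarith),
      fun x => (hh.deriv_bound x).trans (by linarith), fun x y => (hh.deriv_lipschitz x y).trans
        (mul_le_mul_of_nonneg_right (by linarith) (abs_nonneg _))⟩
  have hloss : LossAssumption P.φ c c :=
    ⟨hφ.differentiable, fun y x => (hφ.deriv_bound y x).trans (by linarith),
      fun y x x' => (hφ.deriv_lipschitz y x x').trans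
        (mul_le_mul_of_nonneg_right (by linarith) (abs_nonneg _))⟩
  obtain ⟨Z, hZ, hZ₀, hZs⟩ := hW.exists_isSample Ψ hσ (c := c) (by linarith)
  obtain ⟨E, hE, hEtyp⟩ := htyp _ hregular Ω μ m Z hZ ε δ hε hε1 hδ hδ1 hm
  have hgood := hW.ae_mem_support.and (hW.close₁.and (hW.close₂.and (hW.close.and hW.closeOut)))
  rw [ae_iff] at hgood
  set E' := {ω | ¬ _} with hE'
  -- Neither the atypical event nor the null exceptional set is known to be measurable, so the good
  -- event is the complement of a measurable hull, which has the same measure as their union.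
  refine ⟨(toMeasurable μ (E ∪ E'))ᶜ, (measurableSet_toMeasurable _ _).compl, ?_, ?_⟩
  · rw [prob_compl_eq_one_sub (measurableSet_toMeasurable _ _), measure_toMeasurable,
      ENNReal.ofReal_sub _ hδ.le, ENNReal.ofReal_one]
    refine tsub_le_tsub_left ((measure_union_le _ _).trans ?_) _
    rw [hgood, add_zero]
    exact hE
  intro ω hω k hk
  have hωE : ω ∉ E ∪ E' := fun h => hω (subset_toMeasurable _ _ h)
  rw [Set.mem_union, not_or] at hωE
  obtain ⟨⟨hu, hθ⟩, h₁, h₂, h₃, h₄⟩ := not_not.1 hωE.2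
  -- Off the null set every ideal node lies in its support, where the retraction does nothing.
  have hz : (fun k i => Z k i ω) =
      nodes (u := fun i => u i ω) (θ := fun ℓ i => θ ℓ i ω) hu hθ := by
    funext k i
    cases k with
    | zero => exact hZ₀ i ω (hu i)
    | succ k => exact hZs k i ω (hθ k i)
  have hztyp := hEtyp ω hωE.1
  rw [hz] at hztyp
  obtain ⟨hclose, hgrad⟩ := htrack (limitNet P J Q Ψ) P (nodes hu hθ) (W ω) ε η _ hm0 hregular
    (limitNet_matches P J Q Ψ) hact hloss hztyp hε hεε hη hηκ
    (isClose_zero hT hε.le hΨ h₁ h₂ h₃ h₄) k hk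
  have hΛ := one_le_log (m := m) (by exact_mod_cast hm0) hδ hδ1
  set Λ := Real.log (Real.exp 1 * m / δ) with hΛ_def
  refine ⟨?_, ?_⟩
  · have h := isTrackedWithin_of_isClose (r := (R + 1) * Λ) (by nlinarith) (by positivity)
      (fun k hk i => (hztyp.max_le k hk i).trans (by nlinarith)) hclose hgrad
    rwa [show A₁ * ε * ((R + 1) * Λ) ^ 2 = A₁ * (R + 1) ^ 2 * ε * Λ ^ 2 by ring] at h
  · rw [mul_assoc]
    refine abs_discreteLoss_sub_flowLoss_le hloss (by linarith) (by positivity) fun n => ?_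
    have h := hgrad.output n
    rw [← limitNet_out]
    exact h
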